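/- Let $n\ge 3$, $p\ge 2$, let $\Omega\subset\mathbb{R}^n$ be open, and let $u\in C^1(\Omega)$ be positive. For a positive $C^2$ function $\psi$ put $$A^{\psi}=-\tfrac{2}{n-2}\psi^{-\frac{n+2}{n-2}}\nabla^2\psi+\tfrac{2n}{(n-2)^2}\psi^{-\frac{2n}{n-2}}\nabla\psi\otimes\nabla\psi-\tfrac{2}{(n-2)^2}\psi^{-\frac{2n}{n-2}}|\nabla\psi|^2 I ,$$ let $\lambda(M)$ denote the vector of eigenvalues of a symmetric matrix $M$, and let $\bar\Gamma_2$ be the closure of $\Gamma_2=\{\lambda\in\mathbb{R}^n:\sigma_1(\lambda)>0,\ \sigma_2(\lambda)>0\}$. Assume that $\lambda(-A^u)\in\bar\Gamma_2$ in $\Omega$ in the viscosity sense, i.e. $\lambda(-A^\psi(x_0))\in\bar\Gamma_2$ whenever $x_0\in\Omega$, $\psi$ is $C^2$ near $x_0$, $\psi(x_0)=u(x_0)$ and $\psi\ge u$ near $x_0$. Let $\mathring g$ be the Euclidean metric, $g_u=u^{\frac{4}{n-2}}\mathring g$, and let $B$ be the open unit ball of $\mathbb{R}^{n-1}$. (1)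 Let $f:\bar B\to\Omega$ be a $C^1\cap W^{2,p}$ immersion, let $\nu$ be a continuous field along $f$ on $B$ which is $\mathring g$-unit and normal to $f$, and put $\tilde g=f^*\mathring g$, $\tilde u=u\circ f$. Let $H$ and $H_u$ be the mean curvatures (traces of the second fundamental form, as functions on $B$ defined almost everywhere) of $f$ with respect to $\mathring g$ and $g_u$ in the direction $\nu$. Then $$\Delta_{\tilde g}\tilde u+\frac{n-2}{4(n-1)}H_u^2\,\tilde u^{\frac{n+2}{n-2}}-\frac{n-2}{4(n-1)}H^2\,\tilde u-\frac{1}{(n-2)\tilde u}|\nabla_{\tilde g}\tilde u|^2\ \ge\ 0\quad\text{in } B$$ in the weak sense: for every $0\le\varphi\in C^1_c(B)$, writing $R$ for the sum of the last three terms on the left-hand side, the functions $\langle\nabla_{\tilde g}\tilde u,\nabla_{\tilde g}\varphi\rangle_{\tilde g}$ and $R\varphi$ are integrable with respect to $d\mathrm{vol}_{\tilde g}$ and $\int_B\big(-\langle\nabla_{\tilde g}\tilde u,\nabla_{\tilde g}\varphi\rangle_{\tilde g}+R\varphi\big)\,d\mathrm{vol}_{\tilde g}\ge 0$. (2) Let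 $\Sigma\subset\Omega$ be a $C^1\cap W^{2,p}$ embedded hypersurface with or without boundary, with interior $\mathrm{int}(\Sigma)$, and let $\nu$ be a continuous $\mathring g$-unit normal field along $\mathrm{int}(\Sigma)$. Then, with $\tilde g$ the metric induced by $\mathring g$ and $H$, $H_u$ the mean curvatures of $\mathrm{int}(\Sigma)$ with respect to $\mathring g$, $g_u$ in the direction $\nu$, $$\Delta_{\tilde g}u+\frac{n-2}{4(n-1)}H_u^2\,u^{\frac{n+2}{n-2}}-\frac{n-2}{4(n-1)}H^2\,u-\frac{1}{(n-2)u}|\nabla_{\tilde g}u|^2\ \ge\ 0\quad\text{in }\mathrm{int}(\Sigma)$$ in the weak sense, that is, the inequality holds in the sense of (1) in every local parametrization $f:\bar B\to\mathrm{int}(\Sigma)$ which is a $C^1\cap W^{2,p}$ embedding. -/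

import Mathlib

open MeasureTheory Topology
open scoped ContDiff ENNReal

noncomputable section

namespace Obstruction

/-- `ℝᵈ` with its Euclidean norm. -/
abbrev E (d : ℕ) : Type := EuclideanSpace ℝ (Fin d)

/-- The partial derivative `∂ᵢ g (x)`. -/
def pd {d : ℕ} {F : Type*} [NormedAddCommGroup F] [NormedSpace ℝ F]
    (i : Fin d) (g : E d → F) (x : E d) : F :=
  fderiv ℝ g x (EuclideanSpace.single i 1)

/-! ### The conformal Hessian, the cones `Γₖ`, and viscosity sense -/

/-- The elementary symmetric function `σₖ(l)`. -/
def sigma {n : ℕ} (k : ℕ) (l : Fin n → ℝ) : ℝ :=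
  ∑ s ∈ Finset.powersetCard k (Finset.univ : Finset (Fin n)), ∏ i ∈ s, l i

/-- The cone `Γₖ = {σ₁ > 0, …, σₖ > 0}`. -/
def gammaCone (n k : ℕ) : Set (Fin n → ℝ) :=
  {l | ∀ j : ℕ, 1 ≤ j → j ≤ k → 0 < sigma j l}

/-- `λ(M) ∈ C`: the `n` eigenvalues of `M` (counted with multiplicity) are real and, listed in some
order, form a vector of `C`. -/
def EigenvaluesIn {n : ℕ} (M : Matrix (Fin n) (Fin n) ℝ) (C : Set (Fin n → ℝ)) : Prop :=
  ∃ l : Fin n → ℝ, M.charpoly.roots = (Finset.univ : Finset (Fin n)).val.map l ∧ l ∈ C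

/-- The conformal Hessian `A^u` of a positive function `u`, at `x`. -/
def conformalHessian {n : ℕ} (u : E n → ℝ) (x : E n) : Matrix (Fin n) (Fin n) ℝ :=
  Matrix.of fun i j =>
    -(2 / ((n : ℝ) - 2)) * u x ^ (-(((n : ℝ) + 2) / ((n : ℝ) - 2))) * pd i (pd j u) x
      + 2 * (n : ℝ) / ((n : ℝ) - 2) ^ 2 * u x ^ (-(2 * (n : ℝ) / ((n : ℝ) - 2)))
          * (pd i u x * pd j u x)
      - 2 / ((n : ℝ) - 2) ^ 2 * u x ^ (-(2 * (n : ℝ) / ((n : ℝ) - 2)))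
          * (∑ k, pd k u x ^ 2) * (1 : Matrix (Fin n) (Fin n) ℝ) i j

/-- `λ(-A^u) ∈ Γ̄ₖ` in `Ω` in the viscosity sense: whenever a `C²` function `ψ` touches `u` from
above at a point `x₀` of `Ω`, one has `λ(-A^ψ(x₀)) ∈ Γ̄ₖ`. -/
def ViscosityNegCone {n : ℕ} (k : ℕ) (u : E n → ℝ) (Ω : Set (E n)) : Prop :=
  ∀ x₀ ∈ Ω, ∀ ψ : E n → ℝ, ContDiffAt ℝ 2 ψ x₀ → ψ x₀ = u x₀ → (∀ᶠ x in 𝓝 x₀, u x ≤ ψ x) →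
    EigenvaluesIn (-conformalHessian ψ x₀) (closure (gammaCone n k))

/-! ### Riemannian metrics in coordinates and mean curvature -/

/-- A metric on (an open subset of) `ℝⁿ`, given by its coefficients `G_{ab}(x)`. -/
abbrev MetricField (n : ℕ) : Type := E n → Matrix (Fin n) (Fin n) ℝ

/-- The Euclidean metric. -/
def euclideanMetric (n : ℕ) : MetricField n := fun _ => 1

/-- The conformal metric `g_u = u^{4/(n-2)} g₀`, where `g₀` is the Euclidean metric. -/
def conformalMetric {n : ℕ} (u : E n → ℝ) : MetricField n :=
  fun x => u x ^ (4 / ((n : ℝ) - 2)) • (1 : Matrix (Fin n) (Fin n) ℝ)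

/-- The scalar product `G_x(v, w)`. -/
def MetricField.inner {n : ℕ} (G : MetricField n) (x v w : E n) : ℝ :=
  ∑ a, ∑ b, G x a b * v a * w b

/-- The Christoffel symbols `Γᶜ_{ab}` of `G`. -/
def christoffel {n : ℕ} (G : MetricField n) (x : E n) (c a b : Fin n) : ℝ :=
  (1 / 2) * ∑ d, (G x)⁻¹ c d *
    (pd a (fun z => G z b d) x + pd b (fun z => G z a d) x - pd d (fun z => G z a b) x)

/-- The pull-back metric `f^*G`, in the coordinates of the parameter domain. -/
def inducedMetric {m n : ℕ} (G : MetricField n) (f : E m → E n) : MetricField m :=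
  fun y => Matrix.of fun i j => G.inner (f y) (pd i f y) (pd j f y)

/-- The `G`-covariant derivative `∇_{∂ᵢ f} ∂ⱼ f` along `f`, where `Fij` is the value of the second
derivative `∂ᵢ∂ⱼ f` at `y`. -/
def covariantHessian {m n : ℕ} (G : MetricField n) (f : E m → E n) (Fij : E n)
    (i j : Fin m) (y : E m) : E n :=
  Fij + WithLp.toLp 2 fun c => ∑ a, ∑ b, christoffel G (f y) c a b * pd i f y a * pd j f y b

/-- The `G`-unit vector in the direction of `v`. -/
def normalizeIn {n : ℕ} (G : MetricField n) (x v : E n) : E n :=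
  (Real.sqrt (G.inner x v v))⁻¹ • v

/-- The second fundamental form `II(∂ᵢ f, ∂ⱼ f) = G(∇_{∂ᵢ f} N, ∂ⱼ f) = -G(∇_{∂ᵢ f} ∂ⱼ f, N)`
of `f` with respect to `G`, with `N` the `G`-unit vector in the direction of the normal `ν`;
`F i j` stands for the (weak) derivative `∂ᵢ∂ⱼ f`. -/
def secondFundamentalForm {m n : ℕ} (G : MetricField n) (f : E m → E n)
    (F : Fin m → Fin m → E m → E n) (ν : E m → E n) (y : E m) : Matrix (Fin m) (Fin m) ℝ :=
  Matrix.of fun i j =>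
    -G.inner (f y) (covariantHessian G f (F i j y) i j y) (normalizeIn G (f y) (ν y))

/-- The mean curvature, at parameter `y`, of `f` with respect to `G` and the direction `ν`: the
trace of the second fundamental form with respect to the induced metric. -/
def meanCurvature {m n : ℕ} (G : MetricField n) (f : E m → E n)
    (F : Fin m → Fin m → E m → E n) (ν : E m → E n) (y : E m) : ℝ :=
  ((inducedMetric G f y)⁻¹ * secondFundamentalForm G f F ν y).trace

/-! ### Immersions of class `C¹ ∩ W^{2,p}` -/

/-- `h` is the weak partial derivative `∂ⱼ g` in the open set `U`. -/
def IsWeakPartial {m : ℕ} {F : Type*} [NormedAddCommGroup F] [NormedSpace ℝ F]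
    (U : Set (E m)) (j : Fin m) (g h : E m → F) : Prop :=
  LocallyIntegrableOn g U ∧ LocallyIntegrableOn h U ∧
    ∀ φ : E m → ℝ, ContDiff ℝ ∞ φ → HasCompactSupport φ → tsupport φ ⊆ U →
      ∫ y in U, pd j φ y • g y = -∫ y in U, φ y • h y

/-- `f` is a `C¹ ∩ W^{2,p}` immersion of the compact set `K` (a ball or a half-ball) into `ℝⁿ`, with
weak second derivatives `∂ⱼ∂ᵢ f = F i j`. As `K` is compact and `f` is `C¹` on `K`, the functions
`f` and `∂ᵢ f` are bounded on `K`, so that only the second derivatives have to be required to lie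
in `Lᵖ`. -/
structure IsC1W2Immersion {m n : ℕ} (p : ℝ≥0∞) (K : Set (E m)) (f : E m → E n)
    (F : Fin m → Fin m → E m → E n) : Prop where
  contDiffOn : ContDiffOn ℝ 1 f K
  injective : ∀ y ∈ K, Function.Injective (fderivWithin ℝ f K y)
  isWeakPartial : ∀ i j, IsWeakPartial (interior K) j (pd i f) (F i j)
  memLp : ∀ i j, MemLp (F i j) p (volume.restrict (interior K))

/-! ### Weak inequalities -/

/-- The gradient product `⟨∇v, ∇w⟩ = g^{ij} ∂ᵢv ∂ⱼw` with respect to the metric `g`. -/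
def gradInner {m : ℕ} (g : MetricField m) (v w : E m → ℝ) (y : E m) : ℝ :=
  ∑ i, ∑ j, (g y)⁻¹ i j * pd i v y * pd j w y

/-- The volume density `√det g`. -/
def volDensity {m : ℕ} (g : MetricField m) (y : E m) : ℝ := Real.sqrt (g y).det

/-- `Δ_g v + R ≥ 0` in the open set `U` in the weak sense, for `v ∈ C¹(U)`: the pairing with every
non-negative test function is well defined and non-negative. -/
def WeakLaplaceNonneg {m : ℕ} (g : MetricField m) (U : Set (E m)) (v R : E m → ℝ) : Prop :=
  ∀ φ : E m → ℝ, ContDiff ℝ 1 φ → HasCompactSupport φ → tsupport φ ⊆ U → (∀ y, 0 ≤ φ y) →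
    IntegrableOn (fun y => gradInner g v φ y * volDensity g y) U ∧
    IntegrableOn (fun y => R y * φ y * volDensity g y) U ∧
    0 ≤ ∫ y in U, (-gradInner g v φ y + R y * φ y) * volDensity g y

/-- With `ũ = u ∘ f`, `g̃ = f^*g₀` (`g₀` Euclidean), and `H`, `H_u` the mean curvatures of `f` with
respect to `g₀` and `g_u` in the direction `ν`, the inequality
`Δ_g̃ ũ + c H_u² ũ^{(n+2)/(n-2)} - c H² ũ - |∇_g̃ ũ|² / ((n-2) ũ) ≥ 0`, `c = (n-2)/(4(n-1))`,
holds in the open unit ball in the weak sense. -/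
def ObstructionInequality {m n : ℕ} (u : E n → ℝ) (f : E m → E n)
    (F : Fin m → Fin m → E m → E n) (ν : E m → E n) : Prop :=
  WeakLaplaceNonneg (inducedMetric (euclideanMetric n) f) (Metric.ball 0 1) (u ∘ f) fun y =>
    ((n : ℝ) - 2) / (4 * ((n : ℝ) - 1)) * meanCurvature (conformalMetric u) f F ν y ^ 2
        * u (f y) ^ (((n : ℝ) + 2) / ((n : ℝ) - 2))
      - ((n : ℝ) - 2) / (4 * ((n : ℝ) - 1)) * meanCurvature (euclideanMetric n) f F ν y ^ 2
        * u (f y)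
      - 1 / (((n : ℝ) - 2) * u (f y))
        * gradInner (inducedMetric (euclideanMetric n) f) (u ∘ f) (u ∘ f) y

/-! ### Embedded hypersurfaces of class `C¹ ∩ W^{2,p}`, with or without boundary -/

/-- `x` is an interior point of `S`: near `x`, `S` is the image of an open ball under a
`C¹ ∩ W^{2,p}` embedding. -/
def IsInteriorPoint {n : ℕ} (p : ℝ≥0∞) (S : Set (E n)) (x : E n) : Prop :=
  ∃ V : Set (E n), IsOpen V ∧ x ∈ V ∧ ∃ (f : E (n - 1) → E n)
    (F : Fin (n - 1) → Fin (n - 1) → E (n - 1) → E n),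
    IsC1W2Immersion p (Metric.closedBall 0 1) f F ∧ Set.InjOn f (Metric.closedBall 0 1) ∧
    f '' Metric.ball 0 1 = S ∩ V

/-- `x` is a boundary point of `S`: near `x`, `S` is the image of a half-ball under a
`C¹ ∩ W^{2,p}` embedding that maps the origin to `x`. -/
def IsBoundaryPoint {n : ℕ} (p : ℝ≥0∞) (S : Set (E n)) (x : E n) : Prop :=
  ∃ V : Set (E n), IsOpen V ∧ x ∈ V ∧ ∃ (e : E (n - 1)) (f : E (n - 1) → E n)
    (F : Fin (n - 1) → Fin (n - 1) → E (n - 1) → E n), ‖e‖ = 1 ∧ f 0 = x ∧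
    IsC1W2Immersion p (Metric.closedBall 0 1 ∩ {y | 0 ≤ inner ℝ e y}) f F ∧
    Set.InjOn f (Metric.closedBall 0 1 ∩ {y | 0 ≤ inner ℝ e y}) ∧
    f '' (Metric.ball 0 1 ∩ {y | 0 ≤ inner ℝ e y}) = S ∩ V

/-- `S` is a `C¹ ∩ W^{2,p}` embedded hypersurface of `ℝⁿ`, with or without boundary. -/
def IsHypersurface {n : ℕ} (p : ℝ≥0∞) (S : Set (E n)) : Prop :=
  ∀ x ∈ S, IsInteriorPoint p S x ∨ IsBoundaryPoint p S x

/-- The interior `int(S)` of a hypersurface. -/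
def hypersurfaceInterior {n : ℕ} (p : ℝ≥0∞) (S : Set (E n)) : Set (E n) :=
  {x ∈ S | IsInteriorPoint p S x}

/-- `f` is a local parametrization (by the closed unit ball) of class `C¹ ∩ W^{2,p}` of the
interior of `S`. -/
def IsLocalParam {n : ℕ} (p : ℝ≥0∞) (S : Set (E n)) (f : E (n - 1) → E n)
    (F : Fin (n - 1) → Fin (n - 1) → E (n - 1) → E n) : Prop :=
  IsC1W2Immersion p (Metric.closedBall 0 1) f F ∧ Set.InjOn f (Metric.closedBall 0 1) ∧
    Set.MapsTo f (Metric.closedBall 0 1) (hypersurfaceInterior p S)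

/-- `ν` is a continuous unit normal field along the parametrized hypersurface `f`. -/
structure IsUnitNormalAlong {m n : ℕ} (f : E m → E n) (ν : E m → E n) : Prop where
  continuousOn : ContinuousOn ν (Metric.ball 0 1)
  norm_eq_one : ∀ y ∈ Metric.ball (0 : E m) 1, ‖ν y‖ = 1
  normal : ∀ y ∈ Metric.ball (0 : E m) 1, ∀ v : E m, inner ℝ (ν y) (fderiv ℝ f y v) = 0

/-- `ν` is a continuous unit normal field along the interior of the hypersurface `S`. -/
structure IsUnitNormalOn {n : ℕ} (p : ℝ≥0∞) (S : Set (E n)) (ν : E n → E n) : Prop where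
  continuousOn : ContinuousOn ν (hypersurfaceInterior p S)
  norm_eq_one : ∀ x ∈ hypersurfaceInterior p S, ‖ν x‖ = 1
  normal : ∀ f F, IsLocalParam p S f F → ∀ y ∈ Metric.ball (0 : E (n - 1)) 1,
    ∀ v : E (n - 1), inner ℝ (ν (f y)) (fderiv ℝ f y v) = 0

end Obstruction

end

open MeasureTheory Topology
open scoped ContDiff ENNReal

noncomputable section

namespace Obstruction

/-! ### The cone `Γ̄₂` and traces over hyperplanes -/

/-! If `M` is symmetric with eigenvalues in `Γ̄₂`, then `tr M ≥ 0` and `|M|² ≤ (tr M)²`, because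
`2σ₂ = σ₁² - ∑ λᵢ²`. Hence `M(ν,ν) ≤ |M| ≤ tr M` for every unit `ν`: the trace of `M` over any
hyperplane is non-negative (`quadraticForm_le_trace_of_eigenvaluesIn`). Applied to `-A^ψ`, this
replaces the fully nonlinear condition by a family of linear ones, one for each unit `ν`: in the
viscosity sense, `Δ_{ν^⊥} u + (n u_ν² - |∇u|²)/((n-2)u) ≥ 0`, where `Δ_{ν^⊥}` is the trace of the
Hessian over `ν^⊥`. As `u` is `C¹`, the first order term is a given continuous function of the point
and of `ν`.

For smooth data this is already the theorem. With `ν` the normal and `H` the Euclidean mean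
curvature, `Δ_g̃ ũ = Δ_{ν^⊥} u - H u_ν`. The conformal law `H_u = u^{-2/(n-2)} (H +
2(n-1)u_ν/((n-2)u))` makes the `H²` terms cancel, and the curvature and gradient terms of the
inequality add up to `H u_ν + (n u_ν² - |∇u|²)/((n-2)u)` (`obstruction_terms_eq`).

Two difficulties remain. First, `u` is only `C¹`. Comparison on hyperplane slices shows that `u`
lies below harmonic majorants, up to a multiple of `r²` (`le_harmonic_of_viscosity`). This property
describes a closed convex set of functions on a ball, so averaging translates preserves it, and for
a `C²` function it gives back the differential inequality. Mollification therefore yields `C²`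
functions that are `C¹`-close to `u` on compact sets and satisfy the inequality up to `η`, for all
`ν` at once (`exists_smooth_approx`). This uniformity is needed because the normal varies along the
hypersurface.

Second, `f` has only weak second derivatives. The chain rule for weak derivatives, applied to `√g
gⁱʲ ⟨w, ∂ᵢf⟩` as a function of the frame, gives the first variation formula
(`weak_first_variation`). It yields an integrable field `X`, independent of `v`, with `∫ dv(X) = -∫
φ √g Δ_{ν^⊥} v` for all `C²` functions `v` (`integral_fderiv_testField`). The left side involves
only `dv`, so the inequality passes to the `C¹` limit `u` (`integral_fderiv_testField_le`). -/

theorem two_mul_sum_powersetCard_two {ι : Type*} [DecidableEq ι] (s : Finset ι) (l : ι → ℝ) :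
    2 * ∑ t ∈ Finset.powersetCard 2 s, ∏ i ∈ t, l i = (∑ i ∈ s, l i) ^ 2 - ∑ i ∈ s, l i ^ 2 := by
  induction s using Finset.induction_on with
  | empty =>
    have : Finset.powersetCard 2 (∅ : Finset ι) = ∅ := Finset.powersetCard_eq_empty.mpr (by simp)
    simp [this]
  | insert a s ha ih =>
    have hdisj : Disjoint (Finset.powersetCard 2 s)
        ((Finset.powersetCard 1 s).image (insert a)) := by
      rw [Finset.disjoint_left]
      intro t ht ht'
      obtain ⟨t', _, rfl⟩ := Finset.mem_image.mp ht'
      exact ha ((Finset.mem_powersetCard.mp ht).1 (Finset.mem_insert_self a t'))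
    rw [Finset.powersetCard_succ_insert ha, Finset.sum_union hdisj, mul_add, ih,
      Finset.sum_insert ha, Finset.sum_insert ha, Finset.powersetCard_one, Finset.sum_image]
    · rw [Finset.sum_map]
      have : ∀ i ∈ s, ∏ j ∈ insert a ((⟨singleton, Finset.singleton_injective⟩ : ι ↪ Finset ι) i), l j
          = l a * l i := by
        intro i hi
        rw [Finset.prod_insert (by simpa using fun h : a = i => ha (h ▸ hi))]
        simp
      rw [Finset.sum_congr rfl this, ← Finset.mul_sum]
      ring
    · intro x hx y hy hxy
      simp only [Finset.coe_map, Set.mem_image, Finset.mem_coe] at hx hy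
      obtain ⟨i, hi, rfl⟩ := hx
      obtain ⟨j, hj, rfl⟩ := hy
      have h1 := congrArg (fun t : Finset ι => t.erase a) hxy
      have h2 : ∀ i ∈ s, a ∉ ({i} : Finset ι) := fun i hi => by
        simpa using fun h : a = i => ha (h ▸ hi)
      simpa [Finset.erase_insert, Finset.erase_eq_of_notMem, h2 i hi, h2 j hj] using h1

/-- Both inequalities are closed conditions, and on the open cone they are `σ₁ > 0` and `2σ₂ > 0`.
-/
theorem sum_nonneg_of_mem_closure_gammaCone {n : ℕ} {l : Fin n → ℝ}
    (hl : l ∈ closure (gammaCone n 2)) : 0 ≤ ∑ i, l i ∧ ∑ i, l i ^ 2 ≤ (∑ i, l i) ^ 2 := by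
  have hsub : closure (gammaCone n 2) ⊆
      {l | 0 ≤ ∑ i, l i} ∩ {l | ∑ i, l i ^ 2 ≤ (∑ i, l i) ^ 2} := by
    refine closure_minimal (fun l hl => ⟨?_, ?_⟩) (IsClosed.inter ?_ ?_)
    · have h := hl 1 le_rfl (by norm_num)
      simp only [sigma, Finset.powersetCard_one, Finset.sum_map] at h
      simpa using h.le
    · have h := hl 2 (by norm_num) le_rfl
      have h2 := two_mul_sum_powersetCard_two Finset.univ l
      rw [sigma] at h
      simp only [Set.mem_ofPred_eq]
      linarith
    · exact isClosed_le (by fun_prop) (by fun_prop)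
    · exact isClosed_le (by fun_prop) (by fun_prop)
  exact hsub hl

/-- `M(ν,ν)` is the Frobenius product of `M` with `ν ⊗ ν`, hence at most `|M|`, and `|M| ≤ tr M` on
`Γ̄₂`. This is the only way in which the cone enters the proof. -/
theorem quadraticForm_le_trace_of_eigenvaluesIn {n : ℕ} {M : Matrix (Fin n) (Fin n) ℝ}
    (hM : M.IsHermitian) (h : EigenvaluesIn M (closure (gammaCone n 2))) {ν : Fin n → ℝ}
    (hν : ∑ i, ν i ^ 2 = 1) : ∑ i, ∑ j, M i j * (ν i * ν j) ≤ M.trace := by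
  obtain ⟨l, hl, hmem⟩ := h
  -- The vector `l` is a reordering of `hM.eigenvalues`; this is enough, as only symmetric sums of
  -- eigenvalues occur.
  have hroots : (Finset.univ : Finset (Fin n)).val.map l =
      (Finset.univ : Finset (Fin n)).val.map hM.eigenvalues := by
    rw [← hl, hM.roots_charpoly_eq_eigenvalues]; rfl
  have hsum : ∀ g : ℝ → ℝ, ∑ i, g (l i) = ∑ i, g (hM.eigenvalues i) := by
    intro g
    have := congrArg (fun s : Multiset ℝ => (s.map g).sum) hroots
    simp only [Multiset.map_map] at this
    exact this
  obtain ⟨h1, h2⟩ := sum_nonneg_of_mem_closure_gammaCone hmem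
  rw [hsum (fun x => x ^ 2), hsum (fun x => x)] at h2
  rw [hsum (fun x => x)] at h1
  have htr : M.trace = ∑ i, hM.eigenvalues i := by simpa using hM.trace_eq_sum_eigenvalues
  have htr2 : (M * M).trace = ∑ i, hM.eigenvalues i ^ 2 := by
    conv_lhs => rw [hM.spectral_theorem]
    rw [← map_mul, Unitary.conjStarAlgAut_apply, Matrix.trace_mul_comm, ← mul_assoc]
    simp [Matrix.diagonal_mul_diagonal, Matrix.trace, sq]
  have hfrob : (M * M).trace = ∑ i, ∑ j, M i j ^ 2 := by
    simp only [Matrix.trace, Matrix.diag, Matrix.mul_apply]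
    refine Finset.sum_congr rfl fun i _ => Finset.sum_congr rfl fun j _ => ?_
    have : M j i = M i j := by simpa using hM.apply i j
    rw [this, sq]
  have hcs : (∑ i, ∑ j, M i j * (ν i * ν j)) ^ 2 ≤ (∑ i, ∑ j, M i j ^ 2) := by
    have := Finset.sum_mul_sq_le_sq_mul_sq (Finset.univ : Finset (Fin n × Fin n))
      (fun x => M x.1 x.2) (fun x => ν x.1 * ν x.2)
    simp only [Fintype.sum_prod_type] at this
    have h1 : ∑ i, ∑ j, (ν i * ν j) ^ 2 = 1 := by
      simp only [mul_pow, ← Finset.mul_sum, ← Finset.sum_mul, hν, one_mul]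
    rw [h1, mul_one] at this
    exact this
  rw [← htr] at h1 h2
  refine abs_le_of_sq_le_sq' ?_ h1 |>.2
  linarith [hcs, hfrob, htr2]

/-! ### Gram matrices of frames of a hyperplane -/

/-- The Gram matrix of `t`. -/
def gram {m n : ℕ} (t : Fin m → E n) : Matrix (Fin m) (Fin m) ℝ :=
  Matrix.of fun i j => inner ℝ (t i) (t j)

/-- For a frame `t` of the hyperplane `ν^⊥`, one has `∑ gⁱʲ tᵢ ⊗ tⱼ + ν ⊗ ν = I`. -/
theorem sum_gram_inv_add_normal {m n : ℕ} (hmn : m + 1 = n) (t : Fin m → E n) (ν : E n)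
    (hg : IsUnit (gram t).det) (hν : ‖ν‖ = 1) (hort : ∀ i, inner ℝ ν (t i) = (0 : ℝ))
    (a b : Fin n) :
    ∑ i, ∑ j, (gram t)⁻¹ i j * t i a * t j b + ν a * ν b = (1 : Matrix (Fin n) (Fin n) ℝ) a b := by
  subst hmn
  let A : Matrix (Fin (m + 1)) (Fin m ⊕ Unit) ℝ :=
    Matrix.of fun a s => Sum.elim (fun i => t i a) (fun _ => ν a) s
  let B : Matrix (Fin m ⊕ Unit) (Fin m ⊕ Unit) ℝ := Matrix.fromBlocks (gram t)⁻¹ 0 0 1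
  have hAA : A.transpose * A = Matrix.fromBlocks (gram t) 0 0 1 := by
    ext (i | i) (j | j)
    · simp [A, Matrix.mul_apply, gram, PiLp.inner_apply, mul_comm]
    · have := hort i
      simp only [PiLp.inner_apply] at this
      simpa [A, Matrix.mul_apply] using this
    · have := hort j
      simp only [PiLp.inner_apply] at this
      simpa [A, Matrix.mul_apply, mul_comm] using this
    · have h2 : ∑ a, ν a ^ 2 = 1 := by
        rw [← EuclideanSpace.real_norm_sq_eq, hν, one_pow]
      simpa [A, Matrix.mul_apply, ← sq] using h2
  have hB : B * (A.transpose * A) = 1 := by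
    rw [hAA]
    simp [B, Matrix.fromBlocks_multiply, Matrix.nonsing_inv_mul _ hg]
  -- The matrix `A` with columns `t₁, …, tₘ, ν` is square because `m + 1 = n`, so the left inverse
  -- `B * Aᵀ` of `A` is also a right inverse. The entries of `A * B * Aᵀ = 1` are the claim.
  have hcard : Fintype.card (Fin (m + 1)) = Fintype.card (Fin m ⊕ Unit) := by simp
  have key : A * (B * A.transpose) = 1 := by
    rw [← Matrix.mul_assoc] at hB
    exact (Matrix.mul_eq_one_comm_of_card_eq _ _ _ hcard.symm).mp hB
  have := congrFun (congrFun key a) b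
  rw [← this]
  simp only [Matrix.mul_apply, Fintype.sum_sum_type, A, B, Matrix.transpose_apply]
  simp [Finset.mul_sum]
  refine Finset.sum_congr rfl fun i _ => Finset.sum_congr rfl fun j _ => ?_
  ring

theorem gram_transpose {m n : ℕ} (t : Fin m → E n) : (gram t).transpose = gram t := by
  ext i j; simp [gram, real_inner_comm]

theorem gram_inv_symm {m n : ℕ} (t : Fin m → E n) (i j : Fin m) :
    (gram t)⁻¹ i j = (gram t)⁻¹ j i := by
  conv_lhs => rw [← gram_transpose t, ← Matrix.transpose_nonsing_inv]
  rfl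

theorem bilin_eq_sum_single {n : ℕ} (B : E n →L[ℝ] E n →L[ℝ] ℝ) (v w : E n) :
    B v w = ∑ a, ∑ b, v a * w b * B (EuclideanSpace.single a 1) (EuclideanSpace.single b 1) := by
  have hv : ∀ v : E n, v = ∑ a, v a • EuclideanSpace.single a (1 : ℝ) := by
    intro v
    conv_lhs => rw [← (EuclideanSpace.basisFun (Fin n) ℝ).sum_repr v]
    simp
  conv_lhs => rw [hv v, hv w]
  simp [Finset.mul_sum, mul_assoc]
  rw [Finset.sum_comm]
  simp [mul_left_comm]

/-- The trace of a bilinear form over a hyperplane, in an arbitrary frame. -/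
theorem sum_gram_inv_bilin {m n : ℕ} (hmn : m + 1 = n) (t : Fin m → E n) (ν : E n)
    (hg : IsUnit (gram t).det) (hν : ‖ν‖ = 1) (hort : ∀ i, inner ℝ ν (t i) = (0 : ℝ))
    (B : E n →L[ℝ] E n →L[ℝ] ℝ) :
    ∑ i, ∑ j, (gram t)⁻¹ i j * B (t i) (t j) =
      ∑ a, B (EuclideanSpace.single a 1) (EuclideanSpace.single a 1) - B ν ν := by
  have h := fun a b => sum_gram_inv_add_normal hmn t ν hg hν hort a b
  have e1 : ∑ i, ∑ j, (gram t)⁻¹ i j * B (t i) (t j) = ∑ a, ∑ b,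
      (∑ i, ∑ j, (gram t)⁻¹ i j * t i a * t j b) *
        B (EuclideanSpace.single a 1) (EuclideanSpace.single b 1) := by
    simp_rw [bilin_eq_sum_single B (t _) (t _), Finset.mul_sum, Finset.sum_mul]
    simp_rw [Finset.sum_comm (s := (Finset.univ : Finset (Fin m))) (t := (Finset.univ : Finset (Fin n)))]
    refine Finset.sum_congr rfl fun a _ => Finset.sum_congr rfl fun b _ =>
      Finset.sum_congr rfl fun i _ => Finset.sum_congr rfl fun j _ => ?_
    ring
  rw [e1, bilin_eq_sum_single B ν ν]
  simp_rw [fun a b => eq_sub_of_add_eq (h a b), sub_mul, Finset.sum_sub_distrib]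
  simp [Matrix.one_apply]

/-! ### The viscosity condition in the hyperplane directions -/

/-- The second derivative as a bilinear form. -/
abbrev hess {V : Type*} [NormedAddCommGroup V] [NormedSpace ℝ V] (g : V → ℝ) (x : V) :
    V →L[ℝ] V →L[ℝ] ℝ := fderiv ℝ (fderiv ℝ g) x

/-- The trace of the Hessian of `g` over the hyperplane orthogonal to the unit vector `ν`. -/
def hyperplaneLaplacian {n : ℕ} (g : E n → ℝ) (x ν : E n) : ℝ :=
  ∑ a, hess g x (EuclideanSpace.single a 1) (EuclideanSpace.single a 1) - hess g x ν ν

/-- The first order term `(n u_ν² - |∇u|²) / ((n - 2) u)`. -/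
def gradTerm {n : ℕ} (u : E n → ℝ) (x ν : E n) : ℝ :=
  ((n : ℝ) * fderiv ℝ u x ν ^ 2 - ∑ k, pd k u x ^ 2) / (((n : ℝ) - 2) * u x)

theorem fderiv_apply_eq_sum {n : ℕ} {V : Type*} [NormedAddCommGroup V] [NormedSpace ℝ V]
    (L : E n →L[ℝ] V) (v : E n) : L v = ∑ a, v a • L (EuclideanSpace.single a 1) := by
  conv_lhs => rw [← (EuclideanSpace.basisFun (Fin n) ℝ).sum_repr v]
  simp

theorem pd_pd_eq_hess {n : ℕ} {ψ : E n → ℝ} {x : E n} (h : ContDiffAt ℝ 2 ψ x) (i j : Fin n) :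
    pd i (pd j ψ) x = hess ψ x (EuclideanSpace.single i 1) (EuclideanSpace.single j 1) := by
  have hd : DifferentiableAt ℝ (fderiv ℝ ψ) x :=
    (h.fderiv_right (m := 1) (by norm_num)).differentiableAt (by norm_num)
  unfold pd hess
  rw [fderiv_clm_apply hd (by fun_prop)]
  simp

theorem hess_symm {V : Type*} [NormedAddCommGroup V] [NormedSpace ℝ V] {ψ : V → ℝ} {x : V}
    (h : ContDiffAt ℝ 2 ψ x) (v w : V) : hess ψ x v w = hess ψ x w v :=
  (h.isSymmSndFDerivAt (by simp)).eq v w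

theorem fderiv_eq_of_touching {n : ℕ} {u ψ : E n → ℝ} {x : E n} (hu : DifferentiableAt ℝ u x)
    (hψ : DifferentiableAt ℝ ψ x) (h0 : ψ x = u x) (h : ∀ᶠ y in 𝓝 x, u y ≤ ψ y) :
    fderiv ℝ ψ x = fderiv ℝ u x := by
  have : IsLocalMin (fun y => ψ y - u y) x := by
    filter_upwards [h] with y hy
    linarith
  have h2 := this.fderiv_eq_zero
  rw [fderiv_fun_sub hψ hu] at h2
  exact sub_eq_zero.mp h2

/-- Up to a positive factor, `-A^ψ` is `∇²ψ` plus first order terms, and at a touching point `∇ψ =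
∇u`. Its trace over `ν^⊥` is then affine in `∇²ψ`, with a zeroth coefficient depending on `u` alone.
-/
theorem hyperplaneLaplacian_nonneg_of_touching {n : ℕ} (hn : 3 ≤ n) {u ψ : E n → ℝ} {Ω : Set (E n)}
    (hvisc : ViscosityNegCone 2 u Ω) {x : E n} (hx : x ∈ Ω) (hu : DifferentiableAt ℝ u x)
    (hpos : 0 < u x) (hψ : ContDiffAt ℝ 2 ψ x) (h0 : ψ x = u x) (h : ∀ᶠ y in 𝓝 x, u y ≤ ψ y)
    {ν : E n} (hν : ‖ν‖ = 1) : 0 ≤ hyperplaneLaplacian ψ x ν + gradTerm u x ν := by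
  have hfd := fderiv_eq_of_touching hu (hψ.differentiableAt (by norm_num)) h0 h
  have hpd : ∀ i, pd i ψ x = pd i u x := fun i => by rw [pd, pd, hfd]
  have hν2 : ∑ i, ν i ^ 2 = 1 := by rw [← EuclideanSpace.real_norm_sq_eq, hν, one_pow]
  have hn2 : (0 : ℝ) < (n : ℝ) - 2 := by
    have : (3 : ℝ) ≤ n := by exact_mod_cast hn
    linarith
  -- The coefficient of the Hessian in `-A^ψ`; being positive, it is divided out at the end.
  set κ : ℝ := 2 / ((n : ℝ) - 2) * u x ^ (-(((n : ℝ) + 2) / ((n : ℝ) - 2))) with hκ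
  have hκpos : 0 < κ := by positivity
  have hpow : u x ^ (-(2 * (n : ℝ) / ((n : ℝ) - 2)))
      = u x ^ (-(((n : ℝ) + 2) / ((n : ℝ) - 2))) * (u x)⁻¹ := by
    rw [← Real.rpow_neg_one, ← Real.rpow_add hpos]
    congr 1
    field_simp
    ring
  have hent : ∀ i j, (-conformalHessian ψ x) i j =
      κ * (hess ψ x (EuclideanSpace.single i 1) (EuclideanSpace.single j 1)
        - n / (((n : ℝ) - 2) * u x) * (pd i u x * pd j u x)
        + 1 / (((n : ℝ) - 2) * u x) * (∑ k, pd k u x ^ 2)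
          * (1 : Matrix (Fin n) (Fin n) ℝ) i j) := by
    intro i j
    simp only [Matrix.neg_apply, conformalHessian, Matrix.of_apply, h0, hpd, hpow,
      pd_pd_eq_hess hψ, hκ]
    field_simp
    ring
  have hherm : (-conformalHessian ψ x).IsHermitian := by
    refine Matrix.IsHermitian.ext fun i j => ?_
    rw [hent, hent, hess_symm hψ, Matrix.one_apply, Matrix.one_apply]
    simp only [star_trivial, eq_comm (a := i), mul_comm (pd j u x)]
  have key := quadraticForm_le_trace_of_eigenvaluesIn hherm (hvisc x hx ψ hψ h0 h) hν2
  have e1 : (-conformalHessian ψ x).trace =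
      κ * (∑ a, hess ψ x (EuclideanSpace.single a 1) (EuclideanSpace.single a 1)
        - n / (((n : ℝ) - 2) * u x) * (∑ k, pd k u x ^ 2)
        + 1 / (((n : ℝ) - 2) * u x) * (∑ k, pd k u x ^ 2) * n) := by
    rw [Matrix.trace]
    simp only [Matrix.diag_apply, hent, ← Finset.mul_sum, Finset.sum_add_distrib,
      Finset.sum_sub_distrib, Matrix.one_apply_eq, sq]
    simp
  have e2 : ∑ i, ∑ j, (-conformalHessian ψ x) i j * (ν i * ν j) =
      κ * (hess ψ x ν ν - n / (((n : ℝ) - 2) * u x) * fderiv ℝ u x ν ^ 2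
        + 1 / (((n : ℝ) - 2) * u x) * (∑ k, pd k u x ^ 2)) := by
    have h3 : ∑ i, ∑ j, (1 : Matrix (Fin n) (Fin n) ℝ) i j * (ν i * ν j) = 1 := by
      simpa [Matrix.one_apply, ← sq] using hν2
    have h4 : fderiv ℝ u x ν ^ 2 = ∑ i, ∑ j, pd i u x * pd j u x * (ν i * ν j) := by
      rw [fderiv_apply_eq_sum, sq, Finset.sum_mul_sum]
      refine Finset.sum_congr rfl fun i _ => Finset.sum_congr rfl fun j _ => ?_
      simp only [pd, smul_eq_mul]; ring
    have h5 := bilin_eq_sum_single (hess ψ x) ν ν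
    generalize hT : 1 / (((n : ℝ) - 2) * u x) * (∑ k, pd k u x ^ 2) = T at hent ⊢
    have h6 : T = ∑ i, ∑ j, T * ((1 : Matrix (Fin n) (Fin n) ℝ) i j * (ν i * ν j)) := by
      simp only [← Finset.mul_sum, h3, mul_one]
    rw [h5, h4, h6]
    simp only [Finset.mul_sum, ← Finset.sum_sub_distrib, ← Finset.sum_add_distrib]
    refine Finset.sum_congr rfl fun i _ => Finset.sum_congr rfl fun j _ => ?_
    rw [hent]
    ring
  rw [e1, e2, ← sub_nonneg, ← mul_sub] at key
  have key2 := (mul_nonneg_iff_of_pos_left hκpos).mp key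
  have e3 : hyperplaneLaplacian ψ x ν + gradTerm u x ν =
      ∑ a, hess ψ x (EuclideanSpace.single a 1) (EuclideanSpace.single a 1)
        - n / (((n : ℝ) - 2) * u x) * (∑ k, pd k u x ^ 2)
        + 1 / (((n : ℝ) - 2) * u x) * (∑ k, pd k u x ^ 2) * n -
      (hess ψ x ν ν - n / (((n : ℝ) - 2) * u x) * fderiv ℝ u x ν ^ 2
        + 1 / (((n : ℝ) - 2) * u x) * (∑ k, pd k u x ^ 2)) := by
    rw [hyperplaneLaplacian, gradTerm]
    field_simp
    ring
  rw [e3]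
  exact key2

/-! ### The maximum principle and harmonic polynomials -/

/-- The Laplacian on `ℝᵐ`. -/
def lap {m : ℕ} (g : E m → ℝ) (y : E m) : ℝ :=
  ∑ i, hess g y (EuclideanSpace.single i 1) (EuclideanSpace.single i 1)

/-- If the second derivative along the line through `x` were positive, the second derivative test
would make `x` a local minimum on that line too; the restriction would then be locally constant,
with second derivative zero. -/
theorem hess_nonpos_of_isLocalMax {V : Type*} [NormedAddCommGroup V] [NormedSpace ℝ V]
    {g : V → ℝ} {x : V} (hg : ContDiffAt ℝ 2 g x) (h : IsLocalMax g x) (v : V) :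
    hess g x v v ≤ 0 := by
  by_contra! hpos
  let φ : ℝ → ℝ := fun t => g (x + t • v)
  have hline : ∀ t : ℝ, HasDerivAt (fun t : ℝ => x + t • v) v t := fun t => by
    simpa using ((hasDerivAt_id t).smul_const v).const_add x
  have hcont : ContinuousAt (fun t : ℝ => x + t • v) 0 := (hline 0).continuousAt
  have htend : Filter.Tendsto (fun t : ℝ => x + t • v) (𝓝 0) (𝓝 x) := by
    simpa using hcont.tendsto
  have hd1 : deriv φ =ᶠ[𝓝 0] fun t => fderiv ℝ g (x + t • v) v := by
    have : ∀ᶠ y in 𝓝 x, DifferentiableAt ℝ g y :=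
      (hg.eventually (by simp)).mono fun y hy => hy.differentiableAt (by norm_num)
    filter_upwards [htend.eventually this] with t ht
    exact (ht.hasFDerivAt.comp_hasDerivAt t (hline t)).deriv
  have hdd : deriv (deriv φ) 0 = hess g x v v := by
    rw [hd1.deriv_eq]
    have hd : DifferentiableAt ℝ (fderiv ℝ g) (x + (0 : ℝ) • v) := by
      simpa using (hg.fderiv_right (m := 1) (by norm_num)).differentiableAt (by norm_num)
    have h2 := (hd.hasFDerivAt.comp_hasDerivAt (0 : ℝ) (hline 0))
    have h3 := ((ContinuousLinearMap.apply ℝ ℝ v).hasFDerivAt.comp_hasDerivAt (0 : ℝ) h2).deriv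
    simpa [Function.comp_def] using h3
  have hmax : IsLocalMax φ 0 := by
    have := htend.eventually h
    filter_upwards [this] with t ht
    simpa [φ] using ht
  have hc : ContinuousAt φ 0 := by
    refine ContinuousAt.comp (g := g) (by simpa using hg.continuousAt) hcont
  have hmin := isLocalMin_of_deriv_deriv_pos (hdd ▸ hpos) hmax.deriv_eq_zero hc
  have hconst : φ =ᶠ[𝓝 0] fun _ => φ 0 := by
    filter_upwards [hmax, hmin] with t h1 h2 using le_antisymm h1 h2
  have : deriv (deriv φ) 0 = 0 := by
    rw [(hconst.deriv).deriv_eq]; simp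
  linarith

theorem le_of_lap_pos {m : ℕ} {g : E m → ℝ} {r c : ℝ}
    (hc : ContinuousOn g (Metric.closedBall 0 r))
    (hg : ∀ y ∈ Metric.ball (0 : E m) r, ContDiffAt ℝ 2 g y ∧ 0 < lap g y)
    (hs : ∀ y ∈ Metric.sphere (0 : E m) r, g y ≤ c) :
    ∀ y ∈ Metric.closedBall (0 : E m) r, g y ≤ c := by
  intro y hy
  obtain ⟨z, hz, hmax⟩ := (isCompact_closedBall (0 : E m) r).exists_isMaxOn ⟨y, hy⟩ hc
  refine (hmax hy).trans ?_
  rcases eq_or_lt_of_le (mem_closedBall_zero_iff.mp hz) with h | h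
  · exact hs z (by simpa using h)
  · exfalso
    have hzb : z ∈ Metric.ball (0 : E m) r := by simpa using h
    obtain ⟨h1, h2⟩ := hg z hzb
    have hloc : IsLocalMax g z := hmax.isLocalMax
      (Filter.mem_of_superset (Metric.isOpen_ball.mem_nhds hzb) Metric.ball_subset_closedBall)
    exact absurd h2 (not_lt.mpr (Finset.sum_nonpos fun i _ => hess_nonpos_of_isLocalMax h1 hloc _))

/-- A polynomial as a function on `ℝᵐ`. -/
def evalP {m : ℕ} (p : MvPolynomial (Fin m) ℝ) (y : E m) : ℝ := MvPolynomial.eval (fun i => y i) p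

/-- The Laplacian of a polynomial. -/
def lapP {m : ℕ} (p : MvPolynomial (Fin m) ℝ) : MvPolynomial (Fin m) ℝ :=
  ∑ i, MvPolynomial.pderiv i (MvPolynomial.pderiv i p)

theorem contDiff_evalP {m : ℕ} (p : MvPolynomial (Fin m) ℝ) : ContDiff ℝ ω (evalP p) := by
  unfold evalP
  induction p using MvPolynomial.induction_on with
  | C a => simpa using contDiff_const
  | add p q hp hq => simpa using hp.add hq
  | mul_X p i hp =>
    simp only [map_mul, MvPolynomial.eval_X]
    exact hp.mul (by fun_prop)

theorem pd_evalP {m : ℕ} (p : MvPolynomial (Fin m) ℝ) (i : Fin m) :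
    pd i (evalP p) = evalP (MvPolynomial.pderiv i p) := by
  have hdiff : ∀ (p : MvPolynomial (Fin m) ℝ) y, DifferentiableAt ℝ (evalP p) y := fun p y =>
    (contDiff_evalP p).contDiffAt.differentiableAt (by simp)
  induction p using MvPolynomial.induction_on with
  | C a =>
    have h : evalP (MvPolynomial.C a : MvPolynomial (Fin m) ℝ) = fun _ => a := by
      ext; simp [evalP]
    ext y
    rw [pd, h]
    simp [evalP]
  | add p q hp hq =>
    have h : evalP (p + q) = fun y => evalP p y + evalP q y := by ext; simp [evalP]
    ext y
    have hp' := congrFun hp y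
    have hq' := congrFun hq y
    unfold pd at *
    rw [h, fderiv_fun_add (hdiff p y) (hdiff q y)]
    simp [hp', hq', evalP]
  | mul_X p j hp =>
    have h : evalP (p * MvPolynomial.X j) = fun y => evalP p y * y j := by ext; simp [evalP]
    ext y
    have hp' := congrFun hp y
    unfold pd at *
    rw [h, fderiv_fun_mul (hdiff p y) (by fun_prop)]
    have hj : fderiv ℝ (fun y : E m => y j) y = EuclideanSpace.proj j :=
      (EuclideanSpace.proj (𝕜 := ℝ) j).fderiv
    rw [hj]
    by_cases hij : j = i
    · subst hij
      simp [hp', evalP, MvPolynomial.pderiv_X]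
    · simp [hp', evalP, MvPolynomial.pderiv_X, hij]

theorem lap_evalP {m : ℕ} (p : MvPolynomial (Fin m) ℝ) (y : E m) :
    lap (evalP p) y = evalP (lapP p) y := by
  have h2 : ContDiffAt ℝ 2 (evalP p) y := (contDiff_evalP p).contDiffAt.of_le le_top
  simp only [lap, ← pd_pd_eq_hess h2, pd_evalP]
  simp [lapP, evalP]

theorem lapP_add {m : ℕ} (p q : MvPolynomial (Fin m) ℝ) : lapP (p + q) = lapP p + lapP q := by
  simp [lapP, Finset.sum_add_distrib]

theorem lapP_C_mul {m : ℕ} (a : ℝ) (p : MvPolynomial (Fin m) ℝ) :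
    lapP (MvPolynomial.C a * p) = MvPolynomial.C a * lapP p := by
  simp [lapP, Finset.mul_sum]

theorem lapP_sub {m : ℕ} (p q : MvPolynomial (Fin m) ℝ) : lapP (p - q) = lapP p - lapP q := by
  simp [lapP, Finset.sum_sub_distrib]

/-- The polynomial `r² - |x|²`. -/
def ballP (m : ℕ) (r : ℝ) : MvPolynomial (Fin m) ℝ :=
  MvPolynomial.C (r ^ 2) - ∑ i, MvPolynomial.X i ^ 2

theorem evalP_ballP {m : ℕ} (r : ℝ) (y : E m) : evalP (ballP m r) y = r ^ 2 - ‖y‖ ^ 2 := by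
  simp [evalP, ballP, EuclideanSpace.real_norm_sq_eq]

theorem lapP_ballP (m : ℕ) (r : ℝ) : lapP (ballP m r) = MvPolynomial.C (-(2 * (m : ℝ))) := by
  have h : ∀ i j : Fin m, MvPolynomial.pderiv i (MvPolynomial.X j ^ 2 : MvPolynomial (Fin m) ℝ)
      = if i = j then MvPolynomial.C 2 * MvPolynomial.X i else 0 := by
    intro i j
    rw [MvPolynomial.pderiv_pow, MvPolynomial.pderiv_X]
    by_cases hij : i = j
    · subst hij
      simpa using (map_ofNat MvPolynomial.C 2).symm
    · simp [hij, Ne.symm hij]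
  simp only [lapP, ballP, map_sub, MvPolynomial.pderiv_C, map_sum, h, Finset.sum_ite_eq,
    Finset.mem_univ, if_true, zero_sub, map_neg, MvPolynomial.pderiv_C_mul,
    MvPolynomial.pderiv_X_self, mul_one]
  simp [mul_comm]

/-- Subtracting `δ (r² - |y|²)` keeps the values on the sphere and makes the Laplacian equal to `2mδ
> 0`, so the strict maximum principle applies; then `δ` tends to zero. -/
theorem harmonic_le_of_sphere {m : ℕ} (hm : 0 < m) {p : MvPolynomial (Fin m) ℝ} (hp : lapP p = 0)
    {r c : ℝ} (hs : ∀ y : E m, ‖y‖ = r → evalP p y ≤ c) :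
    ∀ y : E m, ‖y‖ ≤ r → evalP p y ≤ c := by
  intro y hy
  have hδ : ∀ δ > 0, evalP p y ≤ c + δ * (r ^ 2 - ‖y‖ ^ 2) := by
    intro δ hδ
    have := le_of_lap_pos (g := evalP (p - MvPolynomial.C δ * ballP m r)) (r := r) (c := c)
      (contDiff_evalP _).continuous.continuousOn
      (fun z _ => ⟨(contDiff_evalP _).contDiffAt.of_le le_top, by
        rw [lap_evalP, lapP_sub, lapP_C_mul, hp, lapP_ballP]
        simp [evalP]; positivity⟩)
      (fun z hz => by
        have hz' : ‖z‖ = r := by simpa using hz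
        have h1 := hs z hz'
        have h2 := evalP_ballP r z
        rw [hz', sub_self] at h2
        simp only [evalP, map_sub, map_mul] at h1 h2 ⊢
        rw [h2]; simpa using h1) y (by simpa using hy)
    have h2 := evalP_ballP r y
    simp only [evalP, map_sub, map_mul, MvPolynomial.eval_C] at this h2 ⊢
    rw [h2] at this
    linarith
  by_contra! hlt
  have hnn : 0 ≤ r ^ 2 - ‖y‖ ^ 2 := by
    have := pow_le_pow_left₀ (norm_nonneg y) hy 2
    linarith
  -- This `δ` makes the error term at most half of the assumed excess over `c`.
  have h3 := hδ ((evalP p y - c) / (2 * (r ^ 2 - ‖y‖ ^ 2 + 1))) (by apply div_pos <;> linarith)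
  have h4 : (evalP p y - c) / (2 * (r ^ 2 - ‖y‖ ^ 2 + 1)) * (r ^ 2 - ‖y‖ ^ 2)
      ≤ (evalP p y - c) / 2 := by
    rw [div_mul_eq_mul_div, div_le_div_iff₀ (by linarith) (by norm_num)]
    nlinarith
  linarith

/-! ### The polynomial Dirichlet problem and density of harmonic polynomials on spheres -/

theorem totalDegree_pderiv_le {m : ℕ} (p : MvPolynomial (Fin m) ℝ) (i : Fin m) :
    (MvPolynomial.pderiv i p).totalDegree ≤ p.totalDegree - 1 := by
  refine Finset.sup_le fun s hs => ?_
  rw [MvPolynomial.mem_support_iff, MvPolynomial.coeff_pderiv] at hs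
  have h := MvPolynomial.le_totalDegree (MvPolynomial.mem_support_iff.mpr (left_ne_zero_of_mul hs))
  rw [Finsupp.sum_add_index' (by simp) (by simp)] at h
  simp at h
  omega

theorem totalDegree_lapP_le {m : ℕ} (p : MvPolynomial (Fin m) ℝ) :
    (lapP p).totalDegree ≤ p.totalDegree - 2 := by
  refine MvPolynomial.totalDegree_finsetSum_le fun i _ => ?_
  have h1 := totalDegree_pderiv_le p i
  have h2 := totalDegree_pderiv_le (MvPolynomial.pderiv i p) i
  omega

theorem totalDegree_ballP_le (m : ℕ) (r : ℝ) : (ballP m r).totalDegree ≤ 2 := by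
  refine (MvPolynomial.totalDegree_sub _ _).trans (max_le (by rw [MvPolynomial.totalDegree_C]; omega) ?_)
  refine MvPolynomial.totalDegree_finsetSum_le fun i _ => ?_
  exact (MvPolynomial.totalDegree_pow _ _).trans (by simp)

/-- A polynomial vanishing on a product of infinite sets is zero. The cube of half-side `r/(m+1)`
lies in the ball because `m r²/(m+1)² < r²`. -/
theorem eq_zero_of_evalP_eq_zero {m : ℕ} {q : MvPolynomial (Fin m) ℝ} {r : ℝ} (hr : 0 < r)
    (h : ∀ y : E m, ‖y‖ < r → evalP q y = 0) : q = 0 := by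
  refine MvPolynomial.funext_set (fun _ => Set.Ioo (-(r / (m + 1))) (r / (m + 1)))
    (fun _ => Set.Ioo_infinite (by have : 0 < r / (m + 1) := by positivity
                                   linarith)) fun x hx => ?_
  have := h (WithLp.toLp 2 x) ?_
  · simpa [evalP] using this
  · refine lt_of_pow_lt_pow_left₀ 2 hr.le ?_
    rw [EuclideanSpace.real_norm_sq_eq]
    have h1 : ∀ i, x i ^ 2 ≤ (r / (m + 1)) ^ 2 := fun i => by
      have := hx i (Set.mem_univ i)
      exact sq_le_sq' this.1.le this.2.le
    calc ∑ i, x i ^ 2 ≤ ∑ _i : Fin m, (r / (m + 1)) ^ 2 := Finset.sum_le_sum fun i _ => h1 i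
      _ = m * (r / (m + 1)) ^ 2 := by simp
      _ < r ^ 2 := by
        rw [div_pow, mul_div_assoc', div_lt_iff₀ (by positivity)]
        have : 0 < r ^ 2 := by positivity
        have hm : (0 : ℝ) ≤ m := Nat.cast_nonneg m
        nlinarith [mul_nonneg this.le hm, mul_nonneg this.le (sq_nonneg (m : ℝ))]

/-- Solution of the Dirichlet problem in a ball for polynomial boundary values. -/
theorem exists_harmonic_eq_on_sphere {m : ℕ} (hm : 0 < m) {r : ℝ} (hr : 0 < r)
    (P : MvPolynomial (Fin m) ℝ) :
    ∃ h : MvPolynomial (Fin m) ℝ, lapP h = 0 ∧ ∀ y : E m, ‖y‖ = r → evalP h y = evalP P y := by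
  set k := P.totalDegree
  -- Multiplication by `r² - |x|²` raises the degree by at most two and the Laplacian lowers it by
  -- two, so `T` acts on a finite-dimensional space. It is injective by the maximum principle, hence
  -- surjective. Solving `T q = ΔP`, the polynomial `P - (r² - |x|²) q` is harmonic and agrees with
  -- `P` on the sphere.
  let T : MvPolynomial.restrictTotalDegree (Fin m) ℝ k →ₗ[ℝ]
      MvPolynomial.restrictTotalDegree (Fin m) ℝ k :=
    { toFun := fun q => ⟨lapP (ballP m r * q), by
        rw [MvPolynomial.mem_restrictTotalDegree]
        have h1 := totalDegree_lapP_le (ballP m r * (q : MvPolynomial (Fin m) ℝ))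
        have h2 := MvPolynomial.totalDegree_mul (ballP m r) (q : MvPolynomial (Fin m) ℝ)
        have h3 := totalDegree_ballP_le m r
        have h4 := (MvPolynomial.mem_restrictTotalDegree _ _ _).mp q.2
        omega⟩
      map_add' := fun p q => by ext1; simp [mul_add, lapP_add]
      map_smul' := fun a q => by
        ext1
        simp only [MvPolynomial.smul_eq_C_mul, SetLike.val_smul, RingHom.id_apply,
          mul_left_comm (ballP m r), lapP_C_mul] }
  have hinj : Function.Injective T := by
    rw [← LinearMap.ker_eq_bot, LinearMap.ker_eq_bot']
    intro q hq
    have hq' : lapP (ballP m r * (q : MvPolynomial (Fin m) ℝ)) = 0 := congrArg Subtype.val hq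
    have hev : ∀ y : E m, evalP (ballP m r * (q : MvPolynomial (Fin m) ℝ)) y
        = (r ^ 2 - ‖y‖ ^ 2) * evalP q y := fun y => by
      rw [← evalP_ballP]; simp [evalP]
    have hle := harmonic_le_of_sphere hm hq' (r := r) (c := 0)
      (fun y hy => by rw [hev, hy, sub_self, zero_mul])
    have hneg : lapP (MvPolynomial.C (-1) * (ballP m r * (q : MvPolynomial (Fin m) ℝ))) = 0 := by
      rw [lapP_C_mul, hq', mul_zero]
    have hev2 : ∀ y : E m, evalP (MvPolynomial.C (-1) * (ballP m r * (q : MvPolynomial (Fin m) ℝ))) y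
        = -((r ^ 2 - ‖y‖ ^ 2) * evalP q y) := fun y => by
      rw [← hev]; simp [evalP]
    have hge := harmonic_le_of_sphere hm hneg (r := r) (c := 0)
      (fun y hy => by rw [hev2, hy, sub_self, zero_mul, neg_zero])
    ext1
    refine eq_zero_of_evalP_eq_zero hr fun y hy => ?_
    have h1 := hle y hy.le
    have h2 := hge y hy.le
    rw [hev] at h1
    rw [hev2] at h2
    have h3 : (r ^ 2 - ‖y‖ ^ 2) * evalP q y = 0 := by linarith
    refine (mul_eq_zero.mp h3).resolve_left ?_
    have := pow_lt_pow_left₀ hy (norm_nonneg y) two_ne_zero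
    linarith
  have hsurj := LinearMap.injective_iff_surjective.mp hinj
  obtain ⟨q, hq⟩ := hsurj ⟨lapP P, by
    rw [MvPolynomial.mem_restrictTotalDegree]
    have := totalDegree_lapP_le P
    omega⟩
  have hq' : lapP (ballP m r * (q : MvPolynomial (Fin m) ℝ)) = lapP P := congrArg Subtype.val hq
  refine ⟨P - ballP m r * q, by rw [lapP_sub, hq', sub_self], fun y hy => ?_⟩
  have h := evalP_ballP r y
  rw [hy, sub_self] at h
  simp only [evalP, map_sub, map_mul] at h ⊢
  rw [h]; ring

/-- Every continuous function on a sphere is a uniform limit of harmonic polynomials. -/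
theorem exists_harmonic_near_on_sphere {m : ℕ} (hm : 0 < m) {r : ℝ} (hr : 0 < r) {w : E m → ℝ}
    (hw : ContinuousOn w (Metric.sphere 0 r)) {ε : ℝ} (hε : 0 < ε) :
    ∃ h : MvPolynomial (Fin m) ℝ, lapP h = 0 ∧ ∀ y : E m, ‖y‖ = r → |evalP h y - w y| < ε := by
  have : CompactSpace (Metric.sphere (0 : E m) r) :=
    isCompact_iff_compactSpace.mp (isCompact_sphere _ _)
  let X : Fin m → C(Metric.sphere (0 : E m) r, ℝ) := fun i => ⟨fun y => (y : E m) i, by fun_prop⟩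
  -- Restrictions of polynomials to the sphere form a subalgebra separating points. By
  -- Stone–Weierstrass it suffices to approximate by a polynomial, which is then replaced by the
  -- harmonic one with the same values on the sphere.
  let Φ : MvPolynomial (Fin m) ℝ →ₐ[ℝ] C(Metric.sphere (0 : E m) r, ℝ) := MvPolynomial.aeval X
  have hΦ : ∀ p y, Φ p y = evalP p (y : E m) := by
    intro p y
    induction p using MvPolynomial.induction_on with
    | C a => simp [Φ, evalP]
    | add p q hp hq =>
      simp only [evalP, map_add, ContinuousMap.add_apply] at hp hq ⊢
      rw [hp, hq]
    | mul_X p i hp =>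
      simp only [evalP, map_mul, ContinuousMap.mul_apply] at hp ⊢
      rw [hp]; simp [Φ, X]
  have hsep : (Φ.range).SeparatesPoints := by
    intro y z hyz
    have : ∃ i, (y : E m) i ≠ (z : E m) i := by
      by_contra! hall
      exact hyz (Subtype.ext (PiLp.ext hall))
    obtain ⟨i, hi⟩ := this
    exact ⟨X i, ⟨X i, ⟨MvPolynomial.X i, by simp [Φ]⟩, rfl⟩, hi⟩
  obtain ⟨⟨g, P, rfl⟩, hg⟩ :=
    ContinuousMap.exists_mem_subalgebra_near_continuous_of_separatesPoints Φ.range hsep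
      ((Metric.sphere (0 : E m) r).domRestrict w) hw.domRestrict ε hε
  obtain ⟨h, hh, heq⟩ := exists_harmonic_eq_on_sphere hm hr P
  refine ⟨h, hh, fun y hy => ?_⟩
  have := hg ⟨y, by simpa using hy⟩
  rw [heq y hy]
  have h2 := hΦ P ⟨y, by simpa using hy⟩
  simp only at h2
  rw [← h2]
  exact this

/-! ### Comparison with harmonic polynomials on slices -/

theorem exists_isometry_orthogonal {m n : ℕ} (hmn : m + 1 = n) {ν : E n} (hν : ‖ν‖ = 1) :
    ∃ J : E m →ₗᵢ[ℝ] E n, ∀ y, inner ℝ ν (J y) = 0 := by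
  have hne : ν ≠ 0 := by rintro rfl; simp at hν
  have : Fact (Module.finrank ℝ (E n) = m + 1) := ⟨by simp [← hmn]⟩
  have hfr := Submodule.finrank_orthogonal_span_singleton (𝕜 := ℝ) (n := m) hne
  let b : OrthonormalBasis (Fin m) ℝ (ℝ ∙ ν)ᗮ :=
    (stdOrthonormalBasis ℝ (ℝ ∙ ν)ᗮ).reindex (finCongr hfr)
  refine ⟨((ℝ ∙ ν)ᗮ).subtypeₗᵢ.comp b.repr.symm.toLinearIsometry, fun y => ?_⟩
  exact Submodule.mem_orthogonal_singleton_iff_inner_right.mp (b.repr.symm y).2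

theorem gram_isometry {m n : ℕ} (J : E m →ₗᵢ[ℝ] E n) :
    gram (fun i => J (EuclideanSpace.single i 1)) = 1 := by
  ext i j
  simp [gram, Matrix.one_apply, EuclideanSpace.inner_single_left]

section Slice

variable {m n : ℕ} (J : E m →ₗᵢ[ℝ] E n)

/-- The adjoint of the isometry `J`. -/
def isoAdj : E n →L[ℝ] E m := J.toContinuousLinearMap.adjoint

theorem isoAdj_apply_self (y : E m) : isoAdj J (J y) = y := by
  refine ext_inner_right ℝ fun w => ?_
  rw [isoAdj, ContinuousLinearMap.adjoint_inner_left]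
  exact J.inner_map_map y w

theorem isoAdj_normal {ν : E n} (hJ : ∀ y, inner ℝ ν (J y) = (0 : ℝ)) : isoAdj J ν = 0 := by
  refine ext_inner_right ℝ fun w => ?_
  rw [isoAdj, ContinuousLinearMap.adjoint_inner_left, inner_zero_left]
  exact hJ w

theorem hyperplaneLaplacian_eq_sum (hmn : m + 1 = n) {ν : E n} (hν : ‖ν‖ = 1)
    (hJ : ∀ y, inner ℝ ν (J y) = (0 : ℝ)) (g : E n → ℝ) (x : E n) :
    hyperplaneLaplacian g x ν =
      ∑ i, hess g x (J (EuclideanSpace.single i 1)) (J (EuclideanSpace.single i 1)) := by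
  have h := sum_gram_inv_bilin hmn (fun i => J (EuclideanSpace.single i 1)) ν
    (by rw [gram_isometry]; simp) hν (fun i => hJ _) (hess g x)
  rw [hyperplaneLaplacian, ← h, gram_isometry]
  simp [Matrix.one_apply]

theorem slice_decomposition (hmn : m + 1 = n) {ν : E n} (hν : ‖ν‖ = 1)
    (hJ : ∀ y, inner ℝ ν (J y) = (0 : ℝ)) (z : E n) :
    J (isoAdj J z) + (inner ℝ ν z : ℝ) • ν = z := by
  have h := sum_gram_inv_add_normal hmn (fun i => J (EuclideanSpace.single i 1)) ν
    (by rw [gram_isometry]; simp) hν (fun i => hJ _)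
  rw [gram_isometry] at h
  simp only [inv_one, Matrix.one_apply, ite_mul, one_mul, zero_mul, Finset.sum_ite_eq,
    Finset.mem_univ, if_true] at h
  have h1 : J (isoAdj J z) = ∑ i, (inner ℝ (J (EuclideanSpace.single i 1)) z : ℝ) •
      J (EuclideanSpace.single i 1) := by
    have := fderiv_apply_eq_sum J.toContinuousLinearMap (isoAdj J z)
    refine this.trans (Finset.sum_congr rfl fun i _ => ?_)
    have h2 : (isoAdj J z) i = inner ℝ (J (EuclideanSpace.single i 1)) z := by
      have : (isoAdj J z) i = inner ℝ (EuclideanSpace.single i (1 : ℝ)) (isoAdj J z) := by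
        simp [EuclideanSpace.inner_single_left]
      rw [this, isoAdj, ContinuousLinearMap.adjoint_inner_right]
      rfl
    rw [h2]; rfl
  ext a
  have h3 : z a = ∑ b, (if a = b then (1 : ℝ) else 0) * z b := by simp
  rw [h1, h3]
  simp only [← h, PiLp.add_apply, WithLp.ofLp_sum, Finset.sum_apply, PiLp.smul_apply, smul_eq_mul,
    PiLp.inner_apply, RCLike.inner_apply, conj_trivial, add_mul, Finset.sum_add_distrib,
    Finset.sum_mul]
  rw [Finset.sum_comm]
  congr 1
  · refine Finset.sum_congr rfl fun i _ => Finset.sum_congr rfl fun b _ => ?_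
    ring
  · refine Finset.sum_congr rfl fun b _ => ?_
    ring

/-- The penalty `K ⟨ν, z - x⟩²` varies only along `ν`, so the trace over `ν^⊥` does not see it. This
lets `K` be taken arbitrarily large when a function known only on a slice is extended to a test
function on an open set. -/
theorem hyperplaneLaplacian_slice (hmn : m + 1 = n) {ν : E n} (hν : ‖ν‖ = 1)
    (hJ : ∀ y, inner ℝ ν (J y) = (0 : ℝ)) {P : E m → ℝ} (hP : ContDiff ℝ 2 P) (K c : ℝ)
    (x z : E n) :
    hyperplaneLaplacian (fun z => P (isoAdj J (z - x)) + K * (inner ℝ ν (z - x)) ^ 2 + c) z ν =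
      lap P (isoAdj J (z - x)) := by
  rw [hyperplaneLaplacian_eq_sum J hmn hν hJ, lap]
  have hA : ∀ z, HasFDerivAt (fun z => isoAdj J (z - x)) (isoAdj J) z := fun z => by
    have := (isoAdj J).hasFDerivAt.comp z ((hasFDerivAt_id z).sub_const x)
    rwa [ContinuousLinearMap.comp_id] at this
  have hN : ∀ z, HasFDerivAt (fun z => (inner ℝ ν (z - x) : ℝ)) (innerSL ℝ ν) z := fun z => by
    have := (innerSL ℝ ν).hasFDerivAt.comp z ((hasFDerivAt_id z).sub_const x)
    rwa [ContinuousLinearMap.comp_id] at this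
  have hf : fderiv ℝ (fun z => P (isoAdj J (z - x)) + K * (inner ℝ ν (z - x)) ^ 2 + c) =
      fun z => (fderiv ℝ P (isoAdj J (z - x))).comp (isoAdj J) +
        (2 * K * inner ℝ ν (z - x)) • innerSL ℝ ν := by
    ext1 z
    have h1 := ((hP.differentiable (by norm_num) _).hasFDerivAt).comp z (hA z)
    have h2 := ((hN z).pow 2).const_mul K
    have h3 := ((h1.add h2).add_const c).fderiv
    simp only [Function.comp_def] at h3
    refine h3.trans ?_
    congr 1
    ext v
    simp
    ring
  refine Finset.sum_congr rfl fun i _ => ?_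
  rw [hess, hf]
  have hd : DifferentiableAt ℝ (fderiv ℝ P) (isoAdj J (z - x)) :=
    (hP.fderiv_right (m := 1) (by norm_num)).differentiable (by norm_num) _
  have h1 := (hd.hasFDerivAt.comp z (hA z))
  have h2 := ((ContinuousLinearMap.compL ℝ (E n) (E m) ℝ).flip (isoAdj J)).hasFDerivAt.comp z h1
  have h3 := ((hN z).const_mul (2 * K)).smul_const (innerSL ℝ ν)
  have h4 := (h2.add h3).fderiv
  have h5 : (fun z => (fderiv ℝ P (isoAdj J (z - x))).comp (isoAdj J) +
        (2 * K * inner ℝ ν (z - x)) • innerSL ℝ ν) =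
      (⇑((ContinuousLinearMap.compL ℝ (E n) (E m) ℝ).flip (isoAdj J)) ∘
        fderiv ℝ P ∘ fun z => isoAdj J (z - x)) +
          fun z => (2 * K * inner ℝ ν (z - x)) • innerSL ℝ ν := by
    ext1 z; rfl
  rw [h5, h4]
  simp [isoAdj_apply_self, hJ]

/-- Viscosity subsolutions lie below harmonic majorants on slices. -/
theorem le_harmonic_of_viscosity (hmn : m + 1 = n) (hm : 0 < m) (hn : 3 ≤ n) {u : E n → ℝ}
    {Ω : Set (E n)} (hΩ : IsOpen Ω) (hu : ContDiffOn ℝ 1 u Ω) (hpos : ∀ x ∈ Ω, 0 < u x)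
    (hvisc : ViscosityNegCone 2 u Ω) {ν : E n} (hν : ‖ν‖ = 1)
    (hJ : ∀ y, inner ℝ ν (J y) = (0 : ℝ)) {x : E n} {r R c : ℝ} (hr : 0 < r) (hrR : r < R)
    (hR : Metric.closedBall x R ⊆ Ω) (hc : ∀ z ∈ Metric.closedBall x R, gradTerm u z ν < c)
    {h : MvPolynomial (Fin m) ℝ} (hh : lapP h = 0)
    (hle : ∀ y, ‖y‖ = r → u (x + J y) ≤ evalP h y) :
    u x ≤ evalP h 0 + c * r ^ 2 / (2 * m) := by
  have hm0 : (0 : ℝ) < m := by exact_mod_cast hm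
  -- The correction vanishes on the sphere of radius `r` and lowers the Laplacian to exactly `-c`;
  -- at the centre it contributes `c r²/(2m)`.
  set v := h + MvPolynomial.C (c / (2 * m)) * ballP m r with hv
  have hvev : ∀ y, evalP v y = evalP h y + c / (2 * m) * (r ^ 2 - ‖y‖ ^ 2) := fun y => by
    rw [← evalP_ballP]; simp [evalP, hv]
  have hlapv : ∀ y, lap (evalP v) y = -c := fun y => by
    rw [lap_evalP, hv, lapP_add, hh, lapP_C_mul, lapP_ballP]
    simp [evalP]; field_simp
  have hv2 : ContDiff ℝ 2 (evalP v) := (contDiff_evalP v).of_le le_top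
  by_contra! hlt
  have hv0 : evalP v 0 < u x := by
    have : evalP v 0 = evalP h 0 + c * r ^ 2 / (2 * m) := by
      rw [hvev, norm_zero]; ring
    rwa [this]
  set η := (u x - evalP v 0) / 2 with hη
  have hηpos : 0 < η := by rw [hη]; linarith
  have hucont : ContinuousOn u (Metric.closedBall x R) := hu.continuousOn.mono hR
  have hunif := (isCompact_closedBall x R).uniformContinuousOn_of_continuous hucont
  obtain ⟨δ, hδ, hδu⟩ := Metric.uniformContinuousOn_iff.mp hunif η hηpos
  -- Half-width of a slab around the slice: the slab stays in the ball of radius `R`, and `u` varies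
  -- by less than `η` from the slice to any point above it.
  set τ := min (δ / 2) (R - r) with hτ
  have hτpos : 0 < τ := lt_min (by linarith) (by linarith)
  have hτδ : τ < δ := (min_le_left _ _).trans_lt (by linarith)
  have hτR : τ ≤ R - r := min_le_right _ _
  have hmem : ∀ y : E m, ‖y‖ ≤ r → ∀ t : ℝ, |t| ≤ τ → x + J y + t • ν ∈ Metric.closedBall x R := by
    intro y hy t ht
    rw [mem_closedBall_iff_norm, add_assoc, add_sub_cancel_left]
    calc ‖J y + t • ν‖ ≤ ‖J y‖ + ‖t • ν‖ := norm_add_le _ _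
      _ ≤ r + τ := by
        rw [J.norm_map, norm_smul, hν, mul_one, Real.norm_eq_abs]; exact add_le_add hy ht
      _ ≤ R := by linarith
  let C : Set (E m × ℝ) := Metric.closedBall 0 r ×ˢ Set.Icc (-τ) τ
  have hCc : IsCompact C := (isCompact_closedBall 0 r).prod isCompact_Icc
  have hCmem : ∀ q ∈ C, ‖q.1‖ ≤ r ∧ |q.2| ≤ τ := fun q hq =>
    ⟨mem_closedBall_zero_iff.mp hq.1, abs_le.mpr hq.2⟩
  let G : E m × ℝ → ℝ := fun q => u (x + J q.1 + q.2 • ν) - evalP v q.1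
  have hGcont : ContinuousOn G C := by
    refine ContinuousOn.sub ?_ ((contDiff_evalP v).continuous.comp continuous_fst).continuousOn
    refine hucont.comp (f := fun q : E m × ℝ => x + J q.1 + q.2 • ν) ?_ fun q hq =>
      hmem q.1 (hCmem q hq).1 q.2 (hCmem q hq).2
    exact (((continuous_const.add (J.continuous.comp continuous_fst)).add
      (continuous_snd.smul continuous_const))).continuousOn
  obtain ⟨M, hM⟩ := (hCc.bddAbove_image hGcont)
  have hM' : ∀ q ∈ C, G q ≤ M := fun q hq => hM ⟨q, hq, rfl⟩
  -- On the faces `|t| = τ` the penalty is `|M| + 1`, so the penalised difference is at most `-1`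
  -- there, while its value at the centre is `2η > 0`.
  set K := (|M| + 1) / τ ^ 2 with hK
  have h0C : ((0 : E m), (0 : ℝ)) ∈ C := by
    simp [C, hr.le, hτpos.le]
  obtain ⟨⟨y₁, t₁⟩, hqC, hmax⟩ := hCc.exists_isMaxOn (f := fun q => G q - K * q.2 ^ 2) ⟨_, h0C⟩
    (hGcont.sub (by fun_prop))
  have hmax' : ∀ q ∈ C, G q - K * q.2 ^ 2 ≤ G (y₁, t₁) - K * t₁ ^ 2 := fun q hq => hmax hq
  obtain ⟨hy₁, ht₁⟩ := hCmem _ hqC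
  simp only at hy₁ ht₁
  have hbig : 2 * η ≤ G (y₁, t₁) - K * t₁ ^ 2 := by
    have := hmax' _ h0C
    simp only [G] at this ⊢
    simp at this
    rw [hη]; linarith
  have hKpos : 0 < K := by positivity
  have ht₁' : |t₁| < τ := by
    refine lt_of_le_of_ne ht₁ fun heq => ?_
    have h1 := hM' _ hqC
    have h2 : K * t₁ ^ 2 = |M| + 1 := by
      rw [← sq_abs, heq, hK]; field_simp
    have := le_abs_self M
    linarith
  -- On the lateral boundary `v = h ≥ u` holds on the slice, so at height `t₁` the difference is
  -- below `η`, less than the maximum.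
  have hy₁' : ‖y₁‖ < r := by
    refine lt_of_le_of_ne hy₁ fun heq => ?_
    have h1 := hδu _ (hmem y₁ hy₁ t₁ ht₁) _ (hmem y₁ hy₁ 0 (by simpa using hτpos.le)) (by
      simp [dist_eq_norm, norm_smul, hν]; linarith)
    rw [Real.dist_eq] at h1
    have h2 := (abs_lt.mp h1).2
    have h3 := hle y₁ heq
    have h4 := hvev y₁
    rw [heq, sub_self, mul_zero, add_zero] at h4
    have h5 : 0 ≤ K * t₁ ^ 2 := by positivity
    simp only [G] at hbig
    simp at h2
    linarith
  set z₁ := x + J y₁ + t₁ • ν with hz₁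
  have hz₁R : z₁ ∈ Metric.closedBall x R := hmem y₁ hy₁ t₁ ht₁
  have hadj : ∀ (y : E m) (t : ℝ), isoAdj J (x + J y + t • ν - x) = y := fun y t => by
    rw [add_assoc, add_sub_cancel_left, map_add, map_smul, isoAdj_normal J hJ, isoAdj_apply_self]
    simp
  have hinn : ∀ (y : E m) (t : ℝ), (inner ℝ ν (x + J y + t • ν - x) : ℝ) = t := fun y t => by
    rw [add_assoc, add_sub_cancel_left, inner_add_right, hJ, inner_smul_right,
      real_inner_self_eq_norm_sq, hν]
    simp
  -- That `ψ` touches `u` from above at `z₁` restates the interior maximality. Its trace over `ν^⊥`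
  -- is `-c`, which contradicts `gradTerm u z₁ ν < c`.
  let ψ : E n → ℝ := fun z => evalP v (isoAdj J (z - x)) + K * (inner ℝ ν (z - x)) ^ 2 +
    (u z₁ - evalP v y₁ - K * t₁ ^ 2)
  have hψ : ContDiff ℝ 2 ψ := by
    refine ContDiff.add (ContDiff.add ?_ ?_) contDiff_const
    · exact hv2.comp ((isoAdj J).contDiff.comp (contDiff_id.sub contDiff_const))
    · exact contDiff_const.mul ((contDiff_const.inner ℝ (contDiff_id.sub contDiff_const)).pow 2)
  have hψ1 : ψ z₁ = u z₁ := by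
    simp only [ψ]
    rw [hz₁, hadj, hinn]; ring
  have htouch : ∀ᶠ z in 𝓝 z₁, u z ≤ ψ z := by
    have c1 : ContinuousAt (fun z => isoAdj J (z - x)) z₁ := by fun_prop
    have c2 : ContinuousAt (fun z => (inner ℝ ν (z - x) : ℝ)) z₁ := by fun_prop
    have e1 : ∀ᶠ z in 𝓝 z₁, ‖isoAdj J (z - x)‖ < r :=
      c1.norm.eventually_lt continuousAt_const (by rw [hz₁, hadj]; exact hy₁')
    have e2 : ∀ᶠ z in 𝓝 z₁, |(inner ℝ ν (z - x) : ℝ)| < τ :=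
      c2.abs.eventually_lt continuousAt_const (by rw [hz₁, hinn]; exact ht₁')
    filter_upwards [e1, e2] with z h1 h2
    have h3 := hmax' (isoAdj J (z - x), inner ℝ ν (z - x))
      ⟨by simpa using h1.le, abs_le.mp h2.le⟩
    have h4 : x + J (isoAdj J (z - x)) + (inner ℝ ν (z - x) : ℝ) • ν = z := by
      rw [add_assoc, slice_decomposition J hmn hν hJ]; abel
    simp only [G, h4] at h3
    simp only [ψ]
    linarith
  have hux : DifferentiableAt ℝ u z₁ :=
    (hu.contDiffAt (hΩ.mem_nhds (hR hz₁R))).differentiableAt (by norm_num)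
  have hfin := hyperplaneLaplacian_nonneg_of_touching hn hvisc (hR hz₁R) hux (hpos _ (hR hz₁R))
    hψ.contDiffAt hψ1 htouch hν
  have hl := hyperplaneLaplacian_slice J hmn hν hJ hv2 K (u z₁ - evalP v y₁ - K * t₁ ^ 2) x z₁
  rw [hlapv] at hl
  have := hc z₁ hz₁R
  rw [hl] at hfin
  linarith

end Slice

/-! ### Mollification of viscosity subsolutions -/

/-- Functions on a ball lying below the harmonic extension of their boundary values, up to `κ`,
at the centre. -/
def subharmonicAtCentre (m : ℕ) {r : ℝ} (hr : 0 ≤ r) (κ : ℝ) :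
    Set C(Metric.closedBall (0 : E m) r, ℝ) :=
  {w | ∀ ε > 0, ∃ h : MvPolynomial (Fin m) ℝ, lapP h = 0 ∧
    (∀ y : Metric.closedBall (0 : E m) r, ‖(y : E m)‖ = r → |evalP h y - w y| ≤ ε) ∧
    w ⟨0, by simpa using hr⟩ ≤ evalP h 0 + κ + ε}

/-- Harmonicity, approximation on the sphere and the inequality at the centre are all compatible
with convex combinations of the harmonic polynomials. Convexity and closedness are what make the
property survive mollification, although the condition on `u` is nonlinear. -/
theorem convex_subharmonicAtCentre (m : ℕ) {r : ℝ} (hr : 0 ≤ r) (κ : ℝ) :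
    Convex ℝ (subharmonicAtCentre m hr κ) := by
  intro w₁ hw₁ w₂ hw₂ a b ha hb hab ε hε
  obtain ⟨h₁, hl₁, hs₁, hc₁⟩ := hw₁ ε hε
  obtain ⟨h₂, hl₂, hs₂, hc₂⟩ := hw₂ ε hε
  have hev : ∀ y, evalP (MvPolynomial.C a * h₁ + MvPolynomial.C b * h₂) y =
      a * evalP h₁ y + b * evalP h₂ y := fun y => by simp [evalP]
  refine ⟨MvPolynomial.C a * h₁ + MvPolynomial.C b * h₂, ?_, fun y hy => ?_, ?_⟩
  · rw [lapP_add, lapP_C_mul, lapP_C_mul, hl₁, hl₂]; simp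
  · rw [hev]
    simp only [ContinuousMap.add_apply, ContinuousMap.smul_apply, smul_eq_mul]
    have e : a * evalP h₁ y + b * evalP h₂ y - (a * w₁ y + b * w₂ y) =
      a * (evalP h₁ y - w₁ y) + b * (evalP h₂ y - w₂ y) := by ring
    rw [e]
    have h3 := mul_le_mul_of_nonneg_left (hs₁ y hy) ha
    have h4 := mul_le_mul_of_nonneg_left (hs₂ y hy) hb
    calc _ ≤ |a * (evalP h₁ y - w₁ y)| + |b * (evalP h₂ y - w₂ y)| := abs_add_le _ _
      _ = a * |evalP h₁ y - w₁ y| + b * |evalP h₂ y - w₂ y| := by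
        rw [abs_mul, abs_mul, abs_of_nonneg ha, abs_of_nonneg hb]
      _ ≤ (a + b) * ε := by linarith
      _ = ε := by rw [hab, one_mul]
  · rw [hev]
    simp only [ContinuousMap.add_apply, ContinuousMap.smul_apply, smul_eq_mul]
    have h3 := mul_le_mul_of_nonneg_left hc₁ ha
    have h4 := mul_le_mul_of_nonneg_left hc₂ hb
    have h5 : κ + ε = a * (κ + ε) + b * (κ + ε) := by rw [← add_mul, hab, one_mul]
    linarith

/-- The tolerance `ε` built into the definition absorbs a uniform error: a polynomial chosen for a
nearby function with `ε/2` also serves for the limit with `ε`. -/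
theorem isClosed_subharmonicAtCentre (m : ℕ) {r : ℝ} (hr : 0 ≤ r) (κ : ℝ) :
    IsClosed (subharmonicAtCentre m hr κ) := by
  refine isClosed_of_closure_subset fun w hw ε hε => ?_
  obtain ⟨w', hw', hd⟩ := Metric.mem_closure_iff.mp hw (ε / 2) (by linarith)
  obtain ⟨h, hl, hs, hc⟩ := hw' (ε / 2) (by linarith)
  have hd' : ∀ y, |w y - w' y| ≤ ε / 2 := fun y =>
    ((Real.dist_eq _ _).symm.le.trans (ContinuousMap.dist_apply_le_dist y)).trans hd.le
  refine ⟨h, hl, fun y hy => ?_, ?_⟩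
  · have h1 := abs_le.mp (hs y hy)
    have h2 := abs_le.mp (hd' y)
    exact abs_le.mpr ⟨by linarith, by linarith⟩
  · have h2 := abs_le.mp (hd' ⟨0, by simpa using hr⟩)
    linarith

/-- Averages with respect to a compactly supported probability density stay in a closed convex
set. -/
theorem integral_density_smul_mem {d : ℕ} {X : Type*} [NormedAddCommGroup X] [NormedSpace ℝ X]
    [CompleteSpace X] {S : Set X} (hS : Convex ℝ S) (hS' : IsClosed S) {ρ : E d → ℝ}
    (hρ : Continuous ρ) (hρ0 : ∀ t, 0 ≤ ρ t) (hρc : HasCompactSupport ρ) (hρ1 : ∫ t, ρ t = 1)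
    {W : E d → X} (hW : Continuous W) (hmem : ∀ t, ρ t ≠ 0 → W t ∈ S) :
    ∫ t, ρ t • W t ∈ S := by
  -- The weighted integral is the mean of `W` for the probability measure of density `ρ`, and such
  -- means stay in closed convex sets.
  set μ : Measure (E d) := volume.withDensity fun t => ENNReal.ofReal (ρ t) with hμ
  have hmeas : Measurable fun t => ENNReal.ofReal (ρ t) := hρ.measurable.ennreal_ofReal
  have hint : Integrable ρ := hρ.integrable_of_hasCompactSupport hρc
  have : IsProbabilityMeasure μ := ⟨by
    rw [hμ, withDensity_apply _ MeasurableSet.univ, Measure.restrict_univ,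
      ← ofReal_integral_eq_lintegral_ofReal hint (Filter.Eventually.of_forall hρ0), hρ1]
    simp⟩
  have hfin : ∀ᵐ t ∂(volume : Measure (E d)), ENNReal.ofReal (ρ t) < ⊤ :=
    Filter.Eventually.of_forall fun t => ENNReal.ofReal_lt_top
  have e : ∫ t, W t ∂μ = ∫ t, ρ t • W t := by
    rw [hμ, integral_withDensity_eq_integral_toReal_smul hmeas hfin]
    simp only [ENNReal.toReal_ofReal (hρ0 _)]
  rw [← e]
  refine hS.integral_mem hS' ?_ ?_
  · rw [hμ, ae_withDensity_iff hmeas]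
    exact Filter.Eventually.of_forall fun t ht => hmem t (by
      rintro h; rw [h] at ht; simp at ht)
  · rw [hμ, integrable_withDensity_iff_integrable_smul' hmeas hfin]
    simp only [ENNReal.toReal_ofReal (hρ0 _)]
    exact (hρ.smul hW).integrable_of_hasCompactSupport hρc.smul_right

section Slice

variable {m n : ℕ} (J : E m →ₗᵢ[ℝ] E n)

theorem hess_comp_slice {U : E n → ℝ} (hU : ContDiff ℝ 2 U) (x : E n) (y v w : E m) :
    hess (fun y => U (x + J y)) y v w = hess U (x + J y) (J v) (J w) := by
  have hA : ∀ y, HasFDerivAt (fun y => x + J y) J.toContinuousLinearMap y := fun y =>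
    J.toContinuousLinearMap.hasFDerivAt.const_add x
  have hf : fderiv ℝ (fun y => U (x + J y)) =
      fun y => (fderiv ℝ U (x + J y)).comp J.toContinuousLinearMap := by
    ext1 y
    exact ((hU.differentiable (by norm_num) _).hasFDerivAt.comp y (hA y)).fderiv
  have hd : DifferentiableAt ℝ (fderiv ℝ U) (x + J y) :=
    (hU.fderiv_right (m := 1) (by norm_num)).differentiable (by norm_num) _
  have h2 := ((ContinuousLinearMap.compL ℝ (E m) (E n) ℝ).flip
    J.toContinuousLinearMap).hasFDerivAt.comp y (hd.hasFDerivAt.comp y (hA y))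
  have h3 : (fun y => (fderiv ℝ U (x + J y)).comp J.toContinuousLinearMap) =
      ⇑((ContinuousLinearMap.compL ℝ (E m) (E n) ℝ).flip J.toContinuousLinearMap) ∘
        fderiv ℝ U ∘ fun y => x + J y := rfl
  rw [hess, hf, h3, h2.fderiv]
  simp

theorem lap_comp_slice (hmn : m + 1 = n) {ν : E n} (hν : ‖ν‖ = 1)
    (hJ : ∀ y, inner ℝ ν (J y) = (0 : ℝ)) {U : E n → ℝ} (hU : ContDiff ℝ 2 U) (x : E n)
    (y : E m) : lap (fun y => U (x + J y)) y = hyperplaneLaplacian U (x + J y) ν := by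
  rw [hyperplaneLaplacian_eq_sum J hmn hν hJ, lap]
  exact Finset.sum_congr rfl fun i _ => hess_comp_slice J hU x y _ _

theorem lap_sub {f g : E m → ℝ} (hf : ContDiff ℝ 2 f) (hg : ContDiff ℝ 2 g) (y : E m) :
    lap (fun y => f y - g y) y = lap f y - lap g y := by
  have h1 : fderiv ℝ (fun y => f y - g y) = fun y => fderiv ℝ f y - fderiv ℝ g y := by
    ext1 y
    exact fderiv_fun_sub (hf.differentiable (by norm_num) y) (hg.differentiable (by norm_num) y)
  have h2 : hess (fun y => f y - g y) y = hess f y - hess g y := by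
    rw [hess, h1]
    exact fderiv_fun_sub ((hf.fderiv_right (m := 1) (by norm_num)).differentiable (by norm_num) y)
      ((hg.fderiv_right (m := 1) (by norm_num)).differentiable (by norm_num) y)
  simp [lap, h2, Finset.sum_sub_distrib]

theorem continuous_hyperplaneLaplacian {U : E n → ℝ} (hU : ContDiff ℝ 2 U) (ν : E n) :
    Continuous fun x => hyperplaneLaplacian U x ν := by
  have : Continuous (fderiv ℝ (fderiv ℝ U)) :=
    (hU.fderiv_right (m := 1) (by norm_num)).continuous_fderiv (by norm_num)
  unfold hyperplaneLaplacian
  fun_prop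

/-- A `C²` function lying below the harmonic extensions of its values on small spheres satisfies
the corresponding differential inequality. -/
theorem hyperplaneLaplacian_nonneg_of_subharmonicAtCentre (hmn : m + 1 = n) (hm : 0 < m)
    {ν : E n} (hν : ‖ν‖ = 1) (hJ : ∀ y, inner ℝ ν (J y) = (0 : ℝ)) {U : E n → ℝ}
    (hU : ContDiff ℝ 2 U) {x : E n} {c r₀ : ℝ} (hr₀ : 0 < r₀)
    (h : ∀ r (hr : 0 < r), r < r₀ →
      (⟨fun y : Metric.closedBall (0 : E m) r => U (x + J y),
        by have := hU.continuous; have := J.continuous; fun_prop⟩ :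
        C(Metric.closedBall (0 : E m) r, ℝ)) ∈
        subharmonicAtCentre m hr.le (c * r ^ 2 / (2 * m))) :
    0 ≤ hyperplaneLaplacian U x ν + c := by
  have hm0 : (0 : ℝ) < m := by exact_mod_cast hm
  by_contra! hlt
  set δ := -(hyperplaneLaplacian U x ν + c) / 2 with hδ
  have hδpos : 0 < δ := by rw [hδ]; linarith
  have hev : ∀ᶠ z in 𝓝 x, hyperplaneLaplacian U z ν < -(c + δ) :=
    (continuous_hyperplaneLaplacian hU ν).continuousAt.eventually_lt continuousAt_const
      (by rw [hδ]; linarith)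
  obtain ⟨r₁, hr₁, hball⟩ := Metric.eventually_nhds_iff.mp hev
  set r := min r₀ r₁ / 2 with hr
  have hmin : 0 < min r₀ r₁ := lt_min hr₀ hr₁
  have hrpos : 0 < r := by rw [hr]; linarith
  have hrr₀ : r < r₀ := by have := min_le_left r₀ r₁; linarith
  have hrr₁ : r < r₁ := by have := min_le_right r₀ r₁; linarith
  -- The extra `δ` in the Laplacian of `v` below gains `δ r²/(2m) = 4ε` at the centre. The losses
  -- are only `2ε`: one from the values on the sphere, one from the inequality at the centre.
  set ε := δ * r ^ 2 / (8 * m) with hε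
  have hεpos : 0 < ε := by positivity
  obtain ⟨p, hp, hs, hc⟩ := h r hrpos hrr₀ ε hεpos
  set v := p + MvPolynomial.C ((c + δ) / (2 * m)) * ballP m r with hv
  have hvev : ∀ y, evalP v y = evalP p y + (c + δ) / (2 * m) * (r ^ 2 - ‖y‖ ^ 2) := fun y => by
    rw [← evalP_ballP]; simp [evalP, hv]
  have hlapv : ∀ y, lap (evalP v) y = -(c + δ) := fun y => by
    rw [lap_evalP, hv, lapP_add, hp, lapP_C_mul, lapP_ballP]
    simp [evalP]; field_simp; ring
  have hv2 : ContDiff ℝ 2 (evalP v) := (contDiff_evalP v).of_le le_top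
  have hUJ : ContDiff ℝ 2 fun y => U (x + J y) :=
    hU.comp (contDiff_const.add J.toContinuousLinearMap.contDiff)
  have hmax := le_of_lap_pos (g := fun y => evalP v y - U (x + J y)) (r := r) (c := ε)
    (hv2.sub hUJ).continuous.continuousOn
    (fun y hy => ⟨(hv2.sub hUJ).contDiffAt, by
      rw [lap_sub hv2 hUJ, hlapv, lap_comp_slice J hmn hν hJ hU]
      have : dist (x + J y) x < r₁ := by
        have := mem_ball_zero_iff.mp hy
        simp [dist_eq_norm]; linarith
      have := hball this
      linarith⟩)
    (fun y hy => by
      have hy' : ‖y‖ = r := by simpa using hy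
      have h1 := (abs_le.mp (hs ⟨y, by simpa using hy'.le⟩ hy')).2
      simp only [ContinuousMap.coe_mk] at h1
      have h2 := hvev y
      rw [hy', sub_self, mul_zero, add_zero] at h2
      linarith) 0 (by simpa using hrpos.le)
  simp only [ContinuousMap.coe_mk, map_zero, add_zero] at hc hmax
  have h2 := hvev 0
  rw [norm_zero] at h2
  have h3 : (c + δ) / (2 * m) * (r ^ 2 - 0 ^ 2) = c * r ^ 2 / (2 * m) + 4 * ε := by
    rw [hε]; field_simp; ring
  linarith

theorem slice_mem_subharmonicAtCentre (hmn : m + 1 = n) (hm : 0 < m) (hn : 3 ≤ n) {u : E n → ℝ}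
    {Ω : Set (E n)} (hΩ : IsOpen Ω) (hu : ContDiff ℝ 1 u) (hpos : ∀ x ∈ Ω, 0 < u x)
    (hvisc : ViscosityNegCone 2 u Ω) {ν : E n} (hν : ‖ν‖ = 1)
    (hJ : ∀ y, inner ℝ ν (J y) = (0 : ℝ)) {x : E n} {r R c : ℝ} (hr : 0 < r) (hrR : r < R)
    (hR : Metric.closedBall x R ⊆ Ω) (hc : ∀ z ∈ Metric.closedBall x R, gradTerm u z ν < c)
    (w : C(Metric.closedBall (0 : E m) r, ℝ)) (hw : ∀ y, w y = u (x + J y)) :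
    w ∈ subharmonicAtCentre m hr.le (c * r ^ 2 / (2 * m)) := by
  intro ε hε
  -- Raising the boundary values by `ε/2` before approximating within `ε/2` puts the harmonic
  -- polynomial above `u` on the sphere, at distance less than `ε`.
  have hcont : Continuous fun y => u (x + J y) + ε / 2 := by
    have := hu.continuous; have := J.continuous; fun_prop
  obtain ⟨h, hh, hnear⟩ := exists_harmonic_near_on_sphere hm hr hcont.continuousOn
    (show 0 < ε / 2 by linarith)
  refine ⟨h, hh, fun y hy => ?_, ?_⟩
  · have := abs_lt.mp (hnear y hy)
    rw [hw]
    exact abs_le.mpr ⟨by linarith, by linarith⟩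
  · have := le_harmonic_of_viscosity J hmn hm hn hΩ hu.contDiffOn hpos hvisc hν hJ hr hrR hR hc hh
      (fun y hy => by have := abs_lt.mp (hnear y hy); linarith)
    rw [hw]
    simp only [map_zero, add_zero]
    linarith

end Slice

/-- The mollification of `u` by a normalised bump function. -/
def mollify {d : ℕ} {F : Type*} [NormedAddCommGroup F] [NormedSpace ℝ F]
    (φ : ContDiffBump (0 : E d)) (u : E d → F) : E d → F :=
  convolution (φ.normed volume) u (ContinuousLinearMap.lsmul ℝ ℝ) volume

theorem mollify_apply {d : ℕ} {F : Type*} [NormedAddCommGroup F] [NormedSpace ℝ F]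
    (φ : ContDiffBump (0 : E d)) (u : E d → F) (x : E d) :
    mollify φ u x = ∫ t, φ.normed volume t • u (x - t) := rfl

theorem contDiff_mollify {d : ℕ} {F : Type*} [NormedAddCommGroup F] [NormedSpace ℝ F]
    [CompleteSpace F] (φ : ContDiffBump (0 : E d)) {u : E d → F} (hu : LocallyIntegrable u) :
    ContDiff ℝ ∞ (mollify φ u) :=
  φ.hasCompactSupport_normed.contDiff_convolution_left _ φ.contDiff_normed hu

/-- On a slice through `x`, the mollification is the average of the slices of `u` through the points
`x - t`. Each of these lies in the same closed convex set, hence so does the average, and the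
average is smooth. -/
theorem hyperplaneLaplacian_mollify_nonneg {n : ℕ} (hn : 3 ≤ n) {u : E n → ℝ}
    {Ω : Set (E n)} (hΩ : IsOpen Ω) (hu : ContDiff ℝ 1 u) (hpos : ∀ x ∈ Ω, 0 < u x)
    (hvisc : ViscosityNegCone 2 u Ω) {ν : E n} (hν : ‖ν‖ = 1) {x : E n} {R c : ℝ}
    (hR : Metric.closedBall x R ⊆ Ω) (hc : ∀ z ∈ Metric.closedBall x R, gradTerm u z ν < c)
    (φ : ContDiffBump (0 : E n)) (hφ : φ.rOut < R) :
    0 ≤ hyperplaneLaplacian (mollify φ u) x ν + c := by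
  obtain ⟨m, rfl⟩ : ∃ m, n = m + 1 := ⟨n - 1, by omega⟩
  obtain ⟨J, hJ⟩ := exists_isometry_orthogonal (m := m) rfl hν
  have hm : 0 < m := by omega
  have hU : ContDiff ℝ 2 (mollify φ u) := contDiff_infty.mp
    (contDiff_mollify φ (hu.continuous.locallyIntegrable (μ := volume))) 2
  -- With this `r₀`, the balls of radius `R - φ.rOut` about the shifted centres `x - t` stay in the
  -- ball where `gradTerm u · ν < c`.
  refine hyperplaneLaplacian_nonneg_of_subharmonicAtCentre J rfl hm hν hJ hU (r₀ := R - φ.rOut)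
    (by linarith) fun r hr hrR => ?_
  let W : C(E (m + 1), C(Metric.closedBall (0 : E m) r, ℝ)) := ContinuousMap.curry
    ⟨fun q : E (m + 1) × Metric.closedBall (0 : E m) r => u (x - q.1 + J q.2), by
      have := hu.continuous; have := J.continuous; fun_prop⟩
  have hmem := integral_density_smul_mem (convex_subharmonicAtCentre m hr.le (c * r ^ 2 / (2 * m)))
    (isClosed_subharmonicAtCentre m hr.le (c * r ^ 2 / (2 * m)))
    (φ.continuous_normed (μ := volume)) φ.nonneg_normed φ.hasCompactSupport_normed
    φ.integral_normed W.continuous (fun t ht => by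
      have htb : ‖t‖ < φ.rOut := by
        have : t ∈ Function.support (φ.normed volume) := ht
        rw [φ.support_normed_eq] at this
        simpa using this
      have hsub : Metric.closedBall (x - t) (R - φ.rOut) ⊆ Metric.closedBall x R := by
        refine Metric.closedBall_subset_closedBall' ?_
        simp; linarith
      exact slice_mem_subharmonicAtCentre J rfl hm hn hΩ hu hpos hvisc hν hJ hr hrR
        (hsub.trans hR) (fun z hz => hc z (hsub hz)) (W t) fun y => rfl)
  convert hmem using 1
  ext y
  rw [ContinuousMap.integral_apply]
  · simp only [ContinuousMap.coe_mk, mollify_apply, ContinuousMap.smul_apply]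
    refine integral_congr_ae (Filter.Eventually.of_forall fun t => ?_)
    simp only [W, ContinuousMap.curry_apply, ContinuousMap.coe_mk]
    congr 2; abel
  · exact (φ.continuous_normed.smul W.continuous).integrable_of_hasCompactSupport
      φ.hasCompactSupport_normed.smul_right

/-! ### Localisation and `C¹` approximation near a compact set -/

theorem viscosityNegCone_congr {n k : ℕ} {u v : E n → ℝ} {Ω V : Set (E n)} (hV : V ⊆ Ω)
    (huv : ∀ x ∈ V, u =ᶠ[𝓝 x] v) (h : ViscosityNegCone k u Ω) : ViscosityNegCone k v V := by
  intro x hx ψ hψ h0 hle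
  refine h x (hV hx) ψ hψ (h0.trans (huv x hx).eq_of_nhds.symm) ?_
  filter_upwards [hle, huv x hx] with y h1 h2
  rwa [h2]

/-- Extension of a function from a neighbourhood of a compact set. -/
theorem exists_contDiff_extension {n : ℕ} {u : E n → ℝ} {Ω K : Set (E n)} (hΩ : IsOpen Ω)
    (hu : ContDiffOn ℝ 1 u Ω) (hK : IsCompact K) (hKΩ : K ⊆ Ω) :
    ∃ v : E n → ℝ, ContDiff ℝ 1 v ∧ HasCompactSupport v ∧
      ∃ V : Set (E n), IsOpen V ∧ K ⊆ V ∧ V ⊆ Ω ∧ ∀ x ∈ V, u =ᶠ[𝓝 x] v := by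
  obtain ⟨B, hB⟩ := hK.isBounded.subset_ball (0 : E n)
  -- Intersecting with a ball makes the cut-off function, and hence the extension, compactly
  -- supported.
  set Ω' := Ω ∩ Metric.ball 0 B with hΩ'
  have hΩ'o : IsOpen Ω' := hΩ.inter Metric.isOpen_ball
  have hdisj : Disjoint Ω'ᶜ K := by
    rw [Set.disjoint_left]
    intro x hx hxK
    exact hx ⟨hKΩ hxK, hB hxK⟩
  obtain ⟨f, hf0, hf1, -⟩ := exists_contMDiffMap_zero_one_nhds_of_isClosed (n := 1)
    (modelWithCornersSelf ℝ (E n)) hΩ'o.isClosed_compl hK.isClosed hdisj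
  have hfs : ContDiff ℝ 1 f := by
    have h : ContMDiff (modelWithCornersSelf ℝ (E n)) (modelWithCornersSelf ℝ ℝ) 1 f := f.contMDiff
    exact contMDiff_iff_contDiff.mp h
  rw [eventually_nhdsSet_iff_forall] at hf0 hf1
  refine ⟨fun x => f x * u x, ?_, ?_, {x | ∀ᶠ y in 𝓝 x, f y = 1} ∩ Ω, ?_, ?_, ?_, ?_⟩
  · rw [contDiff_iff_contDiffAt]
    intro x
    by_cases hx : x ∈ Ω'
    · exact hfs.contDiffAt.mul (hu.contDiffAt (hΩ.mem_nhds hx.1))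
    · have : (fun x => f x * u x) =ᶠ[𝓝 x] fun _ => 0 := by
        filter_upwards [hf0 x hx] with y hy
        rw [hy, zero_mul]
      exact contDiffAt_const.congr_of_eventuallyEq this
  · refine HasCompactSupport.intro (isCompact_closedBall (0 : E n) B) fun x hx => ?_
    have : x ∈ Ω'ᶜ := fun h => hx (Metric.ball_subset_closedBall h.2)
    rw [(hf0 x this).self_of_nhds, zero_mul]
  · exact isOpen_setOfPred_eventually_nhds.inter hΩ
  · exact fun x hx => ⟨hf1 x hx, hKΩ hx⟩
  · exact Set.inter_subset_right
  · intro x hx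
    filter_upwards [hx.1] with y hy
    rw [hy, one_mul]

theorem fderiv_mollify {n : ℕ} {v : E n → ℝ} (hv : ContDiff ℝ 1 v) (hvc : HasCompactSupport v)
    (φ : ContDiffBump (0 : E n)) (x : E n) :
    fderiv ℝ (mollify φ v) x = mollify φ (fderiv ℝ v) x := by
  have h := hvc.hasFDerivAt_convolution_right (μ := volume) (ContinuousLinearMap.lsmul ℝ ℝ)
    (φ.continuous_normed (μ := volume)).locallyIntegrable hv x
  rw [mollify, h.fderiv, mollify]
  refine integral_congr_ae (Filter.Eventually.of_forall fun t => ?_)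
  ext w
  simp

theorem continuousOn_gradTerm {n : ℕ} (hn : 3 ≤ n) {u : E n → ℝ} {Ω : Set (E n)} (hΩ : IsOpen Ω)
    (hu : ContDiffOn ℝ 1 u Ω) (hpos : ∀ x ∈ Ω, 0 < u x) :
    ContinuousOn (fun q : E n × E n => gradTerm u q.1 q.2) (Ω ×ˢ Set.univ) := by
  have hn2 : (0 : ℝ) < (n : ℝ) - 2 := by
    have : (3 : ℝ) ≤ n := by exact_mod_cast hn
    linarith
  have h1 : ContinuousOn (fun q : E n × E n => fderiv ℝ u q.1) (Ω ×ˢ Set.univ) :=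
    (hu.continuousOn_fderiv_of_isOpen hΩ le_rfl).comp continuousOn_fst fun q hq => hq.1
  have h2 : ContinuousOn (fun q : E n × E n => u q.1) (Ω ×ˢ Set.univ) :=
    hu.continuousOn.comp continuousOn_fst fun q hq => hq.1
  unfold gradTerm
  refine ContinuousOn.div ?_ (continuousOn_const.mul h2) fun q hq =>
    (mul_pos hn2 (hpos _ hq.1)).ne'
  refine (continuousOn_const.mul ((h1.clm_apply continuousOn_snd).pow 2)).sub ?_
  exact continuousOn_finsetSum _ fun k _ => (h1.clm_apply continuousOn_const).pow 2

theorem gradTerm_congr {n : ℕ} {u v : E n → ℝ} {x : E n} (h : u =ᶠ[𝓝 x] v) (ν : E n) :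
    gradTerm u x ν = gradTerm v x ν := by
  simp only [gradTerm, pd, h.fderiv_eq, h.eq_of_nhds]

/-- Smooth approximation of a viscosity subsolution, in the `C¹` sense, by functions that are
approximate subsolutions. -/
theorem exists_smooth_approx {n : ℕ} (hn : 3 ≤ n) {u : E n → ℝ} {Ω K : Set (E n)}
    (hΩ : IsOpen Ω) (hu : ContDiffOn ℝ 1 u Ω) (hpos : ∀ x ∈ Ω, 0 < u x)
    (hvisc : ViscosityNegCone 2 u Ω) (hK : IsCompact K) (hKΩ : K ⊆ Ω) {η : ℝ} (hη : 0 < η) :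
    ∃ U : E n → ℝ, ContDiff ℝ 2 U ∧ ∀ x ∈ K, ‖fderiv ℝ U x - fderiv ℝ u x‖ ≤ η ∧
      ∀ ν : E n, ‖ν‖ = 1 → 0 ≤ hyperplaneLaplacian U x ν + gradTerm u x ν + η := by
  obtain ⟨v, hv, hvc, V, hVo, hKV, hVΩ, huv⟩ := exists_contDiff_extension hΩ hu hK hKΩ
  have hposV : ∀ x ∈ V, 0 < v x := fun x hx => by
    rw [← (huv x hx).eq_of_nhds]; exact hpos x (hVΩ hx)
  have hviscV := viscosityNegCone_congr hVΩ huv hvisc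
  obtain ⟨R₀, hR₀, hthick⟩ := hK.exists_cthickening_subset_open hVo hKV
  have hcomp : IsCompact (Metric.cthickening R₀ K ×ˢ Metric.sphere (0 : E n) 1) :=
    hK.cthickening.prod (isCompact_sphere _ _)
  have hunif := hcomp.uniformContinuousOn_of_continuous
    ((continuousOn_gradTerm hn hVo hv.contDiffOn hposV).mono
      (Set.prod_mono hthick (Set.subset_univ _)))
  obtain ⟨δ₁, hδ₁, hu₁⟩ := Metric.uniformContinuousOn_iff.mp hunif η hη
  have hfd : UniformContinuous (fderiv ℝ v) :=
    (hvc.fderiv ℝ).uniformContinuous_of_continuous (hv.continuous_fderiv one_ne_zero)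
  obtain ⟨δ₂, hδ₂, hu₂⟩ := Metric.uniformContinuous_iff.mp hfd η hη
  set R := min R₀ (min δ₁ δ₂) / 2 with hR
  have hmin : 0 < min R₀ (min δ₁ δ₂) := lt_min hR₀ (lt_min hδ₁ hδ₂)
  have hRpos : 0 < R := by rw [hR]; linarith
  have hRR₀ : R < R₀ := by have := min_le_left R₀ (min δ₁ δ₂); linarith
  have hRδ₁ : R < δ₁ := by
    have := (min_le_right R₀ (min δ₁ δ₂)).trans (min_le_left _ _); linarith
  have hRδ₂ : R < δ₂ := by
    have := (min_le_right R₀ (min δ₁ δ₂)).trans (min_le_right _ _); linarith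
  let φ : ContDiffBump (0 : E n) := ⟨R / 4, R / 2, by linarith, by linarith⟩
  have hφ : φ.rOut = R / 2 := rfl
  refine ⟨mollify φ v, contDiff_infty.mp
    (contDiff_mollify φ (hv.continuous.locallyIntegrable (μ := volume))) 2, fun x hx => ⟨?_, ?_⟩⟩
  · rw [fderiv_mollify hv hvc, (huv x (hKV hx)).fderiv_eq, ← dist_eq_norm]
    refine ContDiffBump.dist_normed_convolution_le
      (hv.continuous_fderiv one_ne_zero).aestronglyMeasurable fun z hz => (hu₂ ?_).le
    have := Metric.mem_ball.mp hz
    linarith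
  · intro ν hν
    have hsub : Metric.closedBall x R ⊆ Metric.cthickening R₀ K :=
      (Metric.closedBall_subset_cthickening hx R).trans (Metric.cthickening_mono hRR₀.le K)
    -- The mollified inequality is used with `c = gradTerm v x ν + η`. By uniform continuity on the
    -- thickened set times the unit sphere, this bounds `gradTerm v z ν` for all `z` within `R` of
    -- `x`, with `R` independent of `x` and `ν`.
    rw [add_assoc, gradTerm_congr (huv x (hKV hx))]
    refine hyperplaneLaplacian_mollify_nonneg hn hVo hv hposV hviscV hν (hsub.trans hthick)
      (fun z hz => ?_) φ (by rw [hφ]; linarith)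
    have hxx : x ∈ Metric.cthickening R₀ K := hsub (Metric.mem_closedBall_self hRpos.le)
    have := hu₁ (z, ν) ⟨hsub hz, by simpa using hν⟩ (x, ν) ⟨hxx, by simpa using hν⟩ (by
      rw [Prod.dist_eq, dist_self, max_eq_left dist_nonneg]
      exact (Metric.mem_closedBall.mp hz).trans_lt hRδ₁)
    have := (abs_lt.mp ((Real.dist_eq _ _).symm.le.trans_lt this)).2
    simp only at this
    linarith

/-! ### The chain rule for weak derivatives -/

section WeakChain

variable {m : ℕ} {V : Type*} [NormedAddCommGroup V] [NormedSpace ℝ V]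

theorem norm_mollify_le (φ : ContDiffBump (0 : E m)) (h : E m → V) (x : E m) :
    ‖mollify φ h x‖ ≤ mollify φ (fun y => ‖h y‖) x := by
  rw [mollify_apply, mollify_apply]
  refine (norm_integral_le_integral_norm _).trans (le_of_eq ?_)
  refine integral_congr_ae (Filter.Eventually.of_forall fun t => ?_)
  simp [norm_smul, abs_of_nonneg (φ.nonneg_normed (μ := volume) t)]

theorem integral_norm_mollify_le [CompleteSpace V] (φ : ContDiffBump (0 : E m)) {h : E m → V}
    (hh : Integrable h) : ∫ x, ‖mollify φ h x‖ ≤ ∫ x, ‖h x‖ := by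
  have hρ : Integrable (φ.normed volume) := φ.integrable_normed
  have h1 : Integrable (mollify φ h) := hρ.integrable_convolution _ hh
  have h2 : Integrable (mollify φ fun y => ‖h y‖) := hρ.integrable_convolution _ hh.norm
  refine (integral_mono h1.norm h2 fun x => norm_mollify_le φ h x).trans (le_of_eq ?_)
  have := integral_convolution (μ := (volume : Measure (E m))) (ν := volume)
    (ContinuousLinearMap.lsmul ℝ ℝ) hρ hh.norm
  rw [φ.integral_normed] at this
  rw [mollify, this]; simp

/-- Mollification converges in `L¹`. -/
theorem exists_integral_norm_mollify_sub_le [CompleteSpace V] {b : E m → V} (hb : Integrable b)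
    {ε : ℝ} (hε : 0 < ε) : ∃ δ > 0, ∀ φ : ContDiffBump (0 : E m), φ.rOut < δ →
      ∫ x, ‖mollify φ b x - b x‖ ≤ ε := by
  -- One third of `ε` goes to approximating `b` by a continuous compactly supported `g`, one third
  -- to the mollified difference (mollifying does not increase the `L¹` norm), one third to the
  -- uniform convergence for `g`.
  obtain ⟨g, hgc, hgb, hg, hgi⟩ := hb.exists_hasCompactSupport_integral_sub_le
    (show 0 < ε / 3 by linarith)
  set K := Metric.cthickening 1 (tsupport g) with hK
  have hKc : IsCompact K := IsCompact.cthickening hgc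
  set κ := ε / 3 / (volume.real K + 1) with hκ
  have hκpos : 0 < κ := by positivity
  obtain ⟨δ, hδ, hu⟩ := Metric.uniformContinuous_iff.mp (hgc.uniformContinuous_of_continuous hg)
    κ hκpos
  refine ⟨min δ 1, lt_min hδ one_pos, fun φ hφ => ?_⟩
  have hρ : Integrable (φ.normed volume) := φ.integrable_normed
  have hmb : Integrable (mollify φ b) := hρ.integrable_convolution _ hb
  have hmg : Integrable (mollify φ g) := hρ.integrable_convolution _ hgi
  have hdist : ∀ x, ‖mollify φ g x - g x‖ ≤ κ := fun x => by
    rw [← dist_eq_norm]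
    refine ContDiffBump.dist_normed_convolution_le hg.aestronglyMeasurable fun z hz => (hu ?_).le
    exact (Metric.mem_ball.mp hz).trans (hφ.trans_le (min_le_left _ _))
  have hzero : ∀ x ∉ K, mollify φ g x - g x = 0 := by
    intro x hx
    have hg0 : ∀ z ∈ Metric.ball x φ.rOut, g z = 0 := by
      intro z hz
      by_contra hne
      refine hx (Metric.mem_cthickening_of_dist_le x z 1 _ (subset_tsupport g hne) ?_)
      rw [dist_comm]
      exact (Metric.mem_ball.mp hz).le.trans (hφ.le.trans (min_le_right _ _))
    have h0 := hg0 x (Metric.mem_ball_self φ.rOut_pos)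
    rw [mollify, φ.normed_convolution_eq_right fun z hz => by rw [hg0 z hz, h0], sub_self]
  have hmid : ∫ x, ‖mollify φ g x - g x‖ ≤ ε / 3 := by
    have h1 : ∫ x, ‖mollify φ g x - g x‖ = ∫ x in K, ‖mollify φ g x - g x‖ :=
      (setIntegral_eq_integral_of_forall_compl_eq_zero fun x hx => by
        rw [hzero x hx, norm_zero]).symm
    rw [h1]
    calc ∫ x in K, ‖mollify φ g x - g x‖ ≤ ∫ _x in K, κ :=
          integral_mono (hmg.sub hgi).norm.integrableOn
            (integrableOn_const hKc.measure_lt_top.ne) fun x => hdist x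
      _ = volume.real K * κ := by simp
      _ ≤ ε / 3 := by
        rw [hκ, mul_div_assoc', div_le_iff₀ (by positivity)]
        have : 0 ≤ volume.real K := measureReal_nonneg
        nlinarith
  have hsub : ∀ x, mollify φ (fun y => b y - g y) x = mollify φ b x - mollify φ g x := by
    intro x
    have e1 : ∀ {h : E m → V}, Integrable h →
        ConvolutionExistsAt (φ.normed volume) h x (ContinuousLinearMap.lsmul ℝ ℝ) volume :=
      fun hh => φ.hasCompactSupport_normed.convolutionExists_left _ φ.continuous_normed
        hh.locallyIntegrable x
    rw [mollify_apply, mollify_apply, mollify_apply, ← integral_sub]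
    · simp only [smul_sub]
    · exact e1 hb
    · exact e1 hgi
  have hfirst := integral_norm_mollify_le φ (hb.sub hgi)
  have e0 : (b - g) = fun y => b y - g y := rfl
  simp only [e0, hsub] at hfirst
  calc ∫ x, ‖mollify φ b x - b x‖
      ≤ ∫ x, (‖mollify φ b x - mollify φ g x‖ + ‖mollify φ g x - g x‖ + ‖b x - g x‖) := by
        refine integral_mono (hmb.sub hb).norm
          (((hmb.sub hmg).norm.add (hmg.sub hgi).norm).add (hb.sub hgi).norm) fun x => ?_
        have e : mollify φ b x - b x = (mollify φ b x - mollify φ g x) + (mollify φ g x - g x)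
          + (g x - b x) := by abel
        simp only
        rw [e, norm_sub_rev (b x)]
        exact (norm_add_le _ _).trans (add_le_add_left (norm_add_le _ _) _)
    _ = (∫ x, ‖mollify φ b x - mollify φ g x‖) + (∫ x, ‖mollify φ g x - g x‖)
          + ∫ x, ‖b x - g x‖ := by
        have i1 : Integrable fun x => ‖mollify φ b x - mollify φ g x‖ := (hmb.sub hmg).norm
        have i2 : Integrable fun x => ‖mollify φ g x - g x‖ := (hmg.sub hgi).norm
        have i3 : Integrable fun x => ‖b x - g x‖ := (hb.sub hgi).norm
        rw [← integral_add i1 i2]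
        exact integral_add (i1.add i2) i3
    _ ≤ ε := by linarith

theorem integrable_mul_of_tsupport {φ G : E m → ℝ} (hφ : Continuous φ)
    (hφc : HasCompactSupport φ) (hG : ContinuousOn G (tsupport φ)) :
    Integrable fun y => φ y * G y := by
  have h1 : IntegrableOn (fun y => φ y * G y) (tsupport φ) :=
    (hφ.continuousOn.mul hG).integrableOn_compact hφc
  refine (integrableOn_iff_integrable_of_support_subset fun y hy => ?_).mp h1
  exact subset_tsupport φ (left_ne_zero_of_mul hy)

/-- Mollification commutes with weak derivatives. -/
theorem pd_mollify_of_isWeakPartial [CompleteSpace V] {U K : Set (E m)}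
    {j : Fin m} {a b : E m → V} (hab : IsWeakPartial U j a b) (hK : IsCompact K) (hKU : K ⊆ U)
    (φ : ContDiffBump (0 : E m)) {y : E m} (hy : Metric.closedBall y φ.rOut ⊆ K) :
    pd j (mollify φ (K.indicator a)) y = mollify φ (K.indicator b) y := by
  obtain ⟨ha, hb, hw⟩ := hab
  have hKm : MeasurableSet K := hK.measurableSet
  have hai : Integrable (K.indicator a) :=
    (integrable_indicator_iff hKm).mpr (ha.integrableOn_compact_subset hKU hK)
  set ρ := φ.normed (volume : Measure (E m)) with hρ
  have hρs : ContDiff ℝ ∞ ρ := φ.contDiff_normed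
  have hρ1 : ContDiff ℝ 1 ρ := φ.contDiff_normed
  have hρc : HasCompactSupport ρ := φ.hasCompactSupport_normed
  -- The derivative of the convolution falls on the kernel; the reflected kernel centred at `y` is
  -- an admissible test function because its support lies in `K ⊆ U`.
  let θ : E m → ℝ := fun s => ρ (y - s)
  have hθ : ContDiff ℝ ∞ θ := hρs.comp (contDiff_const.sub contDiff_id)
  have hθ0 : ∀ s, s ∉ Metric.closedBall y φ.rOut → θ s = 0 := by
    intro s hs
    by_contra hne
    have : y - s ∈ Function.support ρ := hne
    rw [hρ, φ.support_normed_eq] at this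
    refine hs ?_
    rw [mem_closedBall_iff_norm, norm_sub_rev]
    exact (mem_ball_zero_iff.mp this).le
  have hθts : tsupport θ ⊆ Metric.closedBall y φ.rOut :=
    closure_minimal (fun s hs => by by_contra h; exact hs (hθ0 s h)) Metric.isClosed_closedBall
  have hθc : HasCompactSupport θ := HasCompactSupport.intro (isCompact_closedBall y φ.rOut) hθ0
  have hθd : ∀ s, pd j θ s = -fderiv ℝ ρ (y - s) (EuclideanSpace.single j 1) := by
    intro s
    have h1 := (hρ1.differentiable one_ne_zero (y - s)).hasFDerivAt.comp s
      ((hasFDerivAt_id s).const_sub y)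
    have h2 : fderiv ℝ θ s = _ := h1.fderiv
    rw [pd, h2]; simp
  have key := hw θ hθ hθc (hθts.trans (hy.trans hKU))
  have hpdθ0 : ∀ s ∉ K, pd j θ s = 0 := by
    intro s hs
    have : s ∉ tsupport (fderiv ℝ θ) := fun h => hs (hy (hθts (tsupport_fderiv_subset ℝ h)))
    rw [pd, image_eq_zero_of_notMem_tsupport this]; simp
  have hcut : ∀ (c : E m → ℝ) (g : E m → V), (∀ s ∉ K, c s = 0) →
      ∫ s in U, c s • g s = ∫ s, c s • K.indicator g s := by
    intro c g hc
    rw [setIntegral_eq_integral_of_forall_compl_eq_zero fun s hs => by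
      rw [hc s fun h => hs (hKU h), zero_smul]]
    refine integral_congr_ae (Filter.Eventually.of_forall fun s => ?_)
    by_cases hs : s ∈ K
    · simp [hs]
    · simp [hc s hs]
  have hL := hcut (pd j θ) a hpdθ0
  have hR := hcut θ b fun s hs => hθ0 s fun h => hs (hy h)
  have h3 := (hρc.hasFDerivAt_convolution_left (ContinuousLinearMap.lsmul ℝ ℝ) hρ1
    hai.locallyIntegrable y).fderiv
  have hex : ConvolutionExistsAt (fderiv ℝ ρ) (K.indicator a) y
      ((ContinuousLinearMap.lsmul ℝ ℝ : ℝ →L[ℝ] V →L[ℝ] V).precompL (E m)) volume :=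
    (hρc.fderiv ℝ).convolutionExists_left _ (hρ1.continuous_fderiv one_ne_zero)
      hai.locallyIntegrable y
  have h4 : pd j (mollify φ (K.indicator a)) y =
      ∫ t, fderiv ℝ ρ t (EuclideanSpace.single j 1) • K.indicator a (y - t) := by
    rw [pd, mollify, h3, convolution, ContinuousLinearMap.integral_apply hex]
    rfl
  rw [h4, mollify_apply, ← integral_sub_left_eq_self _ volume y,
    ← integral_sub_left_eq_self (fun t => φ.normed volume t • K.indicator b (y - t)) volume y]
  simp only [sub_sub_cancel]
  rw [hL, hR] at key
  simp only [hθd, neg_smul, integral_neg, neg_inj] at key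
  exact key

end WeakChain

section WeakChain

variable {m : ℕ} {V : Type*} [NormedAddCommGroup V] [NormedSpace ℝ V]

theorem continuous_pd {φ : E m → ℝ} (hφ : ContDiff ℝ 1 φ) (j : Fin m) : Continuous (pd j φ) :=
  (hφ.continuous_fderiv one_ne_zero).clm_apply continuous_const

theorem tsupport_pd_subset (φ : E m → ℝ) (j : Fin m) : tsupport (pd j φ) ⊆ tsupport φ := by
  refine (closure_mono fun y hy => ?_).trans (tsupport_fderiv_subset ℝ (f := φ))
  rw [Function.mem_support] at hy ⊢
  rintro h
  exact hy (by rw [pd, h]; simp)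

theorem hasCompactSupport_pd {φ : E m → ℝ} (hφ : HasCompactSupport φ) (j : Fin m) :
    HasCompactSupport (pd j φ) :=
  hφ.of_isClosed_subset (isClosed_tsupport _) (tsupport_pd_subset φ j)

theorem integrable_mul_clm_of_tsupport {φ : E m → ℝ} {G : E m → V →L[ℝ] ℝ} {b : E m → V}
    (hφ : Continuous φ) (hφc : HasCompactSupport φ) (hG : ContinuousOn G (tsupport φ))
    (hb : IntegrableOn b (tsupport φ)) : Integrable fun y => φ y * G y (b y) := by
  obtain ⟨C, hC⟩ := (show IsCompact (tsupport φ) from hφc).exists_bound_of_continuousOn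
    (f := fun y => ‖φ y‖ * ‖G y‖) (hφ.norm.continuousOn.mul hG.norm)
  have hmeas : MeasurableSet (tsupport φ) := (isClosed_tsupport φ).measurableSet
  have h1 : IntegrableOn (fun y => φ y * G y (b y)) (tsupport φ) := by
    refine Integrable.mono' (hb.norm.const_mul C) ?_ ?_
    · refine (hφ.aestronglyMeasurable).mul ?_
      exact (ContinuousLinearMap.id ℝ (V →L[ℝ] ℝ)).aestronglyMeasurable_comp₂
        (hG.aestronglyMeasurable hmeas) hb.aestronglyMeasurable
    · refine (ae_restrict_iff' hmeas).mpr (Filter.Eventually.of_forall fun y hy => ?_)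
      have h := hC y hy
      rw [norm_mul, norm_norm, norm_norm] at h
      rw [norm_mul]
      calc ‖φ y‖ * ‖G y (b y)‖ ≤ ‖φ y‖ * (‖G y‖ * ‖b y‖) := by
            gcongr; exact (G y).le_opNorm _
        _ = (‖φ y‖ * ‖G y‖) * ‖b y‖ := by ring
        _ ≤ C * ‖b y‖ := by gcongr
  refine (integrableOn_iff_integrable_of_support_subset fun y hy => ?_).mp h1
  exact subset_tsupport φ (left_ne_zero_of_mul hy)

/-- The classical case, to which the weak chain rule is reduced by mollifying `a`. The map `A` needs
to stay in `W` only over the support of `φ`. -/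
theorem integral_mul_fderiv_comp_of_contDiff {φ : E m → ℝ} (hφ : ContDiff ℝ 1 φ)
    (hφc : HasCompactSupport φ) {A : E m → V} (hA : ContDiff ℝ 1 A) {W : Set V} (hW : IsOpen W)
    {Ψ : V → ℝ} (hΨ : ContDiffOn ℝ 1 Ψ W) (hAW : ∀ y ∈ tsupport φ, A y ∈ W) (j : Fin m) :
    ∫ y, φ y * fderiv ℝ Ψ (A y) (pd j A y) = -∫ y, pd j φ y * Ψ (A y) := by
  have hd : ∀ y ∈ tsupport φ, HasFDerivAt (fun y => Ψ (A y))
      ((fderiv ℝ Ψ (A y)).comp (fderiv ℝ A y)) y := fun y hy =>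
    ((hΨ.contDiffAt (hW.mem_nhds (hAW y hy))).differentiableAt
      one_ne_zero).hasFDerivAt.comp y (hA.differentiable one_ne_zero y).hasFDerivAt
  have hΨA : ContinuousOn (fun y => Ψ (A y)) (tsupport φ) :=
    hΨ.continuousOn.comp hA.continuous.continuousOn hAW
  have hpt : ∀ y, φ y * fderiv ℝ Ψ (A y) (pd j A y) =
      φ y * fderiv ℝ (fun y => Ψ (A y)) y (EuclideanSpace.single j 1) := by
    intro y
    by_cases hy : y ∈ tsupport φ
    · rw [(hd y hy).fderiv]; rfl
    · rw [image_eq_zero_of_notMem_tsupport hy, zero_mul, zero_mul]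
  simp only [hpt]
  refine integral_mul_fderiv_eq_neg_fderiv_mul_of_integrable ?_ ?_ ?_
    (fun y _ => hφ.differentiable one_ne_zero y) fun y hy => (hd y hy).differentiableAt
  · exact integrable_mul_of_tsupport (continuous_pd hφ j) (hasCompactSupport_pd hφc j)
      (hΨA.mono (tsupport_pd_subset φ j))
  · simp only [← hpt]
    refine integrable_mul_of_tsupport hφ.continuous hφc ?_
    exact ((hΨ.continuousOn_fderiv_of_isOpen hW le_rfl).comp hA.continuous.continuousOn
      hAW).clm_apply ((hA.continuous_fderiv one_ne_zero).clm_apply continuous_const).continuousOn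
  · exact integrable_mul_of_tsupport hφ.continuous hφc hΨA

/-- The chain rule for weak derivatives of continuous functions. -/
theorem integral_pd_mul_comp_of_isWeakPartial [FiniteDimensional ℝ V] {U : Set (E m)}
    (hU : IsOpen U) {j : Fin m} {a b : E m → V} (hab : IsWeakPartial U j a b)
    (ha : ContinuousOn a U) {W : Set V} (hW : IsOpen W) {Ψ : V → ℝ} (hΨ : ContDiffOn ℝ 1 Ψ W)
    (haW : Set.MapsTo a U W) {φ : E m → ℝ} (hφ : ContDiff ℝ 1 φ) (hφc : HasCompactSupport φ)
    (hφU : tsupport φ ⊆ U) :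
    Integrable (fun y => φ y * fderiv ℝ Ψ (a y) (b y)) ∧
      ∫ y, pd j φ y * Ψ (a y) = -∫ y, φ y * fderiv ℝ Ψ (a y) (b y) := by
  have : CompleteSpace V := FiniteDimensional.complete ℝ V
  have : ProperSpace V := FiniteDimensional.proper ℝ V
  set K₀ := tsupport φ with hK₀
  have hK₀c : IsCompact K₀ := hφc
  obtain ⟨δ₀, hδ₀, hthick⟩ := hK₀c.exists_cthickening_subset_open hU hφU
  set K := Metric.cthickening δ₀ K₀ with hK
  have hKc : IsCompact K := hK₀c.cthickening
  have hK₀K : K₀ ⊆ K := Metric.self_subset_cthickening K₀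
  have hKm : MeasurableSet K := hKc.measurableSet
  -- Truncation to a compact neighbourhood of the support makes `a` and `b` globally integrable, so
  -- that they can be mollified; near the support of `φ` nothing changes for small radii.
  set a' := K.indicator a with ha'
  set b' := K.indicator b with hb'
  have hai : Integrable a' :=
    (integrable_indicator_iff hKm).mpr (hab.1.integrableOn_compact_subset hthick hKc)
  have hbi : Integrable b' :=
    (integrable_indicator_iff hKm).mpr (hab.2.1.integrableOn_compact_subset hthick hKc)
  have hΨ' : ContinuousOn (fderiv ℝ Ψ) W := hΨ.continuousOn_fderiv_of_isOpen hW le_rfl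
  have hbb : ∀ y, φ y * fderiv ℝ Ψ (a y) (b y) = φ y * fderiv ℝ Ψ (a y) (b' y) := by
    intro y
    by_cases hy : y ∈ K₀
    · rw [hb', Set.indicator_of_mem (hK₀K hy)]
    · rw [image_eq_zero_of_notMem_tsupport hy, zero_mul, zero_mul]
  simp only [hbb]
  have haK₀ : ContinuousOn a K₀ := ha.mono hφU
  have hint1 : Integrable fun y => φ y * fderiv ℝ Ψ (a y) (b' y) :=
    integrable_mul_clm_of_tsupport hφ.continuous hφc
      (hΨ'.comp haK₀ fun y hy => haW (hφU hy)) hbi.integrableOn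
  refine ⟨hint1, ?_⟩
  have hint2 : Integrable fun y => pd j φ y * Ψ (a y) :=
    integrable_mul_of_tsupport (continuous_pd hφ j) (hasCompactSupport_pd hφc j)
      ((hΨ.continuousOn.comp haK₀ fun y hy => haW (hφU hy)).mono (tsupport_pd_subset φ j))
  have himg : IsCompact (a '' K₀) := hK₀c.image_of_continuousOn haK₀
  obtain ⟨ε₀, hε₀, hthickW⟩ := himg.exists_cthickening_subset_open hW
    (by rintro _ ⟨y, hy, rfl⟩; exact haW (hφU hy))
  -- A compact neighbourhood in `W` of the values of `a` over the support; the mollified values stay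
  -- in it, and `Ψ` and its derivative are uniformly continuous there.
  set L := Metric.cthickening ε₀ (a '' K₀) with hL
  have hLc : IsCompact L := himg.cthickening
  have hΨu := hLc.uniformContinuousOn_of_continuous (hΨ.continuousOn.mono hthickW)
  have hΨ'u := hLc.uniformContinuousOn_of_continuous (hΨ'.mono hthickW)
  obtain ⟨C, hC0, hC⟩ : ∃ C, 0 ≤ C ∧ ∀ t ∈ L, ‖fderiv ℝ Ψ t‖ ≤ C := by
    obtain ⟨C, hC⟩ := hLc.exists_bound_of_continuousOn (hΨ'.mono hthickW)
    exact ⟨max C 0, le_max_right _ _, fun t ht => (hC t ht).trans (le_max_left _ _)⟩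
  obtain ⟨M, hM⟩ := hφ.continuous.bounded_above_of_compact_support hφc
  have hau := hKc.uniformContinuousOn_of_continuous (ha.mono hthick)
  -- The defect `X` of the formula will be bounded by `ε * T` for every `ε > 0`: mollification
  -- converges uniformly for `a`, but only in `L¹` for `b`, which enters linearly.
  set T := (∫ y, |pd j φ y|) + M * ((∫ y, ‖b' y‖) + C) with hT
  set X := (∫ y, pd j φ y * Ψ (a y)) + ∫ y, φ y * fderiv ℝ Ψ (a y) (b' y) with hX
  have hM0 : 0 ≤ M := (norm_nonneg _).trans (hM 0)
  have hpdi : Integrable fun y => |pd j φ y| :=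
    ((continuous_pd hφ j).integrable_of_hasCompactSupport (hasCompactSupport_pd hφc j)).norm
  have hmain : ∀ ε > 0, |X| ≤ ε * T := by
    intro ε hε
    obtain ⟨δ₁, hδ₁, h1⟩ := Metric.uniformContinuousOn_iff.mp hΨu ε hε
    obtain ⟨δ₂, hδ₂, h2⟩ := Metric.uniformContinuousOn_iff.mp hΨ'u ε hε
    set κ := min ε₀ (min δ₁ δ₂) / 2 with hκ
    have hmin : 0 < min ε₀ (min δ₁ δ₂) := lt_min hε₀ (lt_min hδ₁ hδ₂)
    have hκpos : 0 < κ := by rw [hκ]; linarith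
    have hκε₀ : κ < ε₀ := by have := min_le_left ε₀ (min δ₁ δ₂); linarith
    have hκδ₁ : κ < δ₁ := by
      have := (min_le_right ε₀ (min δ₁ δ₂)).trans (min_le_left _ _); linarith
    have hκδ₂ : κ < δ₂ := by
      have := (min_le_right ε₀ (min δ₁ δ₂)).trans (min_le_right _ _); linarith
    obtain ⟨δ₃, hδ₃, h3⟩ := Metric.uniformContinuousOn_iff.mp hau κ hκpos
    obtain ⟨δ₄, hδ₄, h4⟩ := exists_integral_norm_mollify_sub_le hbi hε
    set s := min δ₀ (min δ₃ δ₄) / 2 with hs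
    have hmin' : 0 < min δ₀ (min δ₃ δ₄) := lt_min hδ₀ (lt_min hδ₃ hδ₄)
    have hspos : 0 < s := by rw [hs]; linarith
    have hsδ₀ : s < δ₀ := by have := min_le_left δ₀ (min δ₃ δ₄); linarith
    have hsδ₃ : s < δ₃ := by
      have := (min_le_right δ₀ (min δ₃ δ₄)).trans (min_le_left _ _); linarith
    have hsδ₄ : s < δ₄ := by
      have := (min_le_right δ₀ (min δ₃ δ₄)).trans (min_le_right _ _); linarith
    let ρ : ContDiffBump (0 : E m) := ⟨s / 2, s, by linarith, by linarith⟩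
    have hρs : ρ.rOut = s := rfl
    set A := mollify ρ a' with hA
    set B := mollify ρ b' with hB
    have hA1 : ContDiff ℝ 1 A := contDiff_infty.mp (contDiff_mollify ρ hai.locallyIntegrable) 1
    have hballK : ∀ y ∈ K₀, Metric.closedBall y ρ.rOut ⊆ K := fun y hy =>
      (Metric.closedBall_subset_cthickening hy _).trans (Metric.cthickening_mono hsδ₀.le _)
    have hAa : ∀ y ∈ K₀, dist (A y) (a y) ≤ κ := by
      intro y hy
      have hyy : a' y = a y := Set.indicator_of_mem (hK₀K hy) _
      rw [← hyy]
      refine ContDiffBump.dist_normed_convolution_le hai.aestronglyMeasurable fun z hz => ?_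
      have hzK : z ∈ K := hballK y hy (Metric.ball_subset_closedBall hz)
      rw [hyy, ha', Set.indicator_of_mem hzK]
      exact (h3 z hzK y (hK₀K hy) ((Metric.mem_ball.mp hz).trans hsδ₃)).le
    have haL : ∀ y ∈ K₀, a y ∈ L := fun y hy =>
      Metric.self_subset_cthickening _ ⟨y, hy, rfl⟩
    have hAL : ∀ y ∈ K₀, A y ∈ L := fun y hy =>
      Metric.mem_cthickening_of_dist_le _ _ _ _ ⟨y, hy, rfl⟩ ((hAa y hy).trans hκε₀.le)
    have hAB : ∀ y ∈ K₀, pd j A y = B y := fun y hy =>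
      pd_mollify_of_isWeakPartial hab hKc hthick ρ (hballK y hy)
    have hBi : Integrable B := ρ.integrable_normed.integrable_convolution _ hbi
    have hparts := integral_mul_fderiv_comp_of_contDiff hφ hφc hA1 hW hΨ
      (fun y hy => hthickW (hAL y hy)) j
    have hparts' : ∀ y, φ y * fderiv ℝ Ψ (A y) (pd j A y) = φ y * fderiv ℝ Ψ (A y) (B y) := by
      intro y
      by_cases hy : y ∈ K₀
      · rw [hAB y hy]
      · rw [image_eq_zero_of_notMem_tsupport hy, zero_mul, zero_mul]
    simp only [hparts'] at hparts
    have hint3 : Integrable fun y => φ y * fderiv ℝ Ψ (A y) (B y) :=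
      integrable_mul_clm_of_tsupport hφ.continuous hφc
        (hΨ'.comp hA1.continuous.continuousOn fun y hy => hthickW (hAL y hy)) hBi.integrableOn
    have hint4 : Integrable fun y => pd j φ y * Ψ (A y) :=
      integrable_mul_of_tsupport (continuous_pd hφ j) (hasCompactSupport_pd hφc j)
        ((hΨ.continuousOn.comp hA1.continuous.continuousOn
          fun y hy => hthickW (hAL y hy)).mono (tsupport_pd_subset φ j))
    have hXe : X = ∫ y, ((pd j φ y * Ψ (a y) - pd j φ y * Ψ (A y)) +
        (φ y * fderiv ℝ Ψ (a y) (b' y) - φ y * fderiv ℝ Ψ (A y) (B y))) := by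
      have e1 := integral_sub hint2 hint4
      have e2 := integral_sub hint1 hint3
      have e3 := integral_add (hint2.sub hint4) (hint1.sub hint3)
      simp only [Pi.sub_apply] at e3
      rw [e3, e1, e2, hparts, hX]
      ring
    have hBb : Integrable fun y => ‖B y - b' y‖ := (hBi.sub hbi).norm
    have hbound : ∀ y, ‖(pd j φ y * Ψ (a y) - pd j φ y * Ψ (A y)) +
        (φ y * fderiv ℝ Ψ (a y) (b' y) - φ y * fderiv ℝ Ψ (A y) (B y))‖ ≤
        ε * |pd j φ y| + M * (ε * ‖b' y‖ + C * ‖B y - b' y‖) := by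
      intro y
      by_cases hy : y ∈ K₀
      · have g1 := (h1 _ (haL y hy) _ (hAL y hy) (by
          rw [dist_comm]; exact (hAa y hy).trans_lt hκδ₁)).le
        have g2 := (h2 _ (haL y hy) _ (hAL y hy) (by
          rw [dist_comm]; exact (hAa y hy).trans_lt hκδ₂)).le
        rw [dist_eq_norm] at g1 g2
        have g3 : fderiv ℝ Ψ (a y) (b' y) - fderiv ℝ Ψ (A y) (B y) =
            (fderiv ℝ Ψ (a y) - fderiv ℝ Ψ (A y)) (b' y) -
              fderiv ℝ Ψ (A y) (B y - b' y) := by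
          simp
        have g4 : ‖fderiv ℝ Ψ (a y) (b' y) - fderiv ℝ Ψ (A y) (B y)‖ ≤
            ε * ‖b' y‖ + C * ‖B y - b' y‖ := by
          rw [g3]
          refine (norm_sub_le _ _).trans (add_le_add ?_ ?_)
          · exact ((fderiv ℝ Ψ (a y) - fderiv ℝ Ψ (A y)).le_opNorm _).trans (by gcongr)
          · exact ((fderiv ℝ Ψ (A y)).le_opNorm _).trans (by gcongr; exact hC _ (hAL y hy))
        rw [← mul_sub, ← mul_sub]
        refine (norm_add_le _ _).trans (add_le_add ?_ ?_)
        · rw [norm_mul, mul_comm, Real.norm_eq_abs (pd j φ y)]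
          gcongr
        · rw [norm_mul]
          exact mul_le_mul (hM y) g4 (norm_nonneg _) hM0
      · have z1 : φ y = 0 := image_eq_zero_of_notMem_tsupport hy
        have z2 : pd j φ y = 0 :=
          image_eq_zero_of_notMem_tsupport fun h => hy (tsupport_pd_subset φ j h)
        rw [z1, z2]
        simp only [zero_mul, sub_self, add_zero, norm_zero, abs_zero, mul_zero, zero_add]
        positivity
    have hgi : Integrable fun y => ε * |pd j φ y| + M * (ε * ‖b' y‖ + C * ‖B y - b' y‖) :=
      (hpdi.const_mul ε).add (((hbi.norm.const_mul ε).add (hBb.const_mul C)).const_mul M)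
    rw [hXe, ← Real.norm_eq_abs]
    refine (norm_integral_le_of_norm_le hgi (Filter.Eventually.of_forall hbound)).trans ?_
    have e4 := integral_add (hpdi.const_mul ε)
      (((hbi.norm.const_mul ε).add (hBb.const_mul C)).const_mul M)
    have e5 := integral_add (hbi.norm.const_mul ε) (hBb.const_mul C)
    simp only [Pi.add_apply, integral_const_mul] at e4 e5
    rw [e4, e5, hT]
    have h5 : ∫ y, ‖B y - b' y‖ ≤ ε := h4 ρ (by rw [hρs]; exact hsδ₄)
    have h6 := mul_le_mul_of_nonneg_left (mul_le_mul_of_nonneg_left h5 hC0) hM0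
    nlinarith
  have hX0 : X = 0 := by
    by_contra hne
    have hXpos : 0 < |X| := abs_pos.mpr hne
    have h1 := hmain (|X| / (2 * (|T| + 1))) (by positivity)
    have h2 : |X| / (2 * (|T| + 1)) * T ≤ |X| / 2 := by
      rw [div_mul_eq_mul_div, div_le_div_iff₀ (by positivity) (by norm_num)]
      nlinarith [le_abs_self T, abs_nonneg T]
    linarith
  linarith

end WeakChain

/-! ### Derivatives of determinants and inverses of Gram matrices -/

theorem contDiff_det_of {m : ℕ} : ContDiff ℝ ω fun A : Fin m → Fin m → ℝ => (Matrix.of A).det := by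
  simp only [Matrix.det_apply, Matrix.of_apply]
  fun_prop

/-- Jacobi's formula, read off from `det (A + εH) = det A · det (1 + ε A⁻¹H)` and the first order
expansion of the last factor. -/
theorem fderiv_det_of {m : ℕ} {A : Fin m → Fin m → ℝ} (hA : IsUnit (Matrix.of A).det)
    (H : Fin m → Fin m → ℝ) :
    fderiv ℝ (fun A : Fin m → Fin m → ℝ => (Matrix.of A).det) A H =
      (Matrix.of A).det * ((Matrix.of A)⁻¹ * Matrix.of H).trace := by
  have hline : HasDerivAt (fun ε : ℝ => A + ε • H) H 0 := by
    simpa using ((hasDerivAt_id (0 : ℝ)).smul_const H).const_add A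
  have hd : HasFDerivAt (fun A : Fin m → Fin m → ℝ => (Matrix.of A).det)
      (fderiv ℝ (fun A : Fin m → Fin m → ℝ => (Matrix.of A).det) A) (A + (0 : ℝ) • H) := by
    rw [zero_smul, add_zero]
    exact (contDiff_det_of.differentiable (by simp) A).hasFDerivAt
  have h1 := hd.comp_hasDerivAt (0 : ℝ) hline
  set M := (Matrix.of A)⁻¹ * Matrix.of H with hM
  have h2 : ((fun A : Fin m → Fin m → ℝ => (Matrix.of A).det) ∘ fun ε : ℝ => A + ε • H) =
      fun ε => (Matrix.of A).det * (1 + ε • M).det := by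
    ext ε
    have : Matrix.of (A + ε • H) = Matrix.of A * (1 + ε • M) := by
      rw [mul_add, mul_one, Matrix.mul_smul, hM, ← Matrix.mul_assoc, Matrix.mul_nonsing_inv _ hA,
        Matrix.one_mul]
      rfl
    simp only [Function.comp_apply]
    rw [this, Matrix.det_mul]
  obtain ⟨P, hP⟩ : ∃ P : Polynomial ℝ, ∀ ε : ℝ, (1 + ε • M).det = 1 + M.trace * ε +
      P.eval ε * ε ^ 2 := ⟨_, fun ε => Matrix.det_one_add_smul ε M⟩
  rw [h2] at h1
  have h3 : HasDerivAt (fun ε : ℝ => (Matrix.of A).det * (1 + ε • M).det)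
      ((Matrix.of A).det * M.trace) 0 := by
    simp only [hP]
    have e1 : HasDerivAt (fun ε : ℝ => 1 + M.trace * ε) (M.trace) 0 := by
      simpa using ((hasDerivAt_id (0 : ℝ)).const_mul M.trace).const_add 1
    have e2 := (P.hasDerivAt 0).mul (hasDerivAt_pow (𝕜 := ℝ) 2 0)
    simpa using (e1.add e2).const_mul (Matrix.of A).det
  exact h1.unique h3

section GramCalculus

variable {m n : ℕ}

/-- The density `√det g` as a function of the frame. -/
def frameDensity (t : Fin m → E n) : ℝ := Real.sqrt (gram t).det

/-- The coefficient `√det g gⁱʲ ⟨w, tᵢ⟩` of the surface divergence. -/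
def frameFlux (w : E n) (j : Fin m) (t : Fin m → E n) : ℝ :=
  frameDensity t * ∑ i, (gram t)⁻¹ i j * inner ℝ w (t i)

theorem contDiff_gram : ContDiff ℝ ω fun (t : Fin m → E n) (i j : Fin m) => gram t i j := by
  refine contDiff_pi.mpr fun i => contDiff_pi.mpr fun j => ?_
  exact (contDiff_apply ℝ (E n) i).inner ℝ (contDiff_apply ℝ (E n) j)

theorem contDiff_det_gram : ContDiff ℝ ω fun t : Fin m → E n => (gram t).det :=
  contDiff_det_of.comp contDiff_gram

theorem contDiff_adjugate_gram (i j : Fin m) :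
    ContDiff ℝ ω fun t : Fin m → E n => (gram t).adjugate i j := by
  simp only [Matrix.adjugate_apply]
  refine contDiff_det_of.comp (g := fun A : Fin m → Fin m → ℝ => (Matrix.of A).det)
    (f := fun t : Fin m → E n => (gram t).updateRow j (Pi.single i 1)) ?_
  refine contDiff_pi.mpr fun a => contDiff_pi.mpr fun b => ?_
  have h := contDiff_pi.mp (contDiff_pi.mp (contDiff_gram (m := m) (n := n)) a) b
  by_cases haj : a = j
  · subst haj
    simpa using contDiff_const
  · simpa [Matrix.updateRow_ne haj] using h

theorem isOpen_frames : IsOpen {t : Fin m → E n | 0 < (gram t).det} :=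
  isOpen_lt continuous_const contDiff_det_gram.continuous

theorem contDiffOn_gram_inv (i j : Fin m) :
    ContDiffOn ℝ ω (fun t : Fin m → E n => (gram t)⁻¹ i j) {t | 0 < (gram t).det} := by
  have h : ∀ t : Fin m → E n, (gram t)⁻¹ i j = ((gram t).det)⁻¹ * (gram t).adjugate i j := by
    intro t
    rw [Matrix.inv_def]; simp
  simp only [h]
  exact (contDiff_det_gram.contDiffOn.inv fun t ht => ne_of_gt ht).mul
    (contDiff_adjugate_gram i j).contDiffOn

theorem contDiffOn_frameDensity :
    ContDiffOn ℝ ω (frameDensity : (Fin m → E n) → ℝ) {t | 0 < (gram t).det} :=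
  contDiff_det_gram.contDiffOn.sqrt fun _ ht => ne_of_gt ht

theorem contDiffOn_frameFlux (w : E n) (j : Fin m) :
    ContDiffOn ℝ ω (frameFlux w j : (Fin m → E n) → ℝ) {t | 0 < (gram t).det} := by
  refine contDiffOn_frameDensity.mul (ContDiffOn.sum fun i _ => (contDiffOn_gram_inv i j).mul ?_)
  exact (contDiff_const.inner ℝ (contDiff_apply ℝ (E n) i)).contDiffOn

/-- The derivative of the Gram matrix at `t` in the direction `s`. -/
def gramDeriv (t s : Fin m → E n) : Matrix (Fin m) (Fin m) ℝ :=
  Matrix.of fun i j => inner ℝ (s i) (t j) + inner ℝ (t i) (s j)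

/-- The product rule with `(√det g)˙ = ½ √det g · tr(g⁻¹ġ)`, `(g⁻¹)˙ = -g⁻¹ ġ g⁻¹` and `⟨w, tᵢ⟩˙ =
⟨w, sᵢ⟩`. -/
theorem fderiv_frameFlux {t : Fin m → E n} (ht : 0 < (gram t).det) (w : E n) (j : Fin m)
    (s : Fin m → E n) :
    fderiv ℝ (frameFlux w j) t s = frameDensity t *
      (1 / 2 * ((gram t)⁻¹ * gramDeriv t s).trace * ∑ i, (gram t)⁻¹ i j * inner ℝ w (t i)
        - ∑ i, ((gram t)⁻¹ * gramDeriv t s * (gram t)⁻¹) i j * inner ℝ w (t i)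
        + ∑ i, (gram t)⁻¹ i j * inner ℝ w (s i)) := by
  have hopen := (isOpen_frames (m := m) (n := n)).mem_nhds ht
  have hu : IsUnit (gram t).det := (ne_of_gt ht).isUnit
  let c : ℝ → Fin m → E n := fun ε => t + ε • s
  have hc : HasDerivAt c s 0 := by
    have := ((hasDerivAt_id (0 : ℝ)).smul_const s).const_add t
    rwa [one_smul] at this
  have hc0 : c 0 = t := by simp [c]
  have hci : ∀ i, HasDerivAt (fun ε => c ε i) (s i) 0 := fun i => hasDerivAt_pi.mp hc i
  have hG : ∀ i k, HasDerivAt (fun ε => gram (c ε) i k) (gramDeriv t s i k) 0 := fun i k => by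
    have := (hci i).inner ℝ (hci k)
    rw [hc0] at this
    simpa [gramDeriv, gram, add_comm] using this
  have hGpi : HasDerivAt (fun ε i k => gram (c ε) i k) (fun i k => gramDeriv t s i k) 0 :=
    hasDerivAt_pi.mpr fun i => hasDerivAt_pi.mpr fun k => hG i k
  have hdet : HasDerivAt (fun ε => (gram (c ε)).det)
      ((gram t).det * ((gram t)⁻¹ * gramDeriv t s).trace) 0 := by
    have h1 : HasFDerivAt (fun A : Fin m → Fin m → ℝ => (Matrix.of A).det)
        (fderiv ℝ (fun A : Fin m → Fin m → ℝ => (Matrix.of A).det) fun i k => gram t i k)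
        (fun i k => gram (c 0) i k) := by
      rw [hc0]
      exact (contDiff_det_of.differentiable (by simp) _).hasFDerivAt
    have h2 := h1.comp_hasDerivAt (0 : ℝ) hGpi
    rw [fderiv_det_of (show IsUnit (Matrix.of fun i k => gram t i k).det from hu)] at h2
    exact h2
  have hsqrt : HasDerivAt (fun ε => frameDensity (c ε))
      (frameDensity t * (1 / 2 * ((gram t)⁻¹ * gramDeriv t s).trace)) 0 := by
    have h1 := hdet.sqrt (by rw [hc0]; exact ne_of_gt ht)
    rw [hc0] at h1
    refine HasDerivAt.congr_deriv h1 ?_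
    have h2 : Real.sqrt (gram t).det * Real.sqrt (gram t).det = (gram t).det :=
      Real.mul_self_sqrt ht.le
    have h3 : Real.sqrt (gram t).det ≠ 0 := (Real.sqrt_pos.mpr ht).ne'
    simp only [frameDensity]
    field_simp
    rw [sq, h2]
    ring
  have hIdiff : ∀ i k, DifferentiableAt ℝ (fun ε => (gram (c ε))⁻¹ i k) 0 := fun i k => by
    have h1 : DifferentiableAt ℝ (fun t : Fin m → E n => (gram t)⁻¹ i k) (c 0) := by
      rw [hc0]
      exact ((contDiffOn_gram_inv i k).contDiffAt hopen).differentiableAt (by simp)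
    exact h1.comp (0 : ℝ) hc.differentiableAt
  -- The derivative of the inverse exists by smoothness; its value is found by differentiating `g⁻¹
  -- g = 1`, valid near `0` where the determinant stays positive.
  let I' : Matrix (Fin m) (Fin m) ℝ := Matrix.of fun i k => deriv (fun ε => (gram (c ε))⁻¹ i k) 0
  have hI : ∀ i k, HasDerivAt (fun ε => (gram (c ε))⁻¹ i k) (I' i k) 0 := fun i k =>
    (hIdiff i k).hasDerivAt
  have hev : ∀ᶠ ε in 𝓝 (0 : ℝ), 0 < (gram (c ε)).det := by
    refine hdet.continuousAt.eventually_const_lt ?_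
    simpa only [hc0] using ht
  have hI'G : I' * gram t + (gram t)⁻¹ * gramDeriv t s = 0 := by
    ext i k
    have h1 : HasDerivAt (fun ε => ((gram (c ε))⁻¹ * gram (c ε)) i k)
        (∑ l, (I' i l * gram (c 0) l k + (gram (c 0))⁻¹ i l * gramDeriv t s l k)) 0 := by
      simp only [Matrix.mul_apply]
      exact HasDerivAt.fun_sum fun l _ => (hI i l).mul (hG l k)
    have h2 : (fun ε => ((gram (c ε))⁻¹ * gram (c ε)) i k) =ᶠ[𝓝 0]
        fun _ => (1 : Matrix (Fin m) (Fin m) ℝ) i k := by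
      filter_upwards [hev] with ε hε
      rw [Matrix.nonsing_inv_mul _ (ne_of_gt hε).isUnit]
    have h3 := h1.unique ((hasDerivAt_const (0 : ℝ) _).congr_of_eventuallyEq h2)
    rw [hc0, Finset.sum_add_distrib] at h3
    simpa [Matrix.mul_apply] using h3
  have hI' : I' = -((gram t)⁻¹ * gramDeriv t s * (gram t)⁻¹) := by
    have h1 := congrArg (· * (gram t)⁻¹) hI'G
    simp only [add_mul, Matrix.zero_mul] at h1
    rw [Matrix.mul_assoc I', Matrix.mul_nonsing_inv _ hu, Matrix.mul_one] at h1
    exact eq_neg_of_add_eq_zero_left h1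
  have hlhs : HasDerivAt (fun ε => frameFlux w j (c ε)) (fderiv ℝ (frameFlux w j) t s) 0 := by
    have h1 : HasFDerivAt (frameFlux w j) (fderiv ℝ (frameFlux w j) t) (c 0) := by
      rw [hc0]
      exact (((contDiffOn_frameFlux w j).contDiffAt hopen).differentiableAt (by simp)).hasFDerivAt
    exact h1.comp_hasDerivAt (0 : ℝ) hc
  have hw : ∀ i, HasDerivAt (fun ε => (inner ℝ w (c ε i) : ℝ)) (inner ℝ w (s i)) 0 := fun i => by
    simpa using (hasDerivAt_const (0 : ℝ) w).inner ℝ (hci i)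
  have hrhs := hsqrt.mul (HasDerivAt.fun_sum fun i (_ : i ∈ Finset.univ) => (hI i j).mul (hw i))
  have huniq := hlhs.unique hrhs
  rw [huniq, hc0, hI', Finset.sum_add_distrib]
  simp only [Pi.mul_apply, hc0, Matrix.neg_apply, neg_mul, Finset.sum_neg_distrib]
  ring

/-- The surface divergence of the tangential frame is normal. -/
theorem sum_fderiv_frameFlux {t : Fin m → E n} (ht : 0 < (gram t).det) (w : E n)
    {S : Fin m → Fin m → E n} (hS : ∀ i j, S i j = S j i) :
    ∑ j, fderiv ℝ (frameFlux w j) t (fun i => S i j) = frameDensity t *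
      (inner ℝ w (∑ i, ∑ j, (gram t)⁻¹ i j • S i j) -
        ∑ i, ∑ k, (gram t)⁻¹ i k * inner ℝ w (t i) *
          inner ℝ (t k) (∑ i, ∑ j, (gram t)⁻¹ i j • S i j)) := by
  simp only [fderiv_frameFlux ht, ← Finset.mul_sum]
  congr 1
  set I := (gram t)⁻¹ with hIdef
  have hI : ∀ i k, I i k = I k i := gram_inv_symm t
  rw [Finset.sum_add_distrib, Finset.sum_sub_distrib]
  have e1 : ∑ j, (1 / 2 * (I * gramDeriv t fun i => S i j).trace * ∑ i, I i j * inner ℝ w (t i)) =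
      ∑ j, ∑ i, ∑ k, ∑ l, I k l * I i j * inner ℝ w (t i) * inner ℝ (S k j) (t l) := by
    refine Finset.sum_congr rfl fun j _ => ?_
    have h1 : (I * gramDeriv t fun i => S i j).trace =
        2 * ∑ k, ∑ l, I k l * inner ℝ (S k j) (t l) := by
      simp only [Matrix.trace, Matrix.diag, Matrix.mul_apply, gramDeriv, Matrix.of_apply, mul_add,
        Finset.sum_add_distrib]
      rw [two_mul]
      congr 1
      · rw [Finset.sum_comm]
        refine Finset.sum_congr rfl fun k _ => Finset.sum_congr rfl fun l _ => ?_
        rw [hI]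
      · refine Finset.sum_congr rfl fun k _ => Finset.sum_congr rfl fun l _ => ?_
        rw [real_inner_comm]
    rw [h1]
    simp only [Finset.mul_sum, Finset.sum_mul]
    refine Finset.sum_congr rfl fun i _ => Finset.sum_congr rfl fun k _ =>
      Finset.sum_congr rfl fun l _ => ?_
    ring
  -- The two halves of `ġ` part ways: by the symmetry of `S`, one cancels the derivative of the
  -- density (`e1`), and the other is the tangential projection (`e3`).
  have e2 : ∑ j, ∑ i, (I * (gramDeriv t fun i => S i j) * I) i j * inner ℝ w (t i) =
      (∑ j, ∑ i, ∑ k, ∑ l, I k l * I i j * inner ℝ w (t i) * inner ℝ (S k j) (t l)) +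
      ∑ j, ∑ i, ∑ k, ∑ l, I i k * I l j * inner ℝ w (t i) * inner ℝ (t k) (S l j) := by
    have h1 : ∑ j, ∑ i, ∑ k, ∑ l, I k l * I i j * inner ℝ w (t i) * inner ℝ (S k j) (t l) =
        ∑ j, ∑ i, ∑ k, ∑ l, I i k * I l j * inner ℝ w (t i) * inner ℝ (S k j) (t l) := by
      have h2 : ∀ g : Fin m → Fin m → Fin m → ℝ, ∑ j, ∑ i, ∑ k, g j i k = ∑ j, ∑ i, ∑ k, g k i j := by
        intro g
        rw [Finset.sum_comm]
        conv_rhs => rw [Finset.sum_comm]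
        exact Finset.sum_congr rfl fun i _ => Finset.sum_comm
      rw [h2]
      refine Finset.sum_congr rfl fun j _ => Finset.sum_congr rfl fun i _ =>
        Finset.sum_congr rfl fun k _ => Finset.sum_congr rfl fun l _ => ?_
      rw [hS j k, hI j l]; ring
    rw [h1, ← Finset.sum_add_distrib]
    refine Finset.sum_congr rfl fun j _ => ?_
    rw [← Finset.sum_add_distrib]
    refine Finset.sum_congr rfl fun i _ => ?_
    simp only [Matrix.mul_apply, Finset.sum_mul, gramDeriv, Matrix.of_apply]
    rw [Finset.sum_comm, ← Finset.sum_add_distrib]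
    refine Finset.sum_congr rfl fun k _ => ?_
    rw [← Finset.sum_add_distrib]
    refine Finset.sum_congr rfl fun l _ => ?_
    ring
  have e3 : ∑ i, ∑ k, I i k * inner ℝ w (t i) * inner ℝ (t k) (∑ i, ∑ j, I i j • S i j) =
      ∑ j, ∑ i, ∑ k, ∑ l, I i k * I l j * inner ℝ w (t i) * inner ℝ (t k) (S l j) := by
    simp only [inner_sum, inner_smul_right, Finset.mul_sum]
    conv_rhs => rw [Finset.sum_comm]
    refine Finset.sum_congr rfl fun i _ => ?_
    conv_rhs => rw [Finset.sum_comm]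
    refine Finset.sum_congr rfl fun k _ => ?_
    rw [Finset.sum_comm]
    refine Finset.sum_congr rfl fun j _ => Finset.sum_congr rfl fun l _ => ?_
    ring
  have e4 : ∑ j, ∑ i, I i j * inner ℝ w (S i j) = inner ℝ w (∑ i, ∑ j, I i j • S i j) := by
    simp only [inner_sum, inner_smul_right]
    exact Finset.sum_comm
  rw [e1, e2, e3, e4]
  ring

end GramCalculus

/-! ### The weak first variation formula -/

theorem integrable_smul_of_tsupport {m : ℕ} {V : Type*} [NormedAddCommGroup V] [NormedSpace ℝ V]
    {φ : E m → ℝ} {b : E m → V} {U : Set (E m)} (hφ : Continuous φ) (hφc : HasCompactSupport φ)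
    (hφU : tsupport φ ⊆ U) (hb : LocallyIntegrableOn b U) : Integrable fun y => φ y • b y := by
  have h1 : IntegrableOn (fun y => φ y • b y) (tsupport φ) :=
    (hb.integrableOn_compact_subset hφU hφc).continuousOn_smul hφ.continuousOn hφc
  refine (integrableOn_iff_integrable_of_support_subset fun y hy => ?_).mp h1
  exact subset_tsupport φ (left_ne_zero_of_smul hy)

theorem locallyIntegrableOn_pi {m k : ℕ} {V : Type*} [NormedAddCommGroup V]
    {U : Set (E m)} (hU : IsOpen U) {a : Fin k → E m → V} (ha : ∀ i, LocallyIntegrableOn (a i) U) :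
    LocallyIntegrableOn (fun y i => a i y) U := by
  rw [locallyIntegrableOn_iff hU.isLocallyClosed]
  exact fun K hKU hK => Integrable.of_eval fun i => (ha i).integrableOn_compact_subset hKU hK

/-- Lets the chain rule be applied to the whole frame as one map, since density and flux depend on
all its vectors jointly. -/
theorem isWeakPartial_pi {m k : ℕ} {V : Type*} [NormedAddCommGroup V] [NormedSpace ℝ V]
    [CompleteSpace V] {U : Set (E m)} (hU : IsOpen U) {j : Fin m} {a b : Fin k → E m → V}
    (h : ∀ i, IsWeakPartial U j (a i) (b i)) :
    IsWeakPartial U j (fun y i => a i y) (fun y i => b i y) := by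
  refine ⟨locallyIntegrableOn_pi hU fun i => (h i).1, locallyIntegrableOn_pi hU fun i => (h i).2.1,
    fun φ hφ hφc hφU => ?_⟩
  have hφ1 : ContDiff ℝ 1 φ := contDiff_infty.mp hφ 1
  ext1 i
  rw [eval_integral, Pi.neg_apply, eval_integral]
  · exact (h i).2.2 φ hφ hφc hφU
  · exact fun i => (integrable_smul_of_tsupport hφ.continuous hφc hφU (h i).2.1).integrableOn
  · exact fun i => (integrable_smul_of_tsupport (continuous_pd hφ1 j) (hasCompactSupport_pd hφc j)
      ((tsupport_pd_subset φ j).trans hφU) (h i).1).integrableOn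

theorem continuousOn_pd {m n : ℕ} {f : E m → E n} {U : Set (E m)} (hU : IsOpen U)
    (hf : ContDiffOn ℝ 1 f U) (i : Fin m) : ContinuousOn (pd i f) U :=
  (hf.continuousOn_fderiv_of_isOpen hU le_rfl).clm_apply continuousOn_const

theorem pd_comm {m : ℕ} {φ : E m → ℝ} (hφ : ContDiff ℝ 2 φ) (i j : Fin m) :
    pd i (pd j φ) = pd j (pd i φ) := by
  ext1 y
  rw [pd_pd_eq_hess hφ.contDiffAt, pd_pd_eq_hess hφ.contDiffAt, hess_symm hφ.contDiffAt]

section Immersion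

variable {m n : ℕ} {U : Set (E m)} {f : E m → E n} {F : Fin m → Fin m → E m → E n}

/-- Weak second derivatives are symmetric. -/
theorem weak_hessian_symm (hU : IsOpen U) (hf : ContDiffOn ℝ 1 f U)
    (hF : ∀ i j, IsWeakPartial U j (pd i f) (F i j)) :
    ∀ᵐ y, y ∈ U → ∀ i j, F i j y = F j i y := by
  have key : ∀ i j, ∀ᵐ y, y ∈ U → F i j y - F j i y = 0 := by
    intro i j
    refine hU.ae_eq_zero_of_integral_contDiff_smul_eq_zero
      ((hF i j).2.1.sub (hF j i).2.1) fun φ hφ hφc hφU => ?_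
    have hφ1 : ContDiff ℝ 1 φ := contDiff_infty.mp hφ 1
    have hφ2 : ContDiff ℝ 2 φ := contDiff_infty.mp hφ 2
    have hfloc : LocallyIntegrableOn f U :=
      hf.continuousOn.locallyIntegrableOn hU.measurableSet
    have hpd1 : ∀ j, ContDiff ℝ 1 (pd j φ) := fun j =>
      (hφ2.fderiv_right (m := 1) (by norm_num)).clm_apply contDiff_const
    -- Both derivatives are moved to `φ`, where they commute.
    have hw : ∀ i j, ∫ y, φ y • F i j y = ∫ y, pd i (pd j φ) y • f y := by
      intro i j
      have h1 := (hF i j).2.2 φ hφ hφc hφU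
      rw [setIntegral_eq_integral_of_forall_compl_eq_zero fun y hy => by
          rw [image_eq_zero_of_notMem_tsupport fun h => hy (hφU (tsupport_pd_subset φ j h)),
            zero_smul],
        setIntegral_eq_integral_of_forall_compl_eq_zero fun y hy => by
          rw [image_eq_zero_of_notMem_tsupport fun h => hy (hφU h), zero_smul]] at h1
      have hsub : tsupport (pd j φ) ⊆ U := (tsupport_pd_subset φ j).trans hφU
      have h2 := integral_smul_fderiv_eq_neg_fderiv_smul_of_integrable (μ := volume)
        (f := pd j φ) (g := f) (v := EuclideanSpace.single i (1 : ℝ))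
        (integrable_smul_of_tsupport (continuous_pd (hpd1 j) i)
          (hasCompactSupport_pd (hasCompactSupport_pd hφc j) i)
          ((tsupport_pd_subset _ i).trans hsub) hfloc)
        (integrable_smul_of_tsupport (hpd1 j).continuous (hasCompactSupport_pd hφc j) hsub
          (hF i j).1)
        (integrable_smul_of_tsupport (hpd1 j).continuous (hasCompactSupport_pd hφc j) hsub hfloc)
        (fun y _ => (hpd1 j).differentiable one_ne_zero y)
        (fun y hy => (hf.contDiffAt (hU.mem_nhds (hsub hy))).differentiableAt one_ne_zero)
      have h3 : ∫ y, pd j φ y • pd i f y = -∫ y, pd i (pd j φ) y • f y := h2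
      rw [h3] at h1
      exact (neg_injective h1).symm
    simp only [smul_sub]
    rw [integral_sub (integrable_smul_of_tsupport hφ.continuous hφc hφU (hF i j).2.1)
      (integrable_smul_of_tsupport hφ.continuous hφc hφU (hF j i).2.1), hw, hw, pd_comm hφ2,
      sub_self]
  have h2 := ae_all_iff.mpr fun i => ae_all_iff.mpr fun j => key i j
  filter_upwards [h2] with y hy hyU i j
  exact sub_eq_zero.mp (hy i j hyU)

/-- The frame `(∂₁ f, …, ∂ₘ f)`. -/
def frame (f : E m → E n) (y : E m) : Fin m → E n := fun i => pd i f y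

/-- The trace `gⁱʲ Fᵢⱼ`. -/
def frameTrace (f : E m → E n) (F : Fin m → Fin m → E m → E n) (y : E m) : E n :=
  ∑ i, ∑ j, (gram (frame f y))⁻¹ i j • F i j y

theorem continuousOn_frame (hU : IsOpen U) (hf : ContDiffOn ℝ 1 f U) :
    ContinuousOn (frame f) U :=
  continuousOn_pi.mpr fun i => continuousOn_pd hU hf i

/-- Subtracting from `v` its orthogonal projection to the span of the frame leaves its `ν`
component; this is the hyperplane trace formula for the form `w ⊗ v`. -/
theorem inner_sub_tangential (hmn : m + 1 = n) {t : Fin m → E n} {ν : E n}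
    (ht : 0 < (gram t).det) (hν : ‖ν‖ = 1) (hort : ∀ i, inner ℝ ν (t i) = (0 : ℝ)) (v w : E n) :
    inner ℝ w v - ∑ i, ∑ k, (gram t)⁻¹ i k * inner ℝ w (t i) * inner ℝ (t k) v =
      inner ℝ w ν * inner ℝ ν v := by
  have h := sum_gram_inv_bilin hmn t ν (ne_of_gt ht).isUnit hν hort
    ((ContinuousLinearMap.lsmul ℝ ℝ).bilinearComp (innerSL ℝ w) (innerSL ℝ v))
  simp only [ContinuousLinearMap.bilinearComp_apply, ContinuousLinearMap.lsmul_apply,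
    innerSL_apply_apply, smul_eq_mul] at h
  have h2 : (inner ℝ w v : ℝ) = ∑ a : Fin n, inner ℝ w (EuclideanSpace.single a (1 : ℝ)) *
      inner ℝ v (EuclideanSpace.single a (1 : ℝ)) := by
    simp [PiLp.inner_apply, mul_comm]
  have h3 : ∑ i, ∑ k, (gram t)⁻¹ i k * inner ℝ w (t i) * inner ℝ (t k) v =
      ∑ i, ∑ j, (gram t)⁻¹ i j * (inner ℝ w (t i) * inner ℝ v (t j)) := by
    refine Finset.sum_congr rfl fun i _ => Finset.sum_congr rfl fun j _ => ?_
    rw [real_inner_comm v, mul_assoc]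
  rw [h3, h, ← h2, real_inner_comm ν v]
  ring

/-- The weak form of `∂ⱼ(√g gⁱʲ ∂ᵢf) = √g ⟨ν, gⁱʲFᵢⱼ⟩ ν`, tested against a constant vector `w`. The
chain rule turns the left side into the derivative of the flux along the weak second derivatives,
whose tangential part cancels. -/
theorem weak_first_variation (hmn : m + 1 = n) (hU : IsOpen U) (hf : ContDiffOn ℝ 1 f U)
    (hF : ∀ i j, IsWeakPartial U j (pd i f) (F i j))
    (hg : ∀ y ∈ U, 0 < (gram (frame f y)).det) {ν : E m → E n} (hν : ∀ y ∈ U, ‖ν y‖ = 1)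
    (hort : ∀ y ∈ U, ∀ i, inner ℝ (ν y) (pd i f y) = (0 : ℝ)) (w : E n) {φ : E m → ℝ}
    (hφ : ContDiff ℝ 1 φ) (hφc : HasCompactSupport φ) (hφU : tsupport φ ⊆ U) :
    Integrable (fun y => φ y * (frameDensity (frame f y) *
      (inner ℝ w (ν y) * inner ℝ (ν y) (frameTrace f F y)))) ∧
    ∫ y, ∑ j, pd j φ y * frameFlux w j (frame f y) =
      -∫ y, φ y * (frameDensity (frame f y) *
        (inner ℝ w (ν y) * inner ℝ (ν y) (frameTrace f F y))) := by
  have hchain := fun j => integral_pd_mul_comp_of_isWeakPartial hU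
    (isWeakPartial_pi hU fun i => hF i j) (continuousOn_frame hU hf) isOpen_frames
    ((contDiffOn_frameFlux w j).of_le (by simp)) (fun y hy => hg y hy) hφ hφc hφU
  have hae : (fun y => ∑ j, φ y * fderiv ℝ (frameFlux w j) (fun i => pd i f y) fun i => F i j y)
      =ᵐ[volume] fun y => φ y * (frameDensity (frame f y) *
        (inner ℝ w (ν y) * inner ℝ (ν y) (frameTrace f F y))) := by
    filter_upwards [weak_hessian_symm hU hf hF] with y hy
    by_cases hyU : y ∈ U
    · rw [← Finset.mul_sum]
      congr 1
      have h1 := sum_fderiv_frameFlux (hg y hyU) w (S := fun i j => F i j y) (hy hyU)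
      have h2 := inner_sub_tangential hmn (hg y hyU) (hν y hyU) (hort y hyU) (frameTrace f F y) w
      rw [← h2]
      exact h1
    · have : φ y = 0 := image_eq_zero_of_notMem_tsupport fun h => hyU (hφU h)
      simp [this]
  have hcont : ∀ j, ContinuousOn (fun y => frameFlux w j (frame f y)) U := fun j =>
    (contDiffOn_frameFlux w j).continuousOn.comp (continuousOn_frame hU hf) fun y hy => hg y hy
  refine ⟨(integrable_finsetSum _ fun j _ => (hchain j).1).congr hae, ?_⟩
  rw [← integral_congr_ae hae, integral_finsetSum _ fun j _ => (hchain j).1,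
    integral_finsetSum _ fun j _ => integrable_mul_of_tsupport (continuous_pd hφ j)
      (hasCompactSupport_pd hφc j) ((hcont j).mono ((tsupport_pd_subset φ j).trans hφU)),
    ← Finset.sum_neg_distrib]
  exact Finset.sum_congr rfl fun j _ => (hchain j).2

end Immersion

/-! ### The weak form of the Laplacian of a composition -/

theorem integrable_clm_apply_of_eqOn_zero {m : ℕ} {V : Type*} [NormedAddCommGroup V]
    [NormedSpace ℝ V] {K : Set (E m)} (hK : IsCompact K) {G : E m → V →L[ℝ] ℝ} {X : E m → V}
    (hG : ContinuousOn G K) (hX : Integrable X) (h0 : ∀ y ∉ K, X y = 0) :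
    Integrable fun y => G y (X y) := by
  obtain ⟨C, hC⟩ := hK.exists_bound_of_continuousOn hG
  have hmeas : MeasurableSet K := hK.measurableSet
  have h1 : IntegrableOn (fun y => G y (X y)) K := by
    refine Integrable.mono' (hX.norm.integrableOn.const_mul C) ?_ ?_
    · exact (ContinuousLinearMap.id ℝ (V →L[ℝ] ℝ)).aestronglyMeasurable_comp₂
        (hG.aestronglyMeasurable hmeas) hX.aestronglyMeasurable.restrict
    · refine (ae_restrict_iff' hmeas).mpr (Filter.Eventually.of_forall fun y hy => ?_)
      exact ((G y).le_opNorm _).trans (mul_le_mul_of_nonneg_right (hC y hy) (norm_nonneg _))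
  refine (integrableOn_iff_integrable_of_support_subset fun y hy => ?_).mp h1
  by_contra h
  exact hy (by simp [h0 y h])

section Immersion

variable {m n : ℕ} {U : Set (E m)} {f : E m → E n} {F : Fin m → Fin m → E m → E n}
  {ν : E m → E n} {φ : E m → ℝ}

/-- The vector field `√g (φ ⟨gⁱʲ Fᵢⱼ, ν⟩ ν + ∇φ)`, whose pairing with `dv` is the weak form of
`-φ √g` times the trace of the Hessian of `v` over the tangent space. -/
def testField (f : E m → E n) (F : Fin m → Fin m → E m → E n) (ν : E m → E n) (φ : E m → ℝ)
    (y : E m) : E n :=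
  (φ y * (frameDensity (frame f y) * inner ℝ (ν y) (frameTrace f F y))) • ν y +
    ∑ i, ∑ j, (pd j φ y * (frameDensity (frame f y) * (gram (frame f y))⁻¹ i j)) • pd i f y

theorem testField_eq_zero {y : E m} (hy : y ∉ tsupport φ) : testField f F ν φ y = 0 := by
  have h1 : φ y = 0 := image_eq_zero_of_notMem_tsupport hy
  have h2 : ∀ j, pd j φ y = 0 := fun j =>
    image_eq_zero_of_notMem_tsupport fun h => hy (tsupport_pd_subset φ j h)
  simp [testField, h1, h2]

theorem continuousOn_frameDensity_frame (hU : IsOpen U) (hf : ContDiffOn ℝ 1 f U)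
    (hg : ∀ y ∈ U, 0 < (gram (frame f y)).det) :
    ContinuousOn (fun y => frameDensity (frame f y)) U :=
  contDiffOn_frameDensity.continuousOn.comp (continuousOn_frame hU hf) hg

theorem continuousOn_gram_inv_frame (hU : IsOpen U) (hf : ContDiffOn ℝ 1 f U)
    (hg : ∀ y ∈ U, 0 < (gram (frame f y)).det) (i j : Fin m) :
    ContinuousOn (fun y => (gram (frame f y))⁻¹ i j) U :=
  (contDiffOn_gram_inv i j).continuousOn.comp (continuousOn_frame hU hf) hg

theorem integrable_testField (hU : IsOpen U) (hf : ContDiffOn ℝ 1 f U)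
    (hF : ∀ i j, IsWeakPartial U j (pd i f) (F i j))
    (hg : ∀ y ∈ U, 0 < (gram (frame f y)).det) (hνc : ContinuousOn ν U)
    (hφ : ContDiff ℝ 1 φ) (hφc : HasCompactSupport φ) (hφU : tsupport φ ⊆ U) :
    Integrable (testField f F ν φ) := by
  have hD := continuousOn_frameDensity_frame hU hf hg
  have hG := continuousOn_gram_inv_frame hU hf hg
  have hscalar : Integrable fun y =>
      φ y * (frameDensity (frame f y) * inner ℝ (ν y) (frameTrace f F y)) := by
    have h1 : ∀ i j, Integrable fun y => φ y *
        ((frameDensity (frame f y) * (gram (frame f y))⁻¹ i j) • innerSL ℝ (ν y)) (F i j y) :=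
      fun i j => integrable_mul_clm_of_tsupport hφ.continuous hφc
        (((hD.mul (hG i j)).smul ((innerSL ℝ).continuous.comp_continuousOn hνc)).mono hφU)
        ((hF i j).2.1.integrableOn_compact_subset hφU hφc)
    refine (integrable_finsetSum Finset.univ fun i _ =>
      integrable_finsetSum Finset.univ fun j _ => h1 i j).congr
      (Filter.Eventually.of_forall fun y => ?_)
    simp only [frameTrace, inner_sum, inner_smul_right, Finset.mul_sum,
      _root_.smul_apply, innerSL_apply_apply, smul_eq_mul]
    exact Finset.sum_congr rfl fun i _ => Finset.sum_congr rfl fun j _ => by ring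
  refine Integrable.add ?_ (integrable_finsetSum _ fun i _ => integrable_finsetSum _ fun j _ => ?_)
  · have h2 : IntegrableOn (fun y =>
        (φ y * (frameDensity (frame f y) * inner ℝ (ν y) (frameTrace f F y))) • ν y)
        (tsupport φ) := hscalar.integrableOn.smul_continuousOn (hνc.mono hφU) hφc
    refine (integrableOn_iff_integrable_of_support_subset fun y hy => ?_).mp h2
    exact subset_tsupport φ (left_ne_zero_of_mul (left_ne_zero_of_smul hy))
  · have h3 := integrable_smul_of_tsupport (continuous_pd hφ j) (hasCompactSupport_pd hφc j)
      ((tsupport_pd_subset φ j).trans hφU) (((hD.mul (hG i j)).smul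
        (continuousOn_pd hU hf i)).locallyIntegrableOn hU.measurableSet)
    simpa only [Pi.smul_apply', Pi.mul_apply, smul_smul] using h3

theorem contDiff_mul_of_contDiffOn {a : E m → ℝ} (hU : IsOpen U) (ha : ContDiffOn ℝ 1 a U)
    (hφ : ContDiff ℝ 1 φ) (hφU : tsupport φ ⊆ U) : ContDiff ℝ 1 fun y => φ y * a y := by
  refine contDiff_iff_contDiffAt.mpr fun y => ?_
  by_cases hy : y ∈ tsupport φ
  · exact hφ.contDiffAt.mul (ha.contDiffAt (hU.mem_nhds (hφU hy)))
  · refine (contDiffAt_const (c := (0 : ℝ))).congr_of_eventuallyEq ?_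
    filter_upwards [notMem_tsupport_iff_eventuallyEq.mp hy] with z hz
    simp [hz]

/-- The weak form of the Laplacian of `v ∘ f`. -/
theorem integral_fderiv_testField (hmn : m + 1 = n) (hU : IsOpen U) (hf : ContDiffOn ℝ 1 f U)
    (hF : ∀ i j, IsWeakPartial U j (pd i f) (F i j))
    (hg : ∀ y ∈ U, 0 < (gram (frame f y)).det) (hνc : ContinuousOn ν U)
    (hν : ∀ y ∈ U, ‖ν y‖ = 1) (hort : ∀ y ∈ U, ∀ i, inner ℝ (ν y) (pd i f y) = (0 : ℝ))
    (hφ : ContDiff ℝ 1 φ) (hφc : HasCompactSupport φ) (hφU : tsupport φ ⊆ U) {v : E n → ℝ}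
    (hv : ContDiff ℝ 2 v) :
    Integrable (fun y => φ y * (frameDensity (frame f y) *
      hyperplaneLaplacian v (f y) (ν y))) ∧
    ∫ y, fderiv ℝ v (f y) (testField f F ν φ y) =
      -∫ y, φ y * (frameDensity (frame f y) * hyperplaneLaplacian v (f y) (ν y)) := by
  have hD := continuousOn_frameDensity_frame hU hf hg
  have hv1 : ContDiff ℝ 1 (fderiv ℝ v) := hv.fderiv_right (m := 1) (by norm_num)
  have hhess : Continuous (hess v) := hv1.continuous_fderiv one_ne_zero
  have hLint : Integrable (fun y => φ y * (frameDensity (frame f y) *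
      hyperplaneLaplacian v (f y) (ν y))) := by
    refine integrable_mul_of_tsupport hφ.continuous hφc ((hD.mul ?_).mono hφU)
    have h1 : ContinuousOn (fun y => hess v (f y)) U := hhess.comp_continuousOn hf.continuousOn
    exact (continuousOn_finsetSum _ fun a _ =>
      (h1.clm_apply continuousOn_const).clm_apply continuousOn_const).sub
      ((h1.clm_apply hνc).clm_apply hνc)
  refine ⟨hLint, ?_⟩
  -- The first variation formula is used with `w = eₐ` and test function `φ ∂ₐv(f)`, then summed
  -- over `a`. Differentiating the factor `∂ₐv(f)` produces the Hessian of `v` traced over the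
  -- tangent space.
  set ψ : Fin n → E m → ℝ := fun a y => φ y * fderiv ℝ v (f y) (EuclideanSpace.single a 1) with hψ
  have hcomp : ∀ a, ContDiffOn ℝ 1 (fun y => fderiv ℝ v (f y) (EuclideanSpace.single a 1)) U :=
    fun a => (hv1.comp_contDiffOn hf).clm_apply contDiffOn_const
  have hψ1 : ∀ a, ContDiff ℝ 1 (ψ a) := fun a => contDiff_mul_of_contDiffOn hU (hcomp a) hφ hφU
  have hψs : ∀ a, tsupport (ψ a) ⊆ tsupport φ := fun a => tsupport_mul_subset_left
  have hψc : ∀ a, HasCompactSupport (ψ a) := fun a =>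
    hφc.of_isClosed_subset (isClosed_tsupport _) (hψs a)
  have hfv := fun a => weak_first_variation hmn hU hf hF hg hν hort (EuclideanSpace.single a 1)
    (hψ1 a) (hψc a) ((hψs a).trans hφU)
  have hflux : ∀ a, Integrable fun y => ∑ j, pd j (ψ a) y *
      frameFlux (EuclideanSpace.single a 1) j (frame f y) := fun a =>
    integrable_finsetSum _ fun j _ => integrable_mul_of_tsupport (continuous_pd (hψ1 a) j)
      (hasCompactSupport_pd (hψc a) j) (((contDiffOn_frameFlux _ j).continuousOn.comp
        (continuousOn_frame hU hf) hg).mono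
        ((tsupport_pd_subset _ j).trans ((hψs a).trans hφU)))
  have hsum : ∫ y, ∑ a, ((∑ j, pd j (ψ a) y * frameFlux (EuclideanSpace.single a 1) j (frame f y))
      + ψ a y * (frameDensity (frame f y) * (inner ℝ (EuclideanSpace.single a (1 : ℝ)) (ν y) *
        inner ℝ (ν y) (frameTrace f F y)))) = 0 := by
    rw [integral_finsetSum]
    swap
    · exact fun a _ => (hflux a).add (hfv a).1
    refine Finset.sum_eq_zero fun a _ => ?_
    rw [integral_add (hflux a) (hfv a).1, (hfv a).2, neg_add_cancel]
  have hpt : ∀ y, ∑ a, ((∑ j, pd j (ψ a) y *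
      frameFlux (EuclideanSpace.single a 1) j (frame f y))
      + ψ a y * (frameDensity (frame f y) * (inner ℝ (EuclideanSpace.single a (1 : ℝ)) (ν y) *
        inner ℝ (ν y) (frameTrace f F y)))) = fderiv ℝ v (f y) (testField f F ν φ y) +
      φ y * (frameDensity (frame f y) * hyperplaneLaplacian v (f y) (ν y)) := by
    intro y
    by_cases hy : y ∈ tsupport φ
    · have hyU := hφU hy
      have hpd : ∀ a j, pd j (ψ a) y = pd j φ y * fderiv ℝ v (f y) (EuclideanSpace.single a 1) +
          φ y * hess v (f y) (pd j f y) (EuclideanSpace.single a 1) := by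
        intro a j
        have hfy := ((hf.contDiffAt (hU.mem_nhds hyU)).differentiableAt one_ne_zero).hasFDerivAt
        have h1 := ((hv1.differentiable one_ne_zero (f y)).hasFDerivAt.comp y hfy).clm_apply
          (hasFDerivAt_const (EuclideanSpace.single a (1 : ℝ)) y)
        have h2 := (hφ.differentiable one_ne_zero y).hasFDerivAt.mul h1
        have h3 : fderiv ℝ (ψ a) y = _ := h2.fderiv
        rw [pd, h3]
        simp [pd]
        ring
      have hLin : ∀ (L : E n →L[ℝ] ℝ) (w : E n), ∑ a, L (EuclideanSpace.single a 1) *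
          inner ℝ (EuclideanSpace.single a (1 : ℝ)) w = L w := fun L w => by
        rw [fderiv_apply_eq_sum L w]
        exact Finset.sum_congr rfl fun a _ => by
          simp [EuclideanSpace.inner_single_left, mul_comm]
      have hhL := sum_gram_inv_bilin hmn (frame f y) (ν y) (hg y hyU).ne'.isUnit (hν y hyU)
        (hort y hyU) (hess v (f y))
      rw [Finset.sum_add_distrib]
      have hA : ∑ a, ψ a y * (frameDensity (frame f y) *
          (inner ℝ (EuclideanSpace.single a (1 : ℝ)) (ν y) *
            inner ℝ (ν y) (frameTrace f F y))) =
          φ y * (frameDensity (frame f y) * inner ℝ (ν y) (frameTrace f F y)) *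
            fderiv ℝ v (f y) (ν y) := by
        rw [← hLin (fderiv ℝ v (f y)) (ν y), Finset.mul_sum]
        exact Finset.sum_congr rfl fun a _ => by rw [hψ]; ring
      have hB : ∑ a, ∑ j, pd j (ψ a) y *
          frameFlux (EuclideanSpace.single a 1) j (frame f y) =
          ∑ i, ∑ j, (pd j φ y * (frameDensity (frame f y) * (gram (frame f y))⁻¹ i j)) *
            fderiv ℝ v (f y) (pd i f y) +
          φ y * (frameDensity (frame f y) * hyperplaneLaplacian v (f y) (ν y)) := by
        have e1 : ∀ j, ∑ a, pd j (ψ a) y *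
            frameFlux (EuclideanSpace.single a 1) j (frame f y) = ∑ i, frameDensity (frame f y) *
            (gram (frame f y))⁻¹ i j * (pd j φ y * fderiv ℝ v (f y) (pd i f y) +
              φ y * hess v (f y) (pd j f y) (pd i f y)) := by
          intro j
          simp_rw [← hLin (fderiv ℝ v (f y)) (pd _ f y), ← hLin (hess v (f y) (pd j f y))
            (pd _ f y), hpd, frameFlux, Finset.mul_sum, ← Finset.sum_add_distrib, Finset.mul_sum]
          rw [Finset.sum_comm]
          refine Finset.sum_congr rfl fun i _ => Finset.sum_congr rfl fun a _ => ?_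
          simp only [frame]
          ring
        rw [Finset.sum_comm, Finset.sum_congr rfl fun j _ => e1 j, Finset.sum_comm,
          hyperplaneLaplacian, ← hhL, Finset.mul_sum, Finset.mul_sum, ← Finset.sum_add_distrib]
        refine Finset.sum_congr rfl fun i _ => ?_
        rw [Finset.mul_sum, Finset.mul_sum, ← Finset.sum_add_distrib]
        refine Finset.sum_congr rfl fun j _ => ?_
        rw [hess_symm hv.contDiffAt (pd j f y) (pd i f y)]
        simp only [frame]
        ring
      rw [hA, hB, testField]
      simp only [map_add, map_sum, map_smul, smul_eq_mul]
      ring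
    · have h1 : φ y = 0 := image_eq_zero_of_notMem_tsupport hy
      have h2 : ∀ a j, pd j (ψ a) y = 0 := fun a j =>
        image_eq_zero_of_notMem_tsupport fun h => hy (hψs a (tsupport_pd_subset _ j h))
      have h3 : ∀ a, ψ a y = 0 := fun a => by rw [hψ]; simp [h1]
      simp [testField_eq_zero hy, h1, h2, h3]
  simp only [hpt] at hsum
  have hTint : Integrable fun y => fderiv ℝ v (f y) (testField f F ν φ y) :=
    integrable_clm_apply_of_eqOn_zero hφc
      ((hv1.continuous.comp_continuousOn hf.continuousOn).mono hφU)
      (integrable_testField hU hf hF hg hνc hφ hφc hφU) fun y hy => testField_eq_zero hy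
  rw [integral_add hTint hLint] at hsum
  linarith

/-- The weak inequality in terms of the first derivatives of `u`. -/
theorem integral_fderiv_testField_le (hn : 3 ≤ n) (hmn : m + 1 = n) {Ω : Set (E n)}
    (hΩ : IsOpen Ω) {u : E n → ℝ} (hu : ContDiffOn ℝ 1 u Ω) (hpos : ∀ x ∈ Ω, 0 < u x)
    (hvisc : ViscosityNegCone 2 u Ω) (hU : IsOpen U) (hf : ContDiffOn ℝ 1 f U)
    (hfΩ : Set.MapsTo f U Ω) (hF : ∀ i j, IsWeakPartial U j (pd i f) (F i j))
    (hg : ∀ y ∈ U, 0 < (gram (frame f y)).det) (hνc : ContinuousOn ν U)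
    (hν : ∀ y ∈ U, ‖ν y‖ = 1) (hort : ∀ y ∈ U, ∀ i, inner ℝ (ν y) (pd i f y) = (0 : ℝ))
    (hφ : ContDiff ℝ 1 φ) (hφc : HasCompactSupport φ) (hφU : tsupport φ ⊆ U)
    (hφ0 : ∀ y, 0 ≤ φ y) :
    Integrable (fun y => fderiv ℝ u (f y) (testField f F ν φ y)) ∧
    Integrable (fun y => φ y * (frameDensity (frame f y) * gradTerm u (f y) (ν y))) ∧
    ∫ y, fderiv ℝ u (f y) (testField f F ν φ y) ≤
      ∫ y, φ y * (frameDensity (frame f y) * gradTerm u (f y) (ν y)) := by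
  have hD := continuousOn_frameDensity_frame hU hf hg
  have hX := integrable_testField hU hf hF hg hνc hφ hφc hφU
  have huf : Integrable (fun y => fderiv ℝ u (f y) (testField f F ν φ y)) :=
    integrable_clm_apply_of_eqOn_zero hφc
      (((hu.continuousOn_fderiv_of_isOpen hΩ le_rfl).comp hf.continuousOn hfΩ).mono hφU)
      hX fun y hy => testField_eq_zero hy
  have hgt : Integrable (fun y => φ y * (frameDensity (frame f y) * gradTerm u (f y) (ν y))) :=
    integrable_mul_of_tsupport hφ.continuous hφc ((hD.mul
      ((continuousOn_gradTerm hn hΩ hu hpos).comp (hf.continuousOn.prodMk hνc)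
        fun y hy => ⟨hfΩ hy, Set.mem_univ _⟩)).mono hφU)
  have hφD : Integrable (fun y => φ y * frameDensity (frame f y)) :=
    integrable_mul_of_tsupport hφ.continuous hφc (hD.mono hφU)
  refine ⟨huf, hgt, ?_⟩
  set T := (∫ y, φ y * frameDensity (frame f y)) + ∫ y, ‖testField f F ν φ y‖ with hT
  have hφD0 : ∀ y, 0 ≤ φ y * frameDensity (frame f y) := fun y =>
    mul_nonneg (hφ0 y) (Real.sqrt_nonneg _)
  have hT0 : 0 ≤ T := add_nonneg (integral_nonneg hφD0) (integral_nonneg fun y => norm_nonneg _)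
  have hmain : ∀ η > 0, ∫ y, fderiv ℝ u (f y) (testField f F ν φ y) ≤
      (∫ y, φ y * (frameDensity (frame f y) * gradTerm u (f y) (ν y))) + η * T := by
    intro η hη
    -- The approximation is needed only on the compact set `f(supp φ)`. The two terms of `T` measure
    -- the error in the differential inequality and the `C¹` error paired with the test field.
    obtain ⟨v, hv, hvK⟩ := exists_smooth_approx hn hΩ hu hpos hvisc
      ((show IsCompact (tsupport φ) from hφc).image_of_continuousOn (hf.continuousOn.mono hφU))
      (by rintro _ ⟨y, hy, rfl⟩; exact hfΩ (hφU hy)) hη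
    obtain ⟨hLint, hL⟩ := integral_fderiv_testField hmn hU hf hF hg hνc hν hort hφ hφc hφU hv
    have hvf : Integrable (fun y => fderiv ℝ v (f y) (testField f F ν φ y)) :=
      integrable_clm_apply_of_eqOn_zero hφc
        (((hv.continuous_fderiv two_ne_zero).comp_continuousOn hf.continuousOn).mono hφU)
        hX fun y hy => testField_eq_zero hy
    have h1 : 0 ≤ ∫ y, (φ y * (frameDensity (frame f y) * hyperplaneLaplacian v (f y) (ν y)) +
        φ y * (frameDensity (frame f y) * gradTerm u (f y) (ν y)) +
        η * (φ y * frameDensity (frame f y))) := by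
      refine integral_nonneg fun y => ?_
      by_cases hy : y ∈ tsupport φ
      · have := mul_nonneg (hφD0 y)
          ((hvK (f y) ⟨y, hy, rfl⟩).2 (ν y) (hν y (hφU hy)))
        simp only [Pi.zero_apply]
        linarith
      · simp [image_eq_zero_of_notMem_tsupport hy]
    have h2 : Integrable fun y => φ y * (frameDensity (frame f y) *
        hyperplaneLaplacian v (f y) (ν y)) +
        φ y * (frameDensity (frame f y) * gradTerm u (f y) (ν y)) := hLint.add hgt
    rw [integral_add h2 (hφD.const_mul η), integral_add hLint hgt,
      integral_const_mul] at h1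
    have h5 : ∫ y, fderiv ℝ u (f y) (testField f F ν φ y) ≤
        ∫ y, (fderiv ℝ v (f y) (testField f F ν φ y) + η * ‖testField f F ν φ y‖) := by
      refine integral_mono huf (hvf.add (hX.norm.const_mul η)) fun y => ?_
      by_cases hy : y ∈ tsupport φ
      · have h3 := ((fderiv ℝ v (f y) - fderiv ℝ u (f y)).le_opNorm (testField f F ν φ y)).trans
          (mul_le_mul_of_nonneg_right (hvK (f y) ⟨y, hy, rfl⟩).1 (norm_nonneg _))
        have h4 := (abs_le.mp h3).1
        rw [_root_.sub_apply] at h4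
        simp only
        linarith
      · simp [testField_eq_zero hy]
    rw [integral_add hvf (hX.norm.const_mul η), integral_const_mul] at h5
    rw [hT, mul_add]
    linarith
  refine le_of_forall_pos_le_add fun ε hε => (hmain (ε / (T + 1)) (by positivity)).trans ?_
  gcongr
  rw [div_mul_eq_mul_div, div_le_iff₀ (by positivity)]
  nlinarith

end Immersion

/-! ### Mean curvature in the Euclidean and in the conformal metric -/

section Curvature

variable {m n : ℕ}

theorem inner_eq_sum_mul (v w : E n) : inner ℝ v w = ∑ a, v a * w a := by
  simp [PiLp.inner_apply, mul_comm]

theorem smul_one_inner {G : MetricField n} {x : E n} {κ : ℝ} (hG : G x = κ • 1) (v w : E n) :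
    G.inner x v w = κ * inner ℝ v w := by
  simp [MetricField.inner, hG, inner_eq_sum_mul, Matrix.one_apply, Finset.mul_sum, mul_assoc]

theorem inducedMetric_of_eq_smul {G : MetricField n} {f : E m → E n} {y : E m} {κ : ℝ}
    (hG : G (f y) = κ • 1) : inducedMetric G f y = κ • gram (frame f y) := by
  ext i j
  simp [inducedMetric, smul_one_inner hG, gram, frame]

theorem euclideanMetric_eq_smul (x : E n) : euclideanMetric n x = (1 : ℝ) • 1 := by
  simp [euclideanMetric]

theorem inducedMetric_euclideanMetric (f : E m → E n) (y : E m) :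
    inducedMetric (euclideanMetric n) f y = gram (frame f y) := by
  rw [inducedMetric_of_eq_smul (euclideanMetric_eq_smul _), one_smul]

theorem normalizeIn_of_eq_smul {G : MetricField n} {x ν : E n} {κ : ℝ} (hG : G x = κ • 1)
    (hν : ‖ν‖ = 1) : normalizeIn G x ν = (Real.sqrt κ)⁻¹ • ν := by
  rw [normalizeIn, smul_one_inner hG, real_inner_self_eq_norm_sq, hν, one_pow, mul_one]

/-- The mean curvature with respect to a metric that is conformal to the Euclidean metric and
whose Christoffel symbols have the normal component `-τ ⟨·,·⟩`. -/
theorem meanCurvature_of_eq_smul {G : MetricField n} {f : E m → E n}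
    {F : Fin m → Fin m → E m → E n} {ν : E m → E n} {y : E m} {κ τ : ℝ} (hκ : 0 < κ)
    (hG : G (f y) = κ • 1) (hg : 0 < (gram (frame f y)).det) (hν : ‖ν y‖ = 1)
    (hΓ : ∀ i j, inner ℝ (WithLp.toLp 2 fun c => ∑ a, ∑ b,
      christoffel G (f y) c a b * pd i f y a * pd j f y b) (ν y) =
        -τ * gram (frame f y) i j) :
    meanCurvature G f F ν y =
      (Real.sqrt κ)⁻¹ * (-inner ℝ (ν y) (frameTrace f F y) + m * τ) := by
  have hgu : IsUnit (gram (frame f y)).det := hg.ne'.isUnit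
  have hinv : (κ • gram (frame f y))⁻¹ = κ⁻¹ • (gram (frame f y))⁻¹ := by
    refine Matrix.inv_eq_left_inv ?_
    rw [smul_mul_smul_comm, inv_mul_cancel₀ hκ.ne', Matrix.nonsing_inv_mul _ hgu, one_smul]
  have hII : ∀ i j, secondFundamentalForm G f F ν y i j =
      κ * (Real.sqrt κ)⁻¹ * (-inner ℝ (F i j y) (ν y) + τ * gram (frame f y) i j) := by
    intro i j
    rw [secondFundamentalForm, Matrix.of_apply, smul_one_inner hG, normalizeIn_of_eq_smul hG hν,
      inner_smul_right, covariantHessian, inner_add_left, hΓ]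
    ring
  have htr : ∑ i, ∑ j, (gram (frame f y))⁻¹ i j * gram (frame f y) i j = m := by
    have h := congrArg Matrix.trace (Matrix.nonsing_inv_mul _ hgu)
    simp only [Matrix.trace, Matrix.diag, Matrix.mul_apply, Matrix.one_apply_eq,
      Finset.sum_const, Finset.card_univ, Fintype.card_fin, nsmul_eq_mul, mul_one] at h
    rw [← h]
    refine Finset.sum_congr rfl fun i _ => Finset.sum_congr rfl fun j _ => ?_
    rw [← Matrix.transpose_apply (gram (frame f y)) i j, gram_transpose]
  have hF : inner ℝ (ν y) (frameTrace f F y) =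
      ∑ i, ∑ j, (gram (frame f y))⁻¹ i j * inner ℝ (F i j y) (ν y) := by
    simp only [frameTrace, inner_sum, inner_smul_right, real_inner_comm (ν y)]
  rw [meanCurvature, inducedMetric_of_eq_smul hG, hinv, hF, ← htr]
  simp only [Matrix.trace, Matrix.diag, Matrix.mul_apply, hII, Matrix.smul_apply, smul_eq_mul]
  rw [Finset.sum_comm, Finset.sum_mul, ← Finset.sum_neg_distrib, ← Finset.sum_add_distrib,
    Finset.mul_sum]
  refine Finset.sum_congr rfl fun i _ => ?_
  rw [Finset.sum_mul, ← Finset.sum_neg_distrib, ← Finset.sum_add_distrib, Finset.mul_sum]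
  refine Finset.sum_congr rfl fun j _ => ?_
  rw [gram_inv_symm _ j i]
  field_simp

theorem meanCurvature_euclideanMetric {f : E m → E n}
    {F : Fin m → Fin m → E m → E n} {ν : E m → E n} {y : E m}
    (hg : 0 < (gram (frame f y)).det) (hν : ‖ν y‖ = 1) :
    meanCurvature (euclideanMetric n) f F ν y = -inner ℝ (ν y) (frameTrace f F y) := by
  have hΓ : ∀ c a b, christoffel (euclideanMetric n) (f y) c a b = 0 := fun c a b => by
    simp [christoffel, euclideanMetric, pd]
  rw [meanCurvature_of_eq_smul (κ := 1) (τ := 0) one_pos (euclideanMetric_eq_smul _) hg hν]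
  · simp
  · intro i j
    simp [hΓ, inner_eq_sum_mul]

theorem christoffel_conformalMetric {u : E n → ℝ} {x : E n} (hu : DifferentiableAt ℝ u x)
    (hpos : 0 < u x) (c a b : Fin n) :
    christoffel (conformalMetric u) x c a b = 2 / (((n : ℝ) - 2) * u x) *
      (pd a u x * (1 : Matrix (Fin n) (Fin n) ℝ) b c +
        pd b u x * (1 : Matrix (Fin n) (Fin n) ℝ) a c -
        pd c u x * (1 : Matrix (Fin n) (Fin n) ℝ) a b) := by
  set s : ℝ := 4 / ((n : ℝ) - 2) with hs
  have hκ : 0 < u x ^ s := Real.rpow_pos_of_pos hpos s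
  have hpd : ∀ d a b, pd d (fun z => conformalMetric u z a b) x =
      s * u x ^ (s - 1) * pd d u x * (1 : Matrix (Fin n) (Fin n) ℝ) a b := by
    intro d a b
    have h1 := (hu.hasFDerivAt.rpow_const (p := s) (Or.inl hpos.ne')).mul_const
      ((1 : Matrix (Fin n) (Fin n) ℝ) a b)
    have h2 : fderiv ℝ (fun z => conformalMetric u z a b) x = _ := h1.fderiv
    rw [pd, h2]
    simp [pd]
    ring
  have hinv : (conformalMetric u x)⁻¹ = (u x ^ s)⁻¹ • 1 := by
    refine Matrix.inv_eq_left_inv ?_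
    rw [conformalMetric, smul_mul_smul_comm, inv_mul_cancel₀ hκ.ne', one_mul, one_smul]
  have hpow : u x ^ (s - 1) = u x ^ s / u x := Real.rpow_sub_one hpos.ne' s
  simp only [christoffel, hpd, hinv, Matrix.smul_apply, smul_eq_mul, Matrix.one_apply (i := c),
    mul_ite, mul_one, mul_zero, ite_mul, zero_mul, Finset.sum_ite_eq, Finset.mem_univ, if_true,
    hpow]
  rw [show 2 / (((n : ℝ) - 2) * u x) = s / (2 * u x) by
    rw [hs, div_div, div_eq_div_iff_comm]; ring]
  field_simp

theorem sum_pd_mul {u : E n → ℝ} {x : E n} (v : E n) : ∑ a, pd a u x * v a = fderiv ℝ u x v := by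
  rw [fderiv_apply_eq_sum (fderiv ℝ u x) v]
  exact Finset.sum_congr rfl fun a _ => by simp [pd, mul_comm]

/-- Two of the three terms of the conformal Christoffel symbols point along `v` and `w`, so only the
gradient term has a normal component. -/
theorem inner_christoffel_conformalMetric {u : E n → ℝ} {x : E n} (hu : DifferentiableAt ℝ u x)
    (hpos : 0 < u x) (v w ν : E n) (hv : inner ℝ ν v = (0 : ℝ)) (hw : inner ℝ ν w = (0 : ℝ)) :
    inner ℝ (WithLp.toLp 2 fun c => ∑ a, ∑ b,
      christoffel (conformalMetric u) x c a b * v a * w b) ν =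
        -(2 / (((n : ℝ) - 2) * u x) * fderiv ℝ u x ν) * inner ℝ v w := by
  have hc : ∀ c, ∑ a, ∑ b, christoffel (conformalMetric u) x c a b * v a * w b =
      2 / (((n : ℝ) - 2) * u x) * (fderiv ℝ u x v * w c + fderiv ℝ u x w * v c -
        pd c u x * inner ℝ v w) := by
    intro c
    simp only [christoffel_conformalMetric hu hpos, ← sum_pd_mul v, ← sum_pd_mul w,
      inner_eq_sum_mul]
    have e : ∀ a b, 2 / (((n : ℝ) - 2) * u x) *
        (pd a u x * (1 : Matrix (Fin n) (Fin n) ℝ) b c +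
          pd b u x * (1 : Matrix (Fin n) (Fin n) ℝ) a c -
          pd c u x * (1 : Matrix (Fin n) (Fin n) ℝ) a b) * v a * w b =
        2 / (((n : ℝ) - 2) * u x) * ((pd a u x * v a) * (if b = c then w b else 0) +
          (if a = c then v a else 0) * (pd b u x * w b) -
          pd c u x * (if a = b then v a * w b else 0)) := by
      intro a b
      simp only [Matrix.one_apply]
      split_ifs <;> ring
    simp only [e, ← Finset.mul_sum, Finset.sum_sub_distrib, Finset.sum_add_distrib,
      Finset.sum_ite_eq, Finset.sum_ite_eq', Finset.mem_univ, if_true, ← Finset.sum_mul]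
    ring
  simp only [inner_eq_sum_mul] at hv hw ⊢
  simp only [hc, inner_eq_sum_mul]
  have e2 : ∀ c, 2 / (((n : ℝ) - 2) * u x) * (fderiv ℝ u x v * w c + fderiv ℝ u x w * v c -
      pd c u x * ∑ a, v a * w a) * ν c = 2 / (((n : ℝ) - 2) * u x) *
      (fderiv ℝ u x v * (ν c * w c) + fderiv ℝ u x w * (ν c * v c) -
        (pd c u x * ν c) * ∑ a, v a * w a) := fun c => by ring
  simp only [e2, ← Finset.mul_sum, Finset.sum_sub_distrib, Finset.sum_add_distrib, hv, hw,
    ← Finset.sum_mul, sum_pd_mul]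
  ring

/-- The conformal transformation law of the mean curvature: `τ` is half the normal derivative of the
logarithm of the conformal factor, and the unit normal is rescaled. -/
theorem meanCurvature_conformalMetric {u : E n → ℝ} {f : E m → E n}
    {F : Fin m → Fin m → E m → E n} {ν : E m → E n} {y : E m}
    (hu : DifferentiableAt ℝ u (f y)) (hpos : 0 < u (f y))
    (hg : 0 < (gram (frame f y)).det) (hν : ‖ν y‖ = 1)
    (hort : ∀ i, inner ℝ (ν y) (pd i f y) = (0 : ℝ)) :
    meanCurvature (conformalMetric u) f F ν y =
      (Real.sqrt (u (f y) ^ (4 / ((n : ℝ) - 2))))⁻¹ * (-inner ℝ (ν y) (frameTrace f F y) +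
        m * (2 / (((n : ℝ) - 2) * u (f y)) * fderiv ℝ u (f y) (ν y))) := by
  refine meanCurvature_of_eq_smul (Real.rpow_pos_of_pos hpos _) rfl hg hν fun i j => ?_
  exact inner_christoffel_conformalMetric hu hpos _ _ _ (hort i) (hort j)

theorem gradInner_comp {u : E n → ℝ} {f : E m → E n} {y : E m} (hu : DifferentiableAt ℝ u (f y))
    (hf : DifferentiableAt ℝ f y) (w : E m → ℝ) :
    gradInner (inducedMetric (euclideanMetric n) f) (u ∘ f) w y =
      ∑ i, ∑ j, (gram (frame f y))⁻¹ i j * fderiv ℝ u (f y) (pd i f y) * pd j w y := by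
  have h : ∀ i, pd i (u ∘ f) y = fderiv ℝ u (f y) (pd i f y) := fun i => by
    rw [pd, fderiv_comp y hu hf]; rfl
  simp only [gradInner, inducedMetric_euclideanMetric, h]

theorem gradInner_comp_self (hmn : m + 1 = n) {u : E n → ℝ} {f : E m → E n} {y : E m}
    (hu : DifferentiableAt ℝ u (f y)) (hf : DifferentiableAt ℝ f y) {ν : E n}
    (hg : 0 < (gram (frame f y)).det) (hν : ‖ν‖ = 1)
    (hort : ∀ i, inner ℝ ν (pd i f y) = (0 : ℝ)) :
    gradInner (inducedMetric (euclideanMetric n) f) (u ∘ f) (u ∘ f) y =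
      ∑ k, pd k u (f y) ^ 2 - fderiv ℝ u (f y) ν ^ 2 := by
  have h := sum_gram_inv_bilin hmn (frame f y) ν hg.ne'.isUnit hν hort
    ((ContinuousLinearMap.lsmul ℝ ℝ).bilinearComp (fderiv ℝ u (f y)) (fderiv ℝ u (f y)))
  simp only [ContinuousLinearMap.bilinearComp_apply, ContinuousLinearMap.lsmul_apply,
    smul_eq_mul, ← sq] at h
  rw [gradInner_comp hu hf]
  refine Eq.trans ?_ h
  refine Finset.sum_congr rfl fun i _ => Finset.sum_congr rfl fun j _ => ?_
  have hj : pd j (u ∘ f) y = fderiv ℝ u (f y) (pd j f y) := by rw [pd, fderiv_comp y hu hf]; rfl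
  rw [hj, mul_assoc]
  rfl

/-- The curvature terms of the inequality, in terms of the first derivatives of `u`. -/
theorem obstruction_terms_eq (hn : 3 ≤ n) (hmn : m + 1 = n) {u : E n → ℝ} {f : E m → E n}
    {F : Fin m → Fin m → E m → E n} {ν : E m → E n} {y : E m}
    (hu : DifferentiableAt ℝ u (f y)) (hpos : 0 < u (f y)) (hf : DifferentiableAt ℝ f y)
    (hg : 0 < (gram (frame f y)).det) (hν : ‖ν y‖ = 1)
    (hort : ∀ i, inner ℝ (ν y) (pd i f y) = (0 : ℝ)) :
    ((n : ℝ) - 2) / (4 * ((n : ℝ) - 1)) * meanCurvature (conformalMetric u) f F ν y ^ 2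
        * u (f y) ^ (((n : ℝ) + 2) / ((n : ℝ) - 2))
      - ((n : ℝ) - 2) / (4 * ((n : ℝ) - 1)) * meanCurvature (euclideanMetric n) f F ν y ^ 2
        * u (f y)
      - 1 / (((n : ℝ) - 2) * u (f y))
        * gradInner (inducedMetric (euclideanMetric n) f) (u ∘ f) (u ∘ f) y =
      -inner ℝ (ν y) (frameTrace f F y) * fderiv ℝ u (f y) (ν y) + gradTerm u (f y) (ν y) := by
  have hn3 : (3 : ℝ) ≤ n := by exact_mod_cast hn
  have hn2 : (0 : ℝ) < (n : ℝ) - 2 := by linarith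
  have hn1 : (0 : ℝ) < (n : ℝ) - 1 := by linarith
  have hm : (m : ℝ) = (n : ℝ) - 1 := by rw [← hmn]; push_cast; ring
  have hκ : 0 < u (f y) ^ (4 / ((n : ℝ) - 2)) := Real.rpow_pos_of_pos hpos _
  have hpow : u (f y) ^ (((n : ℝ) + 2) / ((n : ℝ) - 2)) =
      u (f y) ^ (4 / ((n : ℝ) - 2)) * u (f y) := by
    rw [← Real.rpow_add_one hpos.ne']
    congr 1
    field_simp
    ring
  rw [meanCurvature_euclideanMetric hg hν, meanCurvature_conformalMetric hu hpos hg hν hort,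
    gradInner_comp_self hmn hu hf hg hν hort, mul_pow, inv_pow, Real.sq_sqrt hκ.le, hpow, gradTerm,
    hm]
  -- The factor `u^{4/(n-2)}` cancels against the square of the rescaling. Expanding the square, the
  -- `H²` terms cancel, the cross term is `H u_ν`, and the `u_ν²` terms combine to `n
  -- u_ν²/((n-2)u)`.
  field_simp
  ring

end Curvature

/-! ### Assembly of the inequality for immersions -/

theorem det_gram_pos {m n : ℕ} {t : Fin m → E n} (ht : LinearIndependent ℝ t) :
    0 < (gram t).det :=
  (Matrix.posDef_gram_of_linearIndependent (𝕜 := ℝ) ht).det_pos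

theorem det_gram_frame_pos {m n : ℕ} {f : E m → E n} {y : E m}
    (h : Function.Injective (fderiv ℝ f y)) : 0 < (gram (frame f y)).det := by
  refine det_gram_pos ?_
  have h1 := (EuclideanSpace.basisFun (Fin m) ℝ).toBasis.linearIndependent.map'
    (fderiv ℝ f y).toLinearMap (LinearMap.ker_eq_bot.mpr h)
  have h2 : frame f y = (fderiv ℝ f y).toLinearMap ∘ (EuclideanSpace.basisFun (Fin m) ℝ).toBasis := by
    ext1 i
    simp [frame, pd]
  rw [h2]
  exact h1

/-- On the open ball, the integrand of the weak inequality is `-du(X) + φ √g (n u_ν² -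
|∇u|²)/((n-2)u)`, where `X` is `testField`: its normal part supplies `H u_ν`, its tangential part
the gradient product with `φ`. -/
theorem obstructionInequality_of_immersion {m n : ℕ} (hn : 3 ≤ n) (hmn : m + 1 = n) {p : ℝ≥0∞}
    {Ω : Set (E n)} (hΩ : IsOpen Ω) {u : E n → ℝ} (hu : ContDiffOn ℝ 1 u Ω)
    (hpos : ∀ x ∈ Ω, 0 < u x) (hvisc : ViscosityNegCone 2 u Ω) {f : E m → E n}
    {F : Fin m → Fin m → E m → E n} {ν : E m → E n}
    (hf : IsC1W2Immersion p (Metric.closedBall 0 1) f F)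
    (hfΩ : Set.MapsTo f (Metric.closedBall 0 1) Ω) (hν : IsUnitNormalAlong f ν) :
    ObstructionInequality u f F ν := by
  set U : Set (E m) := Metric.ball 0 1 with hUdef
  have hU : IsOpen U := Metric.isOpen_ball
  have hUc : U ⊆ Metric.closedBall 0 1 := Metric.ball_subset_closedBall
  have hint : interior (Metric.closedBall (0 : E m) 1) = U := interior_closedBall _ one_ne_zero
  have hf1 : ContDiffOn ℝ 1 f U := hf.contDiffOn.mono hUc
  have hF : ∀ i j, IsWeakPartial U j (pd i f) (F i j) := fun i j => hint ▸ hf.isWeakPartial i j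
  have hg : ∀ y ∈ U, 0 < (gram (frame f y)).det := by
    intro y hy
    refine det_gram_frame_pos ?_
    have h := hf.injective y (hUc hy)
    rwa [fderivWithin_of_mem_nhds (Filter.mem_of_superset (hU.mem_nhds hy) hUc)] at h
  have hort : ∀ y ∈ U, ∀ i, inner ℝ (ν y) (pd i f y) = (0 : ℝ) := fun y hy i => hν.normal y hy _
  have hmaps : Set.MapsTo f U Ω := hfΩ.mono_left hUc
  have hfd : ∀ y ∈ U, DifferentiableAt ℝ f y := fun y hy =>
    (hf1.contDiffAt (hU.mem_nhds hy)).differentiableAt one_ne_zero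
  have hud : ∀ y ∈ U, DifferentiableAt ℝ u (f y) := fun y hy =>
    (hu.contDiffAt (hΩ.mem_nhds (hmaps hy))).differentiableAt one_ne_zero
  intro φ hφ hφc hφU hφ0
  have hφU' : tsupport φ ⊆ U := hφU
  obtain ⟨hi1, hi2, hle⟩ := integral_fderiv_testField_le hn hmn hΩ hu hpos hvisc hU hf1 hmaps hF hg
    hν.continuousOn hν.norm_eq_one hort hφ hφc hφU hφ0
  have hvol : ∀ y, volDensity (inducedMetric (euclideanMetric n) f) y = frameDensity (frame f y) :=
    fun y => by rw [volDensity, inducedMetric_euclideanMetric, frameDensity]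
  have hgrad : ∀ y ∈ U, gradInner (inducedMetric (euclideanMetric n) f) (u ∘ f) φ y *
      volDensity (inducedMetric (euclideanMetric n) f) y =
      ∑ i, ∑ j, pd j φ y * (frameDensity (frame f y) * (gram (frame f y))⁻¹ i j *
        fderiv ℝ u (f y) (pd i f y)) := by
    intro y hy
    rw [gradInner_comp (hud y hy) (hfd y hy), hvol, Finset.sum_mul]
    refine Finset.sum_congr rfl fun i _ => ?_
    rw [Finset.sum_mul]
    exact Finset.sum_congr rfl fun j _ => by ring
  have hgi : Integrable fun y => ∑ i, ∑ j, pd j φ y * (frameDensity (frame f y) *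
      (gram (frame f y))⁻¹ i j * fderiv ℝ u (f y) (pd i f y)) := by
    refine integrable_finsetSum _ fun i _ => integrable_finsetSum _ fun j _ =>
      integrable_mul_of_tsupport (continuous_pd hφ j) (hasCompactSupport_pd hφc j)
        (ContinuousOn.mono ?_ ((tsupport_pd_subset φ j).trans hφU'))
    exact ((continuousOn_frameDensity_frame hU hf1 hg).mul
      (continuousOn_gram_inv_frame hU hf1 hg i j)).mul
      (((hu.continuousOn_fderiv_of_isOpen hΩ le_rfl).comp hf1.continuousOn hmaps).clm_apply
        (continuousOn_pd hU hf1 i))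
  have hi3 : Integrable fun y => -fderiv ℝ u (f y) (testField f F ν φ y) +
      φ y * (frameDensity (frame f y) * gradTerm u (f y) (ν y)) := hi1.neg.add hi2
  have hdecomp : ∀ y, fderiv ℝ u (f y) (testField f F ν φ y) = φ y * (frameDensity (frame f y) *
      inner ℝ (ν y) (frameTrace f F y)) * fderiv ℝ u (f y) (ν y) + ∑ i, ∑ j, pd j φ y *
      (frameDensity (frame f y) * (gram (frame f y))⁻¹ i j * fderiv ℝ u (f y) (pd i f y)) := by
    intro y
    simp only [testField, map_add, map_sum, map_smul, smul_eq_mul, mul_assoc]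
  refine ⟨?_, ?_, ?_⟩
  · exact hgi.integrableOn.congr_fun (fun y hy => (hgrad y hy).symm) hU.measurableSet
  -- The term `R φ √g` is the full integrand plus the gradient product, both already known to be
  -- integrable.
  · refine (hi3.add hgi).integrableOn.congr_fun (fun y hy => ?_) hU.measurableSet
    simp only [Pi.add_apply]
    rw [obstruction_terms_eq hn hmn (hud y hy) (hpos _ (hmaps hy)) (hfd y hy) (hg y hy)
      (hν.norm_eq_one y hy) (hort y hy), hvol, hdecomp]
    ring
  · have h1 : ∫ y in U, (-fderiv ℝ u (f y) (testField f F ν φ y) +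
        φ y * (frameDensity (frame f y) * gradTerm u (f y) (ν y))) =
        ∫ y, (-fderiv ℝ u (f y) (testField f F ν φ y) +
        φ y * (frameDensity (frame f y) * gradTerm u (f y) (ν y))) := by
      refine setIntegral_eq_integral_of_forall_compl_eq_zero fun y hy => ?_
      have hy' : y ∉ tsupport φ := fun h => hy (hφU' h)
      rw [testField_eq_zero hy', image_eq_zero_of_notMem_tsupport hy']
      simp
    have h2 : 0 ≤ ∫ y in U, (-fderiv ℝ u (f y) (testField f F ν φ y) +
        φ y * (frameDensity (frame f y) * gradTerm u (f y) (ν y))) := by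
      have h3 := integral_add hi1.neg hi2
      simp only [Pi.neg_apply, integral_neg] at h3
      rw [h1, h3]
      linarith
    refine h2.trans_eq (setIntegral_congr_fun hU.measurableSet fun y hy => ?_)
    simp only
    rw [obstruction_terms_eq hn hmn (hud y hy) (hpos _ (hmaps hy)) (hfd y hy) (hg y hy)
      (hν.norm_eq_one y hy) (hort y hy), add_mul, neg_mul, hgrad y hy, hvol, hdecomp]
    ring

end Obstruction

end
open Obstruction in
theorem mainTheorem5 (n : ℕ) (hn : 3 ≤ n) (p : ℝ≥0∞) (hp : 2 ≤ p)
    (Ω : Set (E n)) (hΩ : IsOpen Ω)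
    (u : E n → ℝ) (hu : ContDiffOn ℝ 1 u Ω) (hpos : ∀ x ∈ Ω, 0 < u x)
    (hvisc : ViscosityNegCone 2 u Ω) :
    (∀ (f : E (n - 1) → E n) (F : Fin (n - 1) → Fin (n - 1) → E (n - 1) → E n)
        (ν : E (n - 1) → E n),
        IsC1W2Immersion p (Metric.closedBall 0 1) f F →
        Set.MapsTo f (Metric.closedBall 0 1) Ω →
        IsUnitNormalAlong f ν →
        ObstructionInequality u f F ν) ∧
    (∀ (S : Set (E n)) (ν : E n → E n),
        IsHypersurface p S → S ⊆ Ω → IsUnitNormalOn p S ν →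
        ∀ (f : E (n - 1) → E n) (F : Fin (n - 1) → Fin (n - 1) → E (n - 1) → E n),
          IsLocalParam p S f F → ObstructionInequality u f F (ν ∘ f)) := by
  have hmn : n - 1 + 1 = n := by omega
  refine ⟨fun f F ν hf hfΩ hν =>
    obstructionInequality_of_immersion hn hmn hΩ hu hpos hvisc hf hfΩ hν,
    fun S ν _ hSΩ hν f F hf => ?_⟩
  have hf1 := hf.1
  have hmaps := hf.2.2
  have hsub : Metric.ball (0 : E (n - 1)) 1 ⊆ Metric.closedBall 0 1 :=
    Metric.ball_subset_closedBall
  -- A local parametrization is an immersion of the closed ball into `Ω`, and `ν ∘ f` is a unit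
  -- normal along it, so the embedded case is an instance of the immersed one.
  refine obstructionInequality_of_immersion hn hmn hΩ hu hpos hvisc hf1
    (fun y hy => hSΩ (hmaps hy).1) ⟨?_, fun y hy => hν.norm_eq_one _ (hmaps (hsub hy)),
      hν.normal f F hf⟩
  exact (hν.continuousOn.comp hf1.contDiffOn.continuousOn hmaps).mono hsub
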